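/- **Theorem (García–Macías–Puetzfeld–Socorro electrovacuum).** *Theory.* Work on domains of $\mathbb R^4$ with Lorentzian signature $(+,-,-,-)$. The fields are a coframe $\vartheta^a$ with metric $g_{ab}$, a linear connection $\Gamma_a{}^b$ and an electromagnetic potential $A$, with $T^a=d\vartheta^a+\Gamma_b{}^a\wedge\vartheta^b$, $Q_{ab}=-Dg_{ab}$, $R_a{}^b=d\Gamma_a{}^b+\Gamma_c{}^b\wedge\Gamma_a{}^c$, $F=dA$. Given real constants $\kappa\neq0$, $\rho\neq0$, $\lambda$, $a_0,\dots,a_3$, $b_1,\dots,b_5$, $c_1,c_2,c_3$, $z_5$, the Lagrangian is $$L=-\tfrac1{2\kappa}\Big[2\lambda\,\mathrm{vol}-a_0R^{ab}\wedge\star\vartheta_{ab}+T^a\wedge\star\sum_{I=1}^3a_I{}^{(I)}T_a+Q_{ab}\wedge\star\sum_{I=1}^4b_I{}^{(I)}Q^{ab}+2b_5({}^{(3)}Q_{ac}\wedge\vartheta^a)\wedge\star({}^{(4)}Q^{bc}\wedge\vartheta_b)-2\sum_{I=1}^3c_I{}^{(I+1)}Q_{ab}\wedge\vartheta^a\wedge\star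 T^b\Big]-\tfrac{z_5}{2\rho}{}^{(5)}Z_{ab}\wedge\star{}^{(5)}Z^{ab}-\tfrac12F\wedge\star F .$$ Here ${}^{(2)}T^a=\frac13\vartheta^a\wedge T$ with $T=e_a\rfloor T^a$, ${}^{(3)}T^a=\frac13e^a\rfloor(T^b\wedge\vartheta_b)$ and ${}^{(1)}T^a$ is the rest of the torsion; ${}^{(4)}Q_{ab}=g_{ab}Q$ with $Q=\frac14Q_c{}^c$, ${}^{(3)}Q_{ab}=\frac49(\vartheta_{(a}e_{b)}\rfloor\Lambda-\frac14g_{ab}\Lambda)$ with $\Lambda=\vartheta^ae^b\rfloor(Q_{ab}-g_{ab}Q)$, ${}^{(1)}Q_{ab}$ is the trace-free totally symmetric part and ${}^{(2)}Q_{ab}$ the rest of the nonmetricity; ${}^{(5)}Z_{ab}=\frac14g_{ab}R_c{}^c$. A configuration is a *solution* on an open set $U$ if the variational derivatives of $L$ with respect to the coframe, the connection and $A$ vanish on $U$. Put $$k_0=4(a_2-2a_0)(\tfrac{a_0}8+b_3)-3(a_0-c_2)^2,\quad k_1=\tfrac92(a_2-2a_0)(2b_5-a_0)-9(a_0-c_2)(a_0-c_3),\quad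 k_2=12(\tfrac{a_0}8+b_3)(a_0-c_3)-\tfrac92(2b_5-a_0)(a_0-c_2),$$ assume $k_0\ne0$, and let $$m^2=-\tfrac1{z_5\kappa}\Big(-4b_4+\tfrac32a_0+\tfrac{k_1}{2k_0}(2b_5-a_0)+\tfrac{k_2}{k_0}(a_0-c_3)\Big).$$ *Configurations.* In coordinates $(u,v,\zeta,\bar\zeta)$ on an open set $U$, take smooth functions $\alpha(u)$ (real), $\beta(u)$ (complex), $\mathcal H(u,\zeta,\bar\zeta)$ (real), and functions $f(\zeta,u)$, $g(\zeta,u)$, holomorphic in $\zeta$, with holomorphic $\zeta$-primitives $\int^\zeta f$, $\int^\zeta g$ that are smooth in all variables. Let $$P=1+\tfrac\lambda6\zeta\bar\zeta,\quad Q=(1-\tfrac\lambda6\zeta\bar\zeta)\alpha+\zeta\bar\beta+\bar\zeta\beta,\quad S=-v^2\big(\tfrac\lambda6\alpha^2+\beta\bar\beta\big)+v\,\partial_u\ln|Q|+\tfrac{P}{2Q}\mathcal H,$$ with $P$, $Q$ nowhere zero on $U$. (This function $Q$ is not the 1-form $Q$ above.) The metric is $$ds^2=2\,du\,\big(\tfrac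 QP\big)^2(S\,du+dv)-\tfrac2{P^2}d\zeta\,d\bar\zeta ,$$ the torsion and the nonmetricity are pure trace (${}^{(1)}T^a={}^{(3)}T^a=0$, ${}^{(1)}Q_{ab}={}^{(2)}Q_{ab}=0$) with traces $k_0\phi$ (Weyl 1-form), $\Lambda=k_1\phi$, $T=k_2\phi$, and $$\phi=\Big(\int^\zeta g+\overline{\int^\zeta g}\Big)du,\qquad A=\Big(\int^\zeta f+\overline{\int^\zeta f}\Big)du .$$ *Claim.* Consider the constraints $$a_0=1,\qquad z_5=\rho/k_0^2,\qquad m^2=0 \tag{C}$$ and the wave equation on $U$ $$\partial_\zeta\partial_{\bar\zeta}\mathcal H+\frac{\lambda}{3P^2}\mathcal H=\frac{2\kappa P}{Q}\big(|f|^2+|g|^2\big). \tag{W}$$ 1. If (C) holds, then a configuration is a solution if and only if it satisfies (W). 2. Conversely, if every configuration that satisfies (W) is a solution, then (C) holds. Thus, for a given theory, (W) is sufficient for a configuration to be a solution if and only if (C) holds, and (W) is then also necessary. 3. The necessity of (C) can be seen on a single configuration: if a configuration satisfies (W) and is a solution, if $g\not\equiv0$ on $U$ and if, in case $\lambda=0$,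 $|f|^2$ is not a constant multiple of $|g|^2$ on $U$, then (C) holds. -/

import Mathlib

open scoped ContDiff

noncomputable section

namespace MAG

/-! Four-dimensional metric-affine gravity in a coordinate domain of `ℝ⁴`, signature `(+,-,-,-)`. -/

/-- Points of the coordinate space `ℝ⁴`. -/
abbrev Pt := Fin 4 → ℝ
/-- Arrays with one index. -/
abbrev Arr1 := Fin 4 → ℝ
/-- Arrays with two indices. -/
abbrev Arr2 := Fin 4 → Fin 4 → ℝ
/-- Arrays with three indices. -/
abbrev Arr3 := Fin 4 → Fin 4 → Fin 4 → ℝ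
/-- Arrays with four indices. -/
abbrev Arr4 := Fin 4 → Fin 4 → Fin 4 → Fin 4 → ℝ

/-- The coordinate partial derivative `∂_ν q`. -/
def pd {V : Type} [NormedAddCommGroup V] [NormedSpace ℝ V] (ν : Fin 4) (q : Pt → V) (x : Pt) : V :=
  fderiv ℝ q x (Pi.single ν 1)

/-! ### The fields and their first jets -/

/-- The fields: anholonomic metric `g a b`, coframe `e μ a` (`θ^a = e_μ^a dx^μ`),
connection `Γ μ a b` (`Γ_a^b = Γ_{μ a}^b dx^μ`), electromagnetic potential `A μ`. -/
structure Fields where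
  g : Pt → Arr2
  e : Pt → Arr2
  Γ : Pt → Arr3
  A : Pt → Arr1

/-- The values and first partial derivatives of the fields at a point; the first index of
`dg`, `de`, `dΓ`, `dA` is the direction of differentiation. -/
structure Jet where
  g : Arr2
  dg : Fin 4 → Arr2
  e : Arr2
  de : Fin 4 → Arr2
  Γ : Arr3
  dΓ : Fin 4 → Arr3
  A : Arr1
  dA : Fin 4 → Arr1

/-- The first jet of the fields at `x`. -/
def Fields.jet (Φ : Fields) (x : Pt) : Jet where
  g := Φ.g x
  dg := fun ν => pd ν Φ.g x
  e := Φ.e x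
  de := fun ν => pd ν Φ.e x
  Γ := Φ.Γ x
  dΓ := fun ν => pd ν Φ.Γ x
  A := Φ.A x
  dA := fun ν => pd ν Φ.A x

namespace Jet

variable (J : Jet)

/-- The dual frame: `frame a μ = e^μ_a`. -/
def frame : Arr2 := fun a μ => (Matrix.of J.e)⁻¹ a μ

/-- The inverse anholonomic metric `g^{ab}`. -/
def gi : Arr2 := fun a b => (Matrix.of J.g)⁻¹ a b

/-- Frame components of a 1-form given by its coordinate components. -/
def ofOneForm (φ : Arr1) : Arr1 := fun a => ∑ μ, J.frame a μ * φ μ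

/-- Frame components of a 2-form given by its coordinate components. -/
def ofTwoForm (X : Arr2) : Arr2 := fun a b => ∑ μ, ∑ ν, J.frame a μ * J.frame b ν * X μ ν

/-- `torsion m n c = T_{mn c}`, the frame components of the torsion 2-form
`T^c = dθ^c + Γ_a^c ∧ θ^a`, with the index `c` lowered. -/
def torsion : Arr3 := fun m n c =>
  ∑ d, J.g c d * J.ofTwoForm (fun μ ν => J.de μ ν d - J.de ν μ d
    + ∑ a, (J.Γ μ a d * J.e ν a - J.Γ ν a d * J.e μ a)) m n

/-- `nonmet m a b = Q_{m ab}`, the frame components of the nonmetricity 1-form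
`Q_{ab} = - D g_{ab} = - d g_{ab} + Γ_a^c g_{cb} + Γ_b^c g_{ac}`. -/
def nonmet : Arr3 := fun m a b =>
  J.ofOneForm (fun μ => - J.dg μ a b
    + ∑ c, (J.Γ μ a c * J.g c b + J.Γ μ b c * J.g a c)) m

/-- `curv m n a b = R_{mn a}^b`, the frame components of the curvature 2-form
`R_a^b = dΓ_a^b + Γ_c^b ∧ Γ_a^c`. -/
def curv : Arr4 := fun m n a b =>
  J.ofTwoForm (fun μ ν => J.dΓ μ ν a b - J.dΓ ν μ a b
    + ∑ c, (J.Γ μ c b * J.Γ ν a c - J.Γ ν c b * J.Γ μ a c)) m n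

/-- `curvLow m n a b = R_{mn ab}`. -/
def curvLow : Arr4 := fun m n a b => ∑ c, J.curv m n a c * J.g c b

/-- Frame components of the electromagnetic field `F = dA`. -/
def fieldStrength : Arr2 := J.ofTwoForm (fun μ ν => J.dA μ ν - J.dA ν μ)

/-- Full contraction of two 2-index arrays. -/
def ip2 (X Y : Arr2) : ℝ :=
  ∑ a, ∑ b, ∑ a', ∑ b', J.gi a a' * J.gi b b' * X a b * Y a' b'

/-- Full contraction of two 3-index arrays. -/
def ip3 (X Y : Arr3) : ℝ :=
  ∑ a, ∑ b, ∑ c, ∑ a', ∑ b', ∑ c', J.gi a a' * J.gi b b' * J.gi c c' * X a b c * Y a' b' c'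

/-- Full contraction of two 4-index arrays. -/
def ip4 (X Y : Arr4) : ℝ :=
  ∑ a, ∑ b, ∑ c, ∑ d, ∑ a', ∑ b', ∑ c', ∑ d',
    J.gi a a' * J.gi b b' * J.gi c c' * J.gi d d' * X a b c d * Y a' b' c' d'

/-! ### Irreducible parts (`D = 4`) -/

/-- The Weyl 1-form `Q = (1/4) Q_c^c`. -/
def traceQ : Arr1 := fun m => (1 / 4) * ∑ b, ∑ c, J.gi b c * J.nonmet m b c

/-- The 1-form `Λ = θ^a e^b⌋(Q_{ab} - g_{ab} Q)`. -/
def traceLam : Arr1 := fun m => (∑ b, ∑ c, J.gi b c * J.nonmet b c m) - J.traceQ m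

/-- The trace 1-form of the torsion, `T = e_a⌋T^a`. -/
def traceT : Arr1 := fun m => ∑ b, ∑ c, J.gi b c * J.torsion b m c

/-- `⁽²⁾T^a = (1/3) θ^a ∧ T`. -/
def tor2 : Arr3 := fun m n a => (1 / 3) * (J.g m a * J.traceT n - J.g n a * J.traceT m)

/-- `⁽³⁾T^a = (1/3) e^a⌋(T^b ∧ θ_b)`. -/
def tor3 : Arr3 := fun m n a => (1 / 3) * (J.torsion m n a + J.torsion n a m + J.torsion a m n)

/-- `⁽¹⁾T^a`, the remaining part of the torsion. -/
def tor1 : Arr3 := fun m n a => J.torsion m n a - J.tor2 m n a - J.tor3 m n a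

/-- `⁽⁴⁾Q_{ab} = g_{ab} Q`. -/
def non4 : Arr3 := fun m a b => J.g a b * J.traceQ m

/-- `⁽³⁾Q_{ab} = (4/9) (θ_{(a} e_{b)}⌋Λ - (1/4) g_{ab} Λ)`. -/
def non3 : Arr3 := fun m a b =>
  (4 / 9) * ((1 / 2) * (J.g m a * J.traceLam b + J.g m b * J.traceLam a)
    - (1 / 4) * (J.g a b * J.traceLam m))

/-- The 2-form `Ω_a = (Q_{ac} - g_{ac} Q) ∧ θ^c - (1/3) θ_a ∧ Λ`; here `Ω_a = (1/2) Ω_{mn a} θ^{mn}`. -/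
def omega : Arr3 := fun m n a =>
  (J.nonmet m a n - J.g a n * J.traceQ m) - (J.nonmet n a m - J.g a m * J.traceQ n)
    - (1 / 3) * (J.g a m * J.traceLam n - J.g a n * J.traceLam m)

/-- `⁽²⁾Q_{ab} = -(2/3) sgn(g) ⋆(⋆Ω_{(a} ∧ θ_{b)}) = -(2/3) e_{(a}⌋Ω_{b)}`, by
`⋆(α ∧ θ_b) = e_b⌋⋆α` and `⋆⋆ = sgn(g)` on 2-forms. -/
def non2 : Arr3 := fun m a b => -(2 / 3) * ((1 / 2) * (J.omega a m b + J.omega b m a))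

/-- `⁽¹⁾Q_{ab}`, the remaining part of the nonmetricity. -/
def non1 : Arr3 := fun m a b => J.nonmet m a b - J.non2 m a b - J.non3 m a b - J.non4 m a b

/-- The symmetric part `Z_{ab} = R_{(ab)}` of the curvature. -/
def curvSym : Arr4 := fun m n a b => (1 / 2) * (J.curvLow m n a b + J.curvLow m n b a)

/-- `⁽⁵⁾Z_{ab} = (1/4) g_{ab} Z_c^c`. -/
def curvZ5 : Arr4 := fun m n a b =>
  (1 / 4) * (J.g a b * ∑ c, ∑ d, J.gi c d * J.curvSym m n c d)

/-- For a tensor-valued 1-form `X_{ab}`, the components `(X_{cb} ∧ θ^c)_{mn}` of the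
vector-valued 2-form `X_{cb} ∧ θ^c`. -/
def wedgeCoframe (X : Arr3) : Arr3 := fun m n b => X m n b - X n m b

/-- The curvature scalar `R_{ab}^{ab}`, that is, `R^{ab} ∧ ⋆θ_{ab} = curvScalar • vol`. -/
def curvScalar : ℝ := ∑ m, ∑ n, ∑ a, J.gi m a * J.curv m n a n

/-- The coefficient of `dx⁰ ∧ dx¹ ∧ dx² ∧ dx³` in the volume form `√|det g_{ab}| θ^{0123}`. -/
def vol : ℝ := Real.sqrt |(Matrix.of J.g).det| * (Matrix.of J.e).det

end Jet

/-! ### The Lagrangian -/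

/-- The coupling constants. -/
structure Params where
  (κ ρ lam a0 a1 a2 a3 b1 b2 b3 b4 b5 c1 c2 c3 z5 : ℝ)

/-- The square bracket of the weak sector, so that `L_w = -(1/(2κ)) weakBracket • vol`. Products are
expanded by `α ∧ ⋆β = (1/k!) α_{a₁…a_k} β^{a₁…a_k} vol` for `k`-forms. -/
def weakBracket (p : Params) (J : Jet) : ℝ :=
  2 * p.lam - p.a0 * J.curvScalar
    + (1 / 2) * (p.a1 * J.ip3 J.torsion J.tor1 + p.a2 * J.ip3 J.torsion J.tor2
        + p.a3 * J.ip3 J.torsion J.tor3)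
    + (p.b1 * J.ip3 J.nonmet J.non1 + p.b2 * J.ip3 J.nonmet J.non2
        + p.b3 * J.ip3 J.nonmet J.non3 + p.b4 * J.ip3 J.nonmet J.non4)
    + 2 * p.b5 * ((1 / 2) * J.ip3 (Jet.wedgeCoframe J.non3) (Jet.wedgeCoframe J.non4))
    - 2 * ((1 / 2) * (p.c1 * J.ip3 (Jet.wedgeCoframe J.non2) J.torsion
        + p.c2 * J.ip3 (Jet.wedgeCoframe J.non3) J.torsion
        + p.c3 * J.ip3 (Jet.wedgeCoframe J.non4) J.torsion))

/-- The Lagrangian density (coefficient of `dx⁰ ∧ dx¹ ∧ dx² ∧ dx³`) of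
`L_w - (z₅/(2ρ)) ⁽⁵⁾Z_{ab} ∧ ⋆⁽⁵⁾Z^{ab} - (1/2) F ∧ ⋆F`. -/
def lagrangian (p : Params) (J : Jet) : ℝ :=
  (-(1 / (2 * p.κ)) * weakBracket p J
    - p.z5 / (2 * p.ρ) * ((1 / 2) * J.ip4 J.curvZ5 J.curvZ5)
    - (1 / 2) * ((1 / 2) * J.ip2 J.fieldStrength J.fieldStrength)) * J.vol

/-- The variational derivative `∂L/∂q - ∂_ν (∂L/∂(∂_ν q))` at `x` of a first-order Lagrangian
density `L y q (∂q)`, paired with the value `w` of a variation `δq`. -/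
def eulerLagrange {V : Type} [NormedAddCommGroup V] [NormedSpace ℝ V]
    (L : Pt → V → (Fin 4 → V) → ℝ) (q : Pt → V) (x : Pt) (w : V) : ℝ :=
  deriv (fun t : ℝ => L x (q x + t • w) (fun μ => pd μ q x)) 0
    - ∑ ν, pd ν (fun y => deriv (fun t : ℝ =>
        L y (q y) (fun μ => pd μ q y + t • (Pi.single ν w : Fin 4 → V) μ)) 0) x

/-- The coframe equation, the connection equation and the Maxwell equation, at every point of `U`. -/
def IsSolution (p : Params) (U : Set Pt) (Φ : Fields) : Prop :=
  ∀ x ∈ U,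
    (∀ w : Arr2, eulerLagrange
      (fun y q dq => lagrangian p { Φ.jet y with e := q, de := dq }) Φ.e x w = 0) ∧
    (∀ w : Arr3, eulerLagrange
      (fun y q dq => lagrangian p { Φ.jet y with Γ := q, dΓ := dq }) Φ.Γ x w = 0) ∧
    (∀ w : Arr1, eulerLagrange
      (fun y q dq => lagrangian p { Φ.jet y with A := q, dA := dq }) Φ.A x w = 0)

/-! ### The triplet Ansatz -/

namespace Params

variable (p : Params)

def k0 : ℝ := 4 * (p.a2 - 2 * p.a0) * (p.a0 / 8 + p.b3) - 3 * (p.a0 - p.c2) ^ 2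

def k1 : ℝ := 9 / 2 * (p.a2 - 2 * p.a0) * (2 * p.b5 - p.a0) - 9 * (p.a0 - p.c2) * (p.a0 - p.c3)

def k2 : ℝ := 12 * (p.a0 / 8 + p.b3) * (p.a0 - p.c3) - 9 / 2 * (2 * p.b5 - p.a0) * (p.a0 - p.c2)

/-- The mass parameter `m²`. -/
def mSq : ℝ :=
  -1 / (p.z5 * p.κ) * (-4 * p.b4 + 3 * p.a0 / 2 + p.k1 / (2 * p.k0) * (2 * p.b5 - p.a0)
    + p.k2 / p.k0 * (-p.c3 + p.a0))

/-- The constraints `a₀ = 1`, `z₅ = ρ/k₀²`, `m² = 0`. -/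
def Constraints : Prop := p.a0 = 1 ∧ p.z5 = p.ρ / p.k0 ^ 2 ∧ p.mSq = 0

end Params

/-- On `U`, torsion and nonmetricity are pure trace, and their traces are `Q = k₀ φ`, `Λ = k₁ φ`,
`T = k₂ φ`. -/
def IsTriplet (p : Params) (U : Set Pt) (Φ : Fields) (φ : Pt → Arr1) : Prop :=
  ∀ x ∈ U,
    (Φ.jet x).nonmet = (Φ.jet x).non3 + (Φ.jet x).non4 ∧
    (Φ.jet x).torsion = (Φ.jet x).tor2 ∧
    (Φ.jet x).traceQ = p.k0 • (Φ.jet x).ofOneForm (φ x) ∧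
    (Φ.jet x).traceLam = p.k1 • (Φ.jet x).ofOneForm (φ x) ∧
    (Φ.jet x).traceT = p.k2 • (Φ.jet x).ofOneForm (φ x)

/-! ### The Kundt metric and the wave Ansatz, in coordinates `(u, v, ζ)` with `ζ = x² + i x³` -/

/-- The complex coordinate. -/
def zeta (x : Pt) : ℂ := ⟨x 2, x 3⟩

/-- The free functions of the Ansatz. `F` and `G` are the primitives `∫^ζ f dσ`, `∫^ζ g dσ`. -/
structure WaveData where
  α : ℝ → ℝ
  β : ℝ → ℂ
  H : ℝ → ℂ → ℝ
  f : ℝ → ℂ → ℂ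
  g : ℝ → ℂ → ℂ
  F : ℝ → ℂ → ℂ
  G : ℝ → ℂ → ℂ

namespace WaveData

variable (c : ℝ) (D : WaveData)

/-- `P = 1 + (c/6) ζ ζ*`. -/
def P (z : ℂ) : ℝ := 1 + c / 6 * Complex.normSq z

/-- `Q = (1 - (c/6) ζ ζ*) α + ζ β* + ζ* β`. -/
def Q (u : ℝ) (z : ℂ) : ℝ :=
  (1 - c / 6 * Complex.normSq z) * D.α u + 2 * (z * (starRingEnd ℂ) (D.β u)).re

/-- `S = -v² ((c/6) α² + β β*) + v ∂_u ln|Q| + (P/(2Q)) H`. -/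
def S (u v : ℝ) (z : ℂ) : ℝ :=
  -v ^ 2 * (c / 6 * D.α u ^ 2 + Complex.normSq (D.β u))
    + v * deriv (fun s => Real.log |D.Q c s z|) u
    + P c z / (2 * D.Q c u z) * D.H u z

/-- The components of `ds² = 2 (Q/P)² du (S du + dv) - (2/P²) dζ dζ*`. -/
def metric (x : Pt) : Arr2 :=
  let z := zeta x
  let h := (D.Q c (x 0) z / P c z) ^ 2
  ![![2 * h * D.S c (x 0) (x 1) z, h, 0, 0],
    ![h, 0, 0, 0],
    ![0, 0, -(2 / P c z ^ 2), 0],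
    ![0, 0, 0, -(2 / P c z ^ 2)]]

/-- The components of the 1-form `(K + K*) du`. -/
def waveForm (K : ℝ → ℂ → ℂ) (x : Pt) : Arr1 := ![2 * (K (x 0) (zeta x)).re, 0, 0, 0]

/-- The metric `metric c D` in its natural coframe `θ^a = dx^a`, with the connection `Γ` and the
potential `A = (∫^ζ f + c.c.) du`. -/
def fields (Γ : Pt → Arr3) : Fields where
  g := D.metric c
  e := fun _ μ a => if μ = a then 1 else 0
  Γ := Γ
  A := waveForm D.F

/-- Regularity on an open set `U`: all functions are smooth, `P` and `Q` do not vanish (so that the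
metric is defined and nondegenerate), and `F`, `G` are holomorphic primitives of `f`, `g`. -/
structure IsRegular (U : Set Pt) : Prop where
  isOpen : IsOpen U
  P_ne : ∀ x ∈ U, P c (zeta x) ≠ 0
  Q_ne : ∀ x ∈ U, D.Q c (x 0) (zeta x) ≠ 0
  α_smooth : ContDiffOn ℝ ∞ (fun x : Pt => D.α (x 0)) U
  β_smooth : ContDiffOn ℝ ∞ (fun x : Pt => D.β (x 0)) U
  H_smooth : ContDiffOn ℝ ∞ (fun x : Pt => D.H (x 0) (zeta x)) U
  F_smooth : ContDiffOn ℝ ∞ (fun x : Pt => D.F (x 0) (zeta x)) U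
  G_smooth : ContDiffOn ℝ ∞ (fun x : Pt => D.G (x 0) (zeta x)) U
  F_prim : ∀ x ∈ U, HasDerivAt (D.F (x 0)) (D.f (x 0) (zeta x)) (zeta x)
  G_prim : ∀ x ∈ U, HasDerivAt (D.G (x 0)) (D.g (x 0) (zeta x)) (zeta x)

end WaveData

/-- `∂_ζ = (∂_x - i ∂_y)/2`. -/
def dz (h : ℂ → ℂ) (z : ℂ) : ℂ :=
  (fderiv ℝ h z 1 - Complex.I * fderiv ℝ h z Complex.I) / 2

/-- `∂_{ζ*} = (∂_x + i ∂_y)/2`. -/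
def dzbar (h : ℂ → ℂ) (z : ℂ) : ℂ :=
  (fderiv ℝ h z 1 + Complex.I * fderiv ℝ h z Complex.I) / 2

/-- `∂_ζ ∂_{ζ*} H + (λ/(3P²)) H = (2κP/Q) (|f|² + |g|²)` on `U`. -/
def WaveEquation (p : Params) (U : Set Pt) (D : WaveData) : Prop :=
  ∀ x ∈ U,
    dz (dzbar (fun w => (D.H (x 0) w : ℂ))) (zeta x)
      + ((p.lam / (3 * WaveData.P p.lam (zeta x) ^ 2) * D.H (x 0) (zeta x) : ℝ) : ℂ)
    = ((2 * p.κ * WaveData.P p.lam (zeta x) / D.Q p.lam (x 0) (zeta x)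
        * (‖D.f (x 0) (zeta x)‖ ^ 2 + ‖D.g (x 0) (zeta x)‖ ^ 2) : ℝ) : ℂ)

/-- A configuration of the Ansatz on `U`: the Kundt metric with `c = λ`, a triplet connection with
`φ = (∫^ζ g + c.c.) du`, and the potential `A = (∫^ζ f + c.c.) du`. -/
def IsConfiguration (p : Params) (U : Set Pt) (D : WaveData) (Γ : Pt → Arr3) : Prop :=
  D.IsRegular p.lam U ∧ IsTriplet p U (D.fields p.lam Γ) (WaveData.waveForm D.G)

/-- `g` is not identically zero on `U` and, if `λ = 0`, then `|f|²` is not a constant multiple of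
`|g|²` on `U`. -/
def IsNondegenerate (p : Params) (U : Set Pt) (D : WaveData) : Prop :=
  (∃ x ∈ U, D.g (x 0) (zeta x) ≠ 0) ∧
  (p.lam = 0 → ∀ r : ℝ, ∃ x ∈ U,
    ‖D.f (x 0) (zeta x)‖ ^ 2 ≠ r * ‖D.g (x 0) (zeta x)‖ ^ 2)

end MAG

end

noncomputable section

set_option linter.unusedSimpArgs false

namespace MAG

/-! ### Contractions with a metric and its inverse -/

/-! In the coordinate coframe the triplet conditions determine the connection. A Koszul-type
argument gives Levi-Civita plus `A φ_μ δ_a^b + B δ_μ^b φ_a + C g_{μa} φ^b`, with `A`, `B`, `C`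
linear in `k₀`, `k₁`, `k₂` (`conn_unique`, `pure_of_conn`, `isConfiguration_iff`). At such fields
the first variation of the Lagrangian is manageable: the trace-free irreducible parts vanish, and
their variations are trace-free, hence orthogonal to pure-trace fields, so only a quadratic form in
the three trace covectors contributes (`hasDerivAt_quadForm`). Since `φ = ψ du` is null, the
quadratic invariants vanish and each pairing with `φ` picks out one component.

Each variational derivative is a force minus a divergence of momenta. The Maxwell expression is the
divergence of the gradient of a harmonic function, so it vanishes. In the connection equation,
harmonicity of `ψ` removes the `z₅` term. Up to a factor, `(k₀, k₁, k₂)` is the cross product of two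
vectors of couplings, which makes two linear relations hold identically (`cL_eq`, `cT_eq`). What
remains is `massCoeff * ψ = 0`, where `massCoeff = 2 z₅ κ k₀ m²`. In the coframe equation the
background is Einstein with constant `λ` apart from one null component (`kRel`, `mul_ricCoeff`).
This leaves `λ (a₀ - 1) = 0` and one scalar equation `(a₀/κ) h W = 4|f|² + 4 (z₅ k₀²/ρ) |g|²`, where
`W` is a wave operator applied to the `v`-independent part of `S` (`waveOp_kjet`).

Writing `H = 2 (Q/P) σ` and conjugating `W` with `Q/P` turns (W) into `h W = 4κ (|f|² + |g|²)`
(`wave_iff`). So `isSolution_iff` and (W) agree under (C). Conversely, subtracting the two scalar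
equations gives `(a₀ - 1)|f|² = (z₅ k₀²/ρ - a₀)|g|²`, and a nondegenerate configuration then forces
(C). Explicit witnesses, a plane wave for `λ = 0` and a radial solution for `λ ≠ 0`, give part 2. -/

/-- `gi` is the inverse of the symmetric matrix `g`. -/
structure IsMetricPair (g gi : Arr2) : Prop where
  symm : ∀ a b, g a b = g b a
  symm_inv : ∀ a b, gi a b = gi b a
  inv : ∀ a c, ∑ b, gi a b * g b c = if a = c then 1 else 0

/-- The pairing of two covectors. -/
def pair (gi : Arr2) (v w : Arr1) : ℝ := ∑ a, ∑ b, gi a b * v a * w b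

/-- Raising the index of a covector. -/
def up1 (gi : Arr2) (v : Arr1) : Arr1 := fun a => ∑ b, gi a b * v b

/-- Full contraction of two arrays with three indices. -/
def contr3 (gi : Arr2) (X Y : Arr3) : ℝ :=
  ∑ a, ∑ b, ∑ c, ∑ a', ∑ b', ∑ c', gi a a' * gi b b' * gi c c' * X a b c * Y a' b' c'

/-- Raising all three indices. -/
def up3 (gi : Arr2) (Y : Arr3) : Arr3 := fun a b c =>
  ∑ a', ∑ b', ∑ c', gi a a' * gi b b' * gi c c' * Y a' b' c'

/-- The trace `g^{ac} T_{abc}`. -/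
def trT (gi : Arr2) (X : Arr3) : Arr1 := fun m => ∑ b, ∑ c, gi b c * X b m c

/-- The Weyl covector of a nonmetricity. -/
def trQ (gi : Arr2) (X : Arr3) : Arr1 := fun m => (1 / 4) * ∑ b, ∑ c, gi b c * X m b c

/-- The second trace of a nonmetricity. -/
def trLam (gi : Arr2) (X : Arr3) : Arr1 := fun m => (∑ b, ∑ c, gi b c * X b c m) - trQ gi X m

/-- The vector torsion with trace `v`. -/
def vecTor (g : Arr2) (v : Arr1) : Arr3 := fun m n a => (1 / 3) * (g m a * v n - g n a * v m)

/-- The totally antisymmetric part of a torsion. -/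
def axTor (X : Arr3) : Arr3 := fun m n a => (1 / 3) * (X m n a + X n a m + X a m n)

/-- The tensor part of a torsion. -/
def tenTor (g gi : Arr2) (X : Arr3) : Arr3 := fun m n a =>
  X m n a - vecTor g (trT gi X) m n a - axTor X m n a

/-- The Weyl nonmetricity of a covector. -/
def weylNon (g : Arr2) (v : Arr1) : Arr3 := fun m a b => g a b * v m

/-- The vector nonmetricity of a covector. -/
def vecNon (g : Arr2) (v : Arr1) : Arr3 := fun m a b =>
  (4 / 9) * ((1 / 2) * (g m a * v b + g m b * v a) - (1 / 4) * (g a b * v m))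

/-- The 2-form `Ω_a` of a nonmetricity. -/
def omegaNon (g gi : Arr2) (X : Arr3) : Arr3 := fun m n a =>
  (X m a n - g a n * trQ gi X m) - (X n a m - g a m * trQ gi X n)
    - (1 / 3) * (g a m * trLam gi X n - g a n * trLam gi X m)

/-- The second irreducible part of a nonmetricity. -/
def binNon (g gi : Arr2) (X : Arr3) : Arr3 := fun m a b =>
  -(2 / 3) * ((1 / 2) * (omegaNon g gi X a m b + omegaNon g gi X b m a))

/-- The first irreducible part of a nonmetricity. -/
def triNon (g gi : Arr2) (X : Arr3) : Arr3 := fun m a b =>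
  X m a b - binNon g gi X m a b - vecNon g (trLam gi X) m a b - weylNon g (trQ gi X) m a b

/-- The part of the weak bracket which is quadratic in torsion and nonmetricity. -/
def quadForm (p : Params) (g gi : Arr2) (T X : Arr3) : ℝ :=
  (1 / 2) * (p.a1 * contr3 gi T (tenTor g gi T) + p.a2 * contr3 gi T (vecTor g (trT gi T))
      + p.a3 * contr3 gi T (axTor T))
    + (p.b1 * contr3 gi X (triNon g gi X) + p.b2 * contr3 gi X (binNon g gi X)
      + p.b3 * contr3 gi X (vecNon g (trLam gi X)) + p.b4 * contr3 gi X (weylNon g (trQ gi X)))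
    + 2 * p.b5 * ((1 / 2) * contr3 gi (Jet.wedgeCoframe (vecNon g (trLam gi X)))
        (Jet.wedgeCoframe (weylNon g (trQ gi X))))
    - 2 * ((1 / 2) * (p.c1 * contr3 gi (Jet.wedgeCoframe (binNon g gi X)) T
      + p.c2 * contr3 gi (Jet.wedgeCoframe (vecNon g (trLam gi X))) T
      + p.c3 * contr3 gi (Jet.wedgeCoframe (weylNon g (trQ gi X))) T))

/-- The irreducible parts of a jet unfold to the array operators above. In this form the metric is a
parameter, and torsion and nonmetricity enter through a quadratic form with fixed coefficients,
because the anholonomic metric is never varied. -/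
theorem weakBracket_eq (p : Params) (J : Jet) :
    weakBracket p J = 2 * p.lam - p.a0 * J.curvScalar
      + quadForm p J.g J.gi J.torsion J.nonmet := by
  have h : weakBracket p J = 2 * p.lam - p.a0 * J.curvScalar
    + (1 / 2) * (p.a1 * J.ip3 J.torsion J.tor1 + p.a2 * J.ip3 J.torsion J.tor2
        + p.a3 * J.ip3 J.torsion J.tor3)
    + (p.b1 * J.ip3 J.nonmet J.non1 + p.b2 * J.ip3 J.nonmet J.non2
        + p.b3 * J.ip3 J.nonmet J.non3 + p.b4 * J.ip3 J.nonmet J.non4)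
    + 2 * p.b5 * ((1 / 2) * J.ip3 (Jet.wedgeCoframe J.non3) (Jet.wedgeCoframe J.non4))
    - 2 * ((1 / 2) * (p.c1 * J.ip3 (Jet.wedgeCoframe J.non2) J.torsion
        + p.c2 * J.ip3 (Jet.wedgeCoframe J.non3) J.torsion
        + p.c3 * J.ip3 (Jet.wedgeCoframe J.non4) J.torsion)) := rfl
  have e : quadForm p J.g J.gi J.torsion J.nonmet =
    (1 / 2) * (p.a1 * J.ip3 J.torsion J.tor1 + p.a2 * J.ip3 J.torsion J.tor2
        + p.a3 * J.ip3 J.torsion J.tor3)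
    + (p.b1 * J.ip3 J.nonmet J.non1 + p.b2 * J.ip3 J.nonmet J.non2
        + p.b3 * J.ip3 J.nonmet J.non3 + p.b4 * J.ip3 J.nonmet J.non4)
    + 2 * p.b5 * ((1 / 2) * J.ip3 (Jet.wedgeCoframe J.non3) (Jet.wedgeCoframe J.non4))
    - 2 * ((1 / 2) * (p.c1 * J.ip3 (Jet.wedgeCoframe J.non2) J.torsion
        + p.c2 * J.ip3 (Jet.wedgeCoframe J.non3) J.torsion
        + p.c3 * J.ip3 (Jet.wedgeCoframe J.non4) J.torsion)) := rfl
  rw [h, e]; ring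

theorem contr3_eq_up3 (gi : Arr2) (X Y : Arr3) :
    contr3 gi X Y = ∑ a, ∑ b, ∑ c, X a b c * up3 gi Y a b c := by
  simp only [contr3, up3, Finset.mul_sum]
  congr! 6
  ring

theorem contr3_add_right (gi : Arr2) (X Y Z : Arr3) :
    contr3 gi X (Y + Z) = contr3 gi X Y + contr3 gi X Z := by
  simp only [contr3, Pi.add_apply, mul_add, Finset.sum_add_distrib]

theorem contr3_smul_right (gi : Arr2) (r : ℝ) (X Y : Arr3) :
    contr3 gi X (r • Y) = r * contr3 gi X Y := by
  simp only [contr3, Pi.smul_apply, smul_eq_mul, Finset.mul_sum]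
  congr! 6
  ring

theorem contr3_zero_right (gi : Arr2) (X : Arr3) : contr3 gi X 0 = 0 := by
  simp [contr3]

namespace IsMetricPair

variable {g gi : Arr2} (hg : IsMetricPair g gi)
include hg

theorem pair_comm (v w : Arr1) : pair gi v w = pair gi w v := by
  unfold pair
  rw [Finset.sum_comm]
  congr! 2
  rw [hg.symm_inv]; ring

theorem pair_eq_up1 (v w : Arr1) : pair gi v w = ∑ a, up1 gi v a * w a := by
  rw [hg.pair_comm]
  simp only [pair, up1, Finset.sum_mul]
  congr! 2
  ring

theorem contr3_comm (X Y : Arr3) : contr3 gi X Y = contr3 gi Y X := by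
  -- Bundling three indices into one reduces the symmetry to a single exchange of two sums.
  have key : ∀ F : Arr3, ∑ a, ∑ b, ∑ c, F a b c
      = ∑ i : Fin 4 × Fin 4 × Fin 4, F i.1 i.2.1 i.2.2 := fun F => by
    simp only [Fintype.sum_prod_type]
  have bundle : ∀ X Y : Arr3, contr3 gi X Y = ∑ i : Fin 4 × Fin 4 × Fin 4,
      ∑ j : Fin 4 × Fin 4 × Fin 4, gi i.1 j.1 * gi i.2.1 j.2.1 * gi i.2.2 j.2.2
        * X i.1 i.2.1 i.2.2 * Y j.1 j.2.1 j.2.2 := fun X Y => by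
    rw [← key fun a b c => ∑ j : Fin 4 × Fin 4 × Fin 4, gi a j.1 * gi b j.2.1 * gi c j.2.2
        * X a b c * Y j.1 j.2.1 j.2.2]
    unfold contr3
    congr! 3 with a _ b _ c
    rw [← key fun a' b' c' => gi a a' * gi b b' * gi c c' * X a b c * Y a' b' c']
  rw [bundle, bundle, Finset.sum_comm]
  congr! 2 with i _ j
  rw [hg.symm_inv j.1, hg.symm_inv j.2.1, hg.symm_inv j.2.2]; ring

theorem trace_left (m : Fin 4) (v : Arr1) : ∑ b, ∑ c, gi b c * (g c m * v b) = v m := by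
  have : ∀ b, ∑ c, gi b c * (g c m * v b) = (if b = m then 1 else 0) * v b := fun b => by
    rw [← hg.inv, Finset.sum_mul]; congr! 1; ring
  simp [this]

theorem trace_right (m : Fin 4) (v : Arr1) : ∑ b, ∑ c, gi b c * (g b m * v c) = v m := by
  rw [Finset.sum_comm]
  rw [← hg.trace_left m v]
  congr! 2 with b _ c
  rw [hg.symm_inv]

theorem trace_self (s : ℝ) : ∑ b, ∑ c, gi b c * (g b c * s) = 4 * s := by
  have : ∀ b, ∑ c, gi b c * (g b c * s) = s := fun b => by
    have := hg.inv b b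
    rw [if_pos rfl] at this
    calc _ = (∑ c, gi b c * g c b) * s := by
          rw [Finset.sum_mul]; congr! 1 with c; rw [hg.symm c b]; ring
      _ = s := by rw [this, one_mul]
  simp [this]

theorem up3_ac (v : Arr1) (a b c : Fin 4) :
    up3 gi (fun i j k => g i k * v j) a b c = gi a c * up1 gi v b := by
  have h : ∀ a' b', ∑ c', gi a a' * gi b b' * gi c c' * (g a' c' * v b')
      = (gi a a' * (gi b b' * v b')) * (if c = a' then 1 else 0) := fun a' b' => by
    rw [← hg.inv, Finset.mul_sum]; congr! 1 with c'; rw [hg.symm a' c']; ring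
  simp only [up3, h, up1, Finset.mul_sum]
  rw [Finset.sum_comm]
  simp

theorem up3_bc (v : Arr1) (a b c : Fin 4) :
    up3 gi (fun i j k => g j k * v i) a b c = gi b c * up1 gi v a := by
  have h : ∀ a' b', ∑ c', gi a a' * gi b b' * gi c c' * (g b' c' * v a')
      = (gi b b' * (gi a a' * v a')) * (if c = b' then 1 else 0) := fun a' b' => by
    rw [← hg.inv, Finset.mul_sum]; congr! 1 with c'; rw [hg.symm b' c']; ring
  simp only [up3, h, up1, Finset.mul_sum]
  simp

theorem up3_ab (v : Arr1) (a b c : Fin 4) :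
    up3 gi (fun i j k => g i j * v k) a b c = gi a b * up1 gi v c := by
  have h : ∀ a' c', ∑ b', gi a a' * gi b b' * gi c c' * (g a' b' * v c')
      = (gi a a' * (gi c c' * v c')) * (if b = a' then 1 else 0) := fun a' c' => by
    rw [← hg.inv, Finset.mul_sum]; congr! 1 with b'; rw [hg.symm a' b']; ring
  have h2 : ∀ a', ∑ b', ∑ c', gi a a' * gi b b' * gi c c' * (g a' b' * v c')
      = ∑ c', (gi a a' * (gi c c' * v c')) * (if b = a' then 1 else 0) := fun a' => by
    rw [Finset.sum_comm]; simp only [h]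
  simp only [up3, h2, up1, Finset.mul_sum]
  rw [Finset.sum_comm]
  simp

/-- Up to the factor 2/3, `vecTor` is adjoint to `trT` on antisymmetric arrays; hence vector
torsions are orthogonal to trace-free torsions. -/
theorem contr3_vecTor (X : Arr3) (v : Arr1) (hX : ∀ m n a, X m n a = -X n m a) :
    contr3 gi X (vecTor g v) = (2 / 3) * pair gi v (trT gi X) := by
  have h1 : vecTor g v = (1 / 3 : ℝ) • ((fun i j k => g i k * v j) + (-1 : ℝ) •
      (fun i j k => g j k * v i)) := by
    funext i j k; simp [vecTor]; ring
  rw [h1, contr3_smul_right, contr3_add_right, contr3_smul_right, contr3_eq_up3, contr3_eq_up3]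
  simp only [hg.up3_ac, hg.up3_bc]
  have e1 : ∑ a, ∑ b, ∑ c, X a b c * (gi a c * up1 gi v b) = pair gi v (trT gi X) := by
    rw [hg.pair_eq_up1, Finset.sum_comm]
    simp only [trT, Finset.mul_sum]
    congr! 3; ring
  have e2 : ∑ a, ∑ b, ∑ c, X a b c * (gi b c * up1 gi v a) = -pair gi v (trT gi X) := by
    rw [hg.pair_eq_up1, ← Finset.sum_neg_distrib]
    simp only [trT, Finset.mul_sum, ← Finset.sum_neg_distrib]
    congr! 3; rw [hX]; ring
  rw [e1, e2]; ring

/-- The analogous adjointness of `vecNon` and `trLam`: the two symmetric terms produce the trace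
over the form index, and the last term subtracts a quarter of the other trace, which is `trQ`. -/
theorem contr3_vecNon (X : Arr3) (v : Arr1) (hX : ∀ m a b, X m a b = X m b a) :
    contr3 gi X (vecNon g v) = (4 / 9) * pair gi v (trLam gi X) := by
  have h1 : vecNon g v = (4 / 9 : ℝ) • ((1 / 2 : ℝ) • ((fun i j k => g i j * v k) +
      (fun i j k => g i k * v j)) + (-1 / 4 : ℝ) • (fun i j k => g j k * v i)) := by
    funext i j k; simp [vecNon]; ring
  rw [h1, contr3_smul_right, contr3_add_right, contr3_smul_right, contr3_smul_right,
    contr3_add_right]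
  simp only [contr3_eq_up3, hg.up3_ac, hg.up3_bc, hg.up3_ab, hg.pair_eq_up1]
  have e1 : ∑ a, ∑ b, ∑ c, X a b c * (gi a b * up1 gi v c)
      = ∑ a, up1 gi v a * ∑ b, ∑ c, gi b c * X b c a := by
    simp only [Finset.mul_sum]
    rw [show ∑ a, ∑ b, ∑ c, up1 gi v a * (gi b c * X b c a)
      = ∑ b, ∑ c, ∑ a, up1 gi v a * (gi b c * X b c a) by
        rw [Finset.sum_comm]; congr! 1; rw [Finset.sum_comm]]
    congr! 3; ring
  have e2 : ∑ a, ∑ b, ∑ c, X a b c * (gi a c * up1 gi v b)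
      = ∑ a, up1 gi v a * ∑ b, ∑ c, gi b c * X b c a := by
    simp only [Finset.mul_sum]
    rw [Finset.sum_comm]
    congr! 3; rw [hX]; ring
  have e3 : ∑ a, ∑ b, ∑ c, X a b c * (gi b c * up1 gi v a)
      = ∑ a, up1 gi v a * (4 * trQ gi X a) := by
    simp only [trQ, Finset.mul_sum]
    congr! 3; ring
  rw [e1, e2, e3]
  simp only [trLam, mul_sub, Finset.sum_sub_distrib]
  have e4 : ∑ a, up1 gi v a * (4 * trQ gi X a) = 4 * ∑ a, up1 gi v a * trQ gi X a := by
    rw [Finset.mul_sum]; congr! 1; ring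
  rw [e4]; ring

theorem contr3_weylNon (X : Arr3) (v : Arr1) :
    contr3 gi X (weylNon g v) = 4 * pair gi v (trQ gi X) := by
  have h1 : weylNon g v = fun i j k => g j k * v i := by
    funext i j k; simp [weylNon]
  rw [h1]
  simp only [contr3_eq_up3, hg.up3_bc, hg.pair_eq_up1, trQ, Finset.mul_sum]
  congr! 3; ring

/-! Traces of the irreducible parts. -/

theorem trT_vecTor (v : Arr1) : trT gi (vecTor g v) = v := by
  funext m
  have : trT gi (vecTor g v) m = (1 / 3) * ((∑ b, ∑ c, gi b c * (g b c * v m))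
      - ∑ b, ∑ c, gi b c * (g c m * v b)) := by
    simp only [trT, vecTor, ← Finset.sum_sub_distrib, Finset.mul_sum]
    congr! 2 with b _ c; rw [hg.symm m c]; ring
  rw [this, hg.trace_self, hg.trace_left]; ring

theorem trQ_weylNon (v : Arr1) : trQ gi (weylNon g v) = v := by
  funext m
  simp only [trQ, weylNon]
  rw [hg.trace_self]; ring

theorem trLam_weylNon (v : Arr1) : trLam gi (weylNon g v) = 0 := by
  funext m
  simp only [trLam, hg.trQ_weylNon]
  simp only [weylNon]
  rw [hg.trace_left]; simp

theorem trQ_vecNon (v : Arr1) : trQ gi (vecNon g v) = 0 := by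
  funext m
  have : trQ gi (vecNon g v) m = (1 / 9) * ((1 / 2) * ((∑ b, ∑ c, gi b c * (g b m * v c))
      + ∑ b, ∑ c, gi b c * (g c m * v b)) - (1 / 4) * ∑ b, ∑ c, gi b c * (g b c * v m)) := by
    simp only [trQ, vecNon, ← Finset.sum_sub_distrib, ← Finset.sum_add_distrib, Finset.mul_sum]
    congr! 2 with b _ c; rw [hg.symm m c, hg.symm m b]; ring
  rw [this, hg.trace_self, hg.trace_left, hg.trace_right]
  simp; ring

theorem trLam_vecNon (v : Arr1) : trLam gi (vecNon g v) = v := by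
  funext m
  have : ∑ b, ∑ c, gi b c * vecNon g v b c m
      = (4 / 9) * ((1 / 2) * ((∑ b, ∑ c, gi b c * (g b c * v m))
      + ∑ b, ∑ c, gi b c * (g b m * v c)) - (1 / 4) * ∑ b, ∑ c, gi b c * (g c m * v b)) := by
    simp only [vecNon, ← Finset.sum_sub_distrib, ← Finset.sum_add_distrib, Finset.mul_sum]
    congr! 2 with b _ c; ring
  simp only [trLam, hg.trQ_vecNon]
  rw [this, hg.trace_self, hg.trace_left, hg.trace_right]
  simp; ring

/-- Wedging with the coframe turns both trace parts of the nonmetricity into vector torsions. This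
is why the mixed terms with `b5`, `c2`, `c3` reduce to pairings of traces. -/
theorem wedge_vecNon (v : Arr1) : Jet.wedgeCoframe (vecNon g v) = vecTor g v := by
  funext m n a
  simp only [Jet.wedgeCoframe, vecNon, vecTor]
  rw [hg.symm n m]; ring

omit hg in
theorem wedge_weylNon (v : Arr1) : Jet.wedgeCoframe (weylNon g v) = (-3 : ℝ) • vecTor g v := by
  funext m n a
  simp only [Jet.wedgeCoframe, weylNon, vecTor, Pi.smul_apply, smul_eq_mul]
  ring

theorem trT_axTor (X : Arr3) (hX : ∀ m n a, X m n a = -X n m a) : trT gi (axTor X) = 0 := by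
  funext m
  have e : trT gi (axTor X) m = (1 / 3) * ((∑ b, ∑ c, gi b c * X b m c)
      + (∑ b, ∑ c, gi b c * X m c b) + ∑ b, ∑ c, gi b c * X c b m) := by
    simp only [trT, axTor, ← Finset.sum_add_distrib, Finset.mul_sum]
    congr! 2 with b _ c; ring
  have e1 : ∑ b, ∑ c, gi b c * X m c b = -∑ b, ∑ c, gi b c * X b m c := by
    rw [Finset.sum_comm, ← Finset.sum_neg_distrib]
    simp only [← Finset.sum_neg_distrib]
    congr! 2 with b _ c; rw [hg.symm_inv, hX]; ring
  have e2 : ∑ b, ∑ c, gi b c * X c b m = 0 := by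
    have : ∑ b, ∑ c, gi b c * X c b m = -∑ b, ∑ c, gi b c * X c b m := by
      conv_lhs => rw [Finset.sum_comm]
      rw [← Finset.sum_neg_distrib]
      simp only [← Finset.sum_neg_distrib]
      congr! 2 with b _ c; rw [hg.symm_inv, hX]; ring
    linarith
  rw [e, e1, e2]; simp

theorem trT_tenTor (X : Arr3) (hX : ∀ m n a, X m n a = -X n m a) :
    trT gi (tenTor g gi X) = 0 := by
  funext m
  have e : trT gi (tenTor g gi X) m
      = trT gi X m - trT gi (vecTor g (trT gi X)) m - trT gi (axTor X) m := by
    simp only [trT, tenTor, mul_sub, Finset.sum_sub_distrib]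
  rw [e, hg.trT_vecTor, hg.trT_axTor X hX]; simp

omit hg in
theorem omegaNon_antisymm (X : Arr3) (m n a : Fin 4) :
    omegaNon g gi X m n a = -omegaNon g gi X n m a := by
  simp only [omegaNon]; ring

/-- The term `(1/3) θ_a ∧ Λ` in `Ω_a` is tuned for this: in dimension 4 its trace is `(1/3)(4 - 1)
Λ`, which cancels the trace left over after the removal of the Weyl part. -/
theorem trT_omegaNon (X : Arr3) (hX : ∀ m a b, X m a b = X m b a) :
    trT gi (omegaNon g gi X) = 0 := by
  funext m
  have e : trT gi (omegaNon g gi X) m = (∑ b, ∑ c, gi b c * X b c m)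
      - (∑ b, ∑ c, gi b c * (g c m * trQ gi X b)) - 4 * trQ gi X m
      + (∑ b, ∑ c, gi b c * (g b c * trQ gi X m))
      - (1 / 3) * ((∑ b, ∑ c, gi b c * (g b c * trLam gi X m))
        - ∑ b, ∑ c, gi b c * (g c m * trLam gi X b)) := by
    have h4 : 4 * trQ gi X m = ∑ b, ∑ c, gi b c * X m b c := by simp only [trQ]; ring
    rw [h4]
    simp only [trT, omegaNon, ← Finset.sum_sub_distrib, ← Finset.sum_add_distrib,
      Finset.mul_sum]
    congr! 2 with b _ c; rw [hg.symm b c, hX m b c]; ring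
  have h5 : ∑ b, ∑ c, gi b c * X b c m = trLam gi X m + trQ gi X m := by simp [trLam]
  rw [e, h5, hg.trace_self, hg.trace_self, hg.trace_left, hg.trace_left]; simp; ring

theorem trace_omegaNon (X : Arr3) (m : Fin 4) :
    ∑ b, ∑ c, gi b c * omegaNon g gi X b c m = 0 := by
  have : ∑ b, ∑ c, gi b c * omegaNon g gi X b c m
      = -∑ b, ∑ c, gi b c * omegaNon g gi X b c m := by
    conv_lhs => rw [Finset.sum_comm]
    rw [← Finset.sum_neg_distrib]
    simp only [← Finset.sum_neg_distrib]
    congr! 2 with b _ c; rw [hg.symm_inv, omegaNon_antisymm]; ring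
  linarith

theorem trQ_binNon (X : Arr3) (hX : ∀ m a b, X m a b = X m b a) :
    trQ gi (binNon g gi X) = 0 := by
  funext m
  have e : trQ gi (binNon g gi X) m = -(1 / 12) * (trT gi (omegaNon g gi X) m
      + ∑ b, ∑ c, gi b c * omegaNon g gi X c m b) := by
    simp only [trQ, binNon, trT, ← Finset.sum_add_distrib, Finset.mul_sum]
    congr! 2 with b _ c; ring
  have e2 : ∑ b, ∑ c, gi b c * omegaNon g gi X c m b = trT gi (omegaNon g gi X) m := by
    rw [Finset.sum_comm]; simp only [trT]
    congr! 2 with b _ c; rw [hg.symm_inv]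
  rw [e, e2, hg.trT_omegaNon X hX]; simp

theorem trLam_binNon (X : Arr3) (hX : ∀ m a b, X m a b = X m b a) :
    trLam gi (binNon g gi X) = 0 := by
  funext m
  have e : ∑ b, ∑ c, gi b c * binNon g gi X b c m
      = -(1 / 3) * ((∑ b, ∑ c, gi b c * omegaNon g gi X c b m)
        - trT gi (omegaNon g gi X) m) := by
    simp only [binNon, trT, ← Finset.sum_sub_distrib, Finset.mul_sum]
    congr! 2 with b _ c; rw [omegaNon_antisymm X m b c]; ring
  have e2 : ∑ b, ∑ c, gi b c * omegaNon g gi X c b m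
      = ∑ b, ∑ c, gi b c * omegaNon g gi X b c m := by
    rw [Finset.sum_comm]
    congr! 2 with b _ c; rw [hg.symm_inv]
  simp only [trLam, e, e2, hg.trace_omegaNon, hg.trT_omegaNon X hX, hg.trQ_binNon X hX]
  simp

omit hg in
theorem binNon_symm (X : Arr3) (m a b : Fin 4) :
    binNon g gi X m a b = binNon g gi X m b a := by
  simp only [binNon]; ring

omit hg in
theorem trT_wedge (X : Arr3) (hX : ∀ m a b, X m a b = X m b a) (m : Fin 4) :
    trT gi (Jet.wedgeCoframe X) m = trLam gi X m - 3 * trQ gi X m := by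
  have h : trLam gi X m - 3 * trQ gi X m
      = (∑ b, ∑ c, gi b c * X b c m) - ∑ b, ∑ c, gi b c * X m b c := by
    simp only [trLam, trQ]; ring
  rw [h, ← Finset.sum_sub_distrib]
  simp only [trT, Jet.wedgeCoframe, ← Finset.sum_sub_distrib]
  congr! 2 with b _ c; rw [hX b m c]; ring

theorem trT_wedge_binNon (X : Arr3) (hX : ∀ m a b, X m a b = X m b a) :
    trT gi (Jet.wedgeCoframe (binNon g gi X)) = 0 := by
  funext m
  rw [trT_wedge _ (binNon_symm X), hg.trQ_binNon X hX, hg.trLam_binNon X hX]; simp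

theorem triNon_symm (X : Arr3) (hX : ∀ m a b, X m a b = X m b a) (m a b : Fin 4) :
    triNon g gi X m a b = triNon g gi X m b a := by
  simp only [triNon, vecNon, weylNon]
  rw [hX, binNon_symm, hg.symm a b]; ring

theorem trQ_triNon (X : Arr3) (hX : ∀ m a b, X m a b = X m b a) :
    trQ gi (triNon g gi X) = 0 := by
  funext m
  have e : trQ gi (triNon g gi X) m = trQ gi X m - trQ gi (binNon g gi X) m
      - trQ gi (vecNon g (trLam gi X)) m - trQ gi (weylNon g (trQ gi X)) m := by
    simp only [trQ, triNon, mul_sub, Finset.sum_sub_distrib]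
  rw [e, hg.trQ_binNon X hX, hg.trQ_vecNon, hg.trQ_weylNon]; simp

theorem trLam_triNon (X : Arr3) (hX : ∀ m a b, X m a b = X m b a) :
    trLam gi (triNon g gi X) = 0 := by
  funext m
  have e : trLam gi (triNon g gi X) m = trLam gi X m - trLam gi (binNon g gi X) m
      - trLam gi (vecNon g (trLam gi X)) m - trLam gi (weylNon g (trQ gi X)) m := by
    simp only [trLam, trQ, triNon, mul_sub, Finset.sum_sub_distrib]; ring
  rw [e, hg.trLam_binNon X hX, hg.trLam_vecNon, hg.trLam_weylNon]; simp

end IsMetricPair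

/-! ### First variation of the quadratic form at pure-trace fields -/

theorem hasDerivAt_of_isLinearMap {V W : Type*} [NormedAddCommGroup V] [NormedSpace ℝ V]
    [FiniteDimensional ℝ V] [NormedAddCommGroup W] [NormedSpace ℝ W] {f : V → W}
    (hf : IsLinearMap ℝ f) {X : ℝ → V} {X' : V} {t : ℝ} (hX : HasDerivAt X X' t) :
    HasDerivAt (fun s => f (X s)) (f X') t :=
  ((hf.mk' f).toContinuousLinearMap.hasFDerivAt (x := X t)).comp_hasDerivAt t hX

theorem hasDerivAt_contr3 (gi : Arr2) {X Y : ℝ → Arr3} {X' Y' : Arr3} {t : ℝ}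
    (hX : HasDerivAt X X' t) (hY : HasDerivAt Y Y' t) :
    HasDerivAt (fun s => contr3 gi (X s) (Y s)) (contr3 gi X' (Y t) + contr3 gi (X t) Y') t := by
  have hX' : ∀ a b c, HasDerivAt (fun s => X s a b c) (X' a b c) t := fun a b c =>
    hasDerivAt_pi.1 (hasDerivAt_pi.1 (hasDerivAt_pi.1 hX a) b) c
  have hY' : ∀ a b c, HasDerivAt (fun s => Y s a b c) (Y' a b c) t := fun a b c =>
    hasDerivAt_pi.1 (hasDerivAt_pi.1 (hasDerivAt_pi.1 hY a) b) c
  have e : contr3 gi X' (Y t) + contr3 gi (X t) Y' = ∑ a, ∑ b, ∑ c, ∑ a', ∑ b', ∑ c',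
      (gi a a' * gi b b' * gi c c' * X' a b c * Y t a' b' c'
        + gi a a' * gi b b' * gi c c' * X t a b c * Y' a' b' c') := by
    simp only [contr3, Finset.sum_add_distrib]
  rw [e]
  unfold contr3
  refine HasDerivAt.fun_sum fun a _ => HasDerivAt.fun_sum fun b _ => HasDerivAt.fun_sum fun c _ =>
    HasDerivAt.fun_sum fun a' _ => HasDerivAt.fun_sum fun b' _ => HasDerivAt.fun_sum fun c' _ => ?_
  exact ((hX' a b c).const_mul _).mul (hY' a' b' c')

theorem hasDerivAt_pair (gi : Arr2) {v w : ℝ → Arr1} {v' w' : Arr1} {t : ℝ}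
    (hv : HasDerivAt v v' t) (hw : HasDerivAt w w' t) :
    HasDerivAt (fun s => pair gi (v s) (w s)) (pair gi v' (w t) + pair gi (v t) w') t := by
  have e : pair gi v' (w t) + pair gi (v t) w' = ∑ a, ∑ b,
      (gi a b * v' a * w t b + gi a b * v t a * w' b) := by
    simp only [pair, Finset.sum_add_distrib]
  rw [e]
  unfold pair
  refine HasDerivAt.fun_sum fun a _ => HasDerivAt.fun_sum fun b _ => ?_
  exact ((hasDerivAt_pi.1 hv a).const_mul _).mul (hasDerivAt_pi.1 hw b)

theorem isLinearMap_trT (gi : Arr2) : IsLinearMap ℝ (trT gi) where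
  map_add X Y := by funext; simp [trT, mul_add, Finset.sum_add_distrib]
  map_smul r X := by
    funext; simp only [trT, Pi.smul_apply, smul_eq_mul, Finset.mul_sum]; congr! 2; ring

theorem isLinearMap_trQ (gi : Arr2) : IsLinearMap ℝ (trQ gi) where
  map_add X Y := by funext; simp [trQ, mul_add, Finset.sum_add_distrib]
  map_smul r X := by
    funext; simp only [trQ, Pi.smul_apply, smul_eq_mul, Finset.mul_sum]; congr! 2; ring

theorem isLinearMap_trLam (gi : Arr2) : IsLinearMap ℝ (trLam gi) where
  map_add X Y := by
    funext
    simp [trLam, (isLinearMap_trQ gi).map_add, mul_add, Finset.sum_add_distrib]; ring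
  map_smul r X := by
    funext
    simp only [trLam, (isLinearMap_trQ gi).map_smul, Pi.smul_apply, smul_eq_mul, mul_sub,
      Finset.mul_sum]
    congr! 3; ring

theorem isLinearMap_axTor : IsLinearMap ℝ axTor where
  map_add X Y := by funext; simp [axTor]; ring
  map_smul r X := by funext; simp [axTor]; ring

theorem isLinearMap_tenTor (g gi : Arr2) : IsLinearMap ℝ (tenTor g gi) where
  map_add X Y := by
    funext; simp [tenTor, isLinearMap_axTor.map_add, (isLinearMap_trT gi).map_add, vecTor]; ring
  map_smul r X := by
    funext; simp [tenTor, isLinearMap_axTor.map_smul, (isLinearMap_trT gi).map_smul, vecTor]; ring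

theorem isLinearMap_omegaNon (g gi : Arr2) : IsLinearMap ℝ (omegaNon g gi) where
  map_add X Y := by
    funext; simp [omegaNon, (isLinearMap_trQ gi).map_add, (isLinearMap_trLam gi).map_add]; ring
  map_smul r X := by
    funext; simp [omegaNon, (isLinearMap_trQ gi).map_smul, (isLinearMap_trLam gi).map_smul]; ring

theorem isLinearMap_binNon (g gi : Arr2) : IsLinearMap ℝ (binNon g gi) where
  map_add X Y := by funext; simp [binNon, (isLinearMap_omegaNon g gi).map_add]; ring
  map_smul r X := by funext; simp [binNon, (isLinearMap_omegaNon g gi).map_smul]; ring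

theorem isLinearMap_triNon (g gi : Arr2) : IsLinearMap ℝ (triNon g gi) where
  map_add X Y := by
    funext
    simp [triNon, vecNon, weylNon, (isLinearMap_binNon g gi).map_add, (isLinearMap_trQ gi).map_add,
      (isLinearMap_trLam gi).map_add]; ring
  map_smul r X := by
    funext
    simp [triNon, vecNon, weylNon, (isLinearMap_binNon g gi).map_smul,
      (isLinearMap_trQ gi).map_smul, (isLinearMap_trLam gi).map_smul]; ring

theorem isLinearMap_wedge : IsLinearMap ℝ Jet.wedgeCoframe where
  map_add X Y := by funext; simp [Jet.wedgeCoframe]; ring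
  map_smul r X := by funext; simp [Jet.wedgeCoframe]; ring

/-- The part of `quadForm` which only involves the traces. -/
def traceForm (p : Params) (gi : Arr2) (τ l q : Arr1) : ℝ :=
  p.a2 / 3 * pair gi τ τ + 4 / 9 * p.b3 * pair gi l l + 4 * p.b4 * pair gi q q
    - 2 * p.b5 * pair gi l q - 2 / 3 * p.c2 * pair gi l τ + 2 * p.c3 * pair gi q τ

/-- The derivative of `traceForm` in the direction `(τ', l', q')`. -/
def traceForm' (p : Params) (gi : Arr2) (τ l q τ' l' q' : Arr1) : ℝ :=
  2 / 3 * p.a2 * pair gi τ τ' + 8 / 9 * p.b3 * pair gi l l' + 8 * p.b4 * pair gi q q'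
    - 2 * p.b5 * (pair gi l q' + pair gi q l') - 2 / 3 * p.c2 * (pair gi l τ' + pair gi τ l')
    + 2 * p.c3 * (pair gi q τ' + pair gi τ q')

namespace IsMetricPair

variable {g gi : Arr2} (hg : IsMetricPair g gi)
include hg

/-- By the adjointness relations, the terms built from `vecTor`, `vecNon` and `weylNon` depend on
the traces alone. Each of the remaining terms contains a trace-free projection as a factor. -/
theorem quadForm_eq (p : Params) (T X : Arr3) (hT : ∀ m n a, T m n a = -T n m a)
    (hX : ∀ m a b, X m a b = X m b a) :
    quadForm p g gi T X = (1 / 2) * (p.a1 * contr3 gi T (tenTor g gi T)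
        + p.a3 * contr3 gi T (axTor T))
      + p.b1 * contr3 gi X (triNon g gi X) + p.b2 * contr3 gi X (binNon g gi X)
      - p.c1 * contr3 gi (Jet.wedgeCoframe (binNon g gi X)) T
      + traceForm p gi (trT gi T) (trLam gi X) (trQ gi X) := by
  have hv : ∀ v : Arr1, ∀ m n a, vecTor g v m n a = -vecTor g v n m a := fun v m n a => by
    simp only [vecTor]; ring
  have h1 : contr3 gi (vecTor g (trLam gi X)) T = 2 / 3 * pair gi (trLam gi X) (trT gi T) := by
    rw [hg.contr3_comm, hg.contr3_vecTor T _ hT]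
  have h2 : contr3 gi ((-3 : ℝ) • vecTor g (trQ gi X)) T
      = -2 * pair gi (trQ gi X) (trT gi T) := by
    rw [hg.contr3_comm, contr3_smul_right, hg.contr3_vecTor T _ hT]; ring
  have h3 : contr3 gi (vecTor g (trLam gi X)) ((-3 : ℝ) • vecTor g (trQ gi X))
      = -2 * pair gi (trLam gi X) (trQ gi X) := by
    rw [contr3_smul_right, hg.contr3_vecTor _ _ (hv _), hg.trT_vecTor, hg.pair_comm]; ring
  simp only [quadForm, traceForm, hg.wedge_vecNon, wedge_weylNon, h1, h2, h3,
    hg.contr3_vecTor T _ hT, hg.contr3_vecNon X _ hX, hg.contr3_weylNon]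
  ring

theorem hasDerivAt_traceForm (p : Params) {τ l q : ℝ → Arr1} {τ' l' q' : Arr1} {t : ℝ}
    (hτ : HasDerivAt τ τ' t) (hl : HasDerivAt l l' t) (hq : HasDerivAt q q' t) :
    HasDerivAt (fun s => traceForm p gi (τ s) (l s) (q s))
      (traceForm' p gi (τ t) (l t) (q t) τ' l' q') t := by
  unfold traceForm
  have := (((((hasDerivAt_pair gi hτ hτ).const_mul (p.a2 / 3)).add
    ((hasDerivAt_pair gi hl hl).const_mul (4 / 9 * p.b3))).add
    ((hasDerivAt_pair gi hq hq).const_mul (4 * p.b4))).sub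
    ((hasDerivAt_pair gi hl hq).const_mul (2 * p.b5))).sub
    ((hasDerivAt_pair gi hl hτ).const_mul (2 / 3 * p.c2)) |>.add
    ((hasDerivAt_pair gi hq hτ).const_mul (2 * p.c3))
  refine HasDerivAt.congr_deriv this ?_
  unfold traceForm'
  rw [hg.pair_comm τ' (τ t), hg.pair_comm l' (l t), hg.pair_comm q' (q t), hg.pair_comm l' (q t),
    hg.pair_comm l' (τ t), hg.pair_comm q' (τ t)]
  ring

variable {τ l q : Arr1}

theorem trT_of_pure {T : Arr3} (h : T = vecTor g τ) : trT gi T = τ := by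
  rw [h, hg.trT_vecTor]

theorem trLam_of_pure {X : Arr3} (h : X = vecNon g l + weylNon g q) : trLam gi X = l := by
  rw [h, (isLinearMap_trLam gi).map_add, hg.trLam_vecNon, hg.trLam_weylNon, add_zero]

theorem trQ_of_pure {X : Arr3} (h : X = vecNon g l + weylNon g q) : trQ gi X = q := by
  rw [h, (isLinearMap_trQ gi).map_add, hg.trQ_vecNon, hg.trQ_weylNon, zero_add]

theorem axTor_vecTor : axTor (vecTor g τ) = 0 := by
  funext m n a
  simp only [axTor, vecTor, Pi.zero_apply]
  rw [hg.symm a m, hg.symm n m, hg.symm a n]; ring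

theorem tenTor_vecTor : tenTor g gi (vecTor g τ) = 0 := by
  funext m n a
  simp only [tenTor, hg.trT_vecTor, hg.axTor_vecTor]; simp

theorem binNon_pure {X : Arr3} (h : X = vecNon g l + weylNon g q) : binNon g gi X = 0 := by
  funext m a b
  simp only [binNon, omegaNon, hg.trQ_of_pure h, hg.trLam_of_pure h]
  simp only [h, vecNon, weylNon, Pi.add_apply, Pi.zero_apply]
  rw [hg.symm a m, hg.symm b m, hg.symm b a]; ring

theorem triNon_pure {X : Arr3} (h : X = vecNon g l + weylNon g q) : triNon g gi X = 0 := by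
  funext m a b
  simp only [triNon, hg.binNon_pure h, hg.trQ_of_pure h, hg.trLam_of_pure h]
  simp [h]

omit hg in
theorem vecTor_antisymm (v : Arr1) (m n a : Fin 4) : vecTor g v m n a = -vecTor g v n m a := by
  simp only [vecTor]; ring

theorem pure_symm (m a b : Fin 4) : (vecNon g l + weylNon g q) m a b
    = (vecNon g l + weylNon g q) m b a := by
  simp only [Pi.add_apply, vecNon, weylNon]; rw [hg.symm a b]; ring

omit hg in
theorem pair_zero (v : Arr1) : pair gi v 0 = 0 := by simp [pair]

theorem contr3_pure {X Y : Arr3} (h : X = vecNon g l + weylNon g q)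
    (hY : ∀ m a b, Y m a b = Y m b a) (h1 : trLam gi Y = 0) (h2 : trQ gi Y = 0) :
    contr3 gi X Y = 0 := by
  rw [h, hg.contr3_comm, contr3_add_right, hg.contr3_vecNon Y _ hY, hg.contr3_weylNon, h1, h2,
    pair_zero, pair_zero]; simp

/-- At a pure-trace field only `traceForm` has a first variation. In any other term, either the
trace-free projection is taken of the unvaried field and is zero, or it is taken of the variation
and is orthogonal to the pure-trace field. The couplings `a1`, `a3`, `b1`, `b2`, `c1` therefore drop
out of the field equations. -/
theorem hasDerivAt_quadForm (p : Params) {T X : ℝ → Arr3} {T' X' : Arr3} {t : ℝ}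
    (hT : HasDerivAt T T' t) (hX : HasDerivAt X X' t)
    (aT : ∀ s m n a, T s m n a = -T s n m a) (sX : ∀ s m a b, X s m a b = X s m b a)
    (aT' : ∀ m n a, T' m n a = -T' n m a) (sX' : ∀ m a b, X' m a b = X' m b a)
    (hT0 : T t = vecTor g τ) (hX0 : X t = vecNon g l + weylNon g q) :
    HasDerivAt (fun s => quadForm p g gi (T s) (X s))
      (traceForm' p gi τ l q (trT gi T') (trLam gi X') (trQ gi X')) t := by
  have e : (fun s => quadForm p g gi (T s) (X s)) = _ :=
    funext fun s => hg.quadForm_eq p (T s) (X s) (aT s) (sX s)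
  rw [e]
  have d1 := hasDerivAt_contr3 gi hT (hasDerivAt_of_isLinearMap (isLinearMap_tenTor g gi) hT)
  have d2 := hasDerivAt_contr3 gi hT (hasDerivAt_of_isLinearMap isLinearMap_axTor hT)
  have d3 := hasDerivAt_contr3 gi hX (hasDerivAt_of_isLinearMap (isLinearMap_triNon g gi) hX)
  have d4 := hasDerivAt_contr3 gi hX (hasDerivAt_of_isLinearMap (isLinearMap_binNon g gi) hX)
  have d5 := hasDerivAt_contr3 gi (hasDerivAt_of_isLinearMap isLinearMap_wedge
    (hasDerivAt_of_isLinearMap (isLinearMap_binNon g gi) hX)) hT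
  have d6 := hg.hasDerivAt_traceForm p (hasDerivAt_of_isLinearMap (isLinearMap_trT gi) hT)
    (hasDerivAt_of_isLinearMap (isLinearMap_trLam gi) hX)
    (hasDerivAt_of_isLinearMap (isLinearMap_trQ gi) hX)
  have tenTor_antisymm : ∀ m n a, tenTor g gi T' m n a = -tenTor g gi T' n m a := fun m n a => by
    simp only [tenTor, vecTor, axTor]
    rw [aT' m n a, aT' n a m, aT' a m n]; ring
  have axTor_antisymm : ∀ m n a, axTor T' m n a = -axTor T' n m a := fun m n a => by
    simp only [axTor]
    rw [aT' m n a, aT' n a m, aT' a m n]; ring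
  have wedge_antisymm : ∀ m n a, Jet.wedgeCoframe (binNon g gi X') m n a
      = -Jet.wedgeCoframe (binNon g gi X') n m a := fun m n a => by
    simp only [Jet.wedgeCoframe]; ring
  have z1 : contr3 gi T' (tenTor g gi (T t)) + contr3 gi (T t) (tenTor g gi T') = 0 := by
    rw [hT0, hg.tenTor_vecTor, contr3_zero_right, hg.contr3_comm,
      hg.contr3_vecTor _ _ tenTor_antisymm, hg.trT_tenTor _ aT', pair_zero]; simp
  have z2 : contr3 gi T' (axTor (T t)) + contr3 gi (T t) (axTor T') = 0 := by
    rw [hT0, hg.axTor_vecTor, contr3_zero_right, hg.contr3_comm,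
      hg.contr3_vecTor _ _ axTor_antisymm, hg.trT_axTor _ aT', pair_zero]; simp
  have z3 : contr3 gi X' (triNon g gi (X t)) + contr3 gi (X t) (triNon g gi X') = 0 := by
    rw [hg.triNon_pure hX0, contr3_zero_right, hg.contr3_pure hX0 (hg.triNon_symm X' sX')
      (hg.trLam_triNon X' sX') (hg.trQ_triNon X' sX')]; simp
  have z4 : contr3 gi X' (binNon g gi (X t)) + contr3 gi (X t) (binNon g gi X') = 0 := by
    rw [hg.binNon_pure hX0, contr3_zero_right, hg.contr3_pure hX0 (binNon_symm X')
      (hg.trLam_binNon X' sX') (hg.trQ_binNon X' sX')]; simp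
  have z5 : contr3 gi (Jet.wedgeCoframe (binNon g gi X')) (T t)
      + contr3 gi (Jet.wedgeCoframe (binNon g gi (X t))) T' = 0 := by
    rw [hT0, hg.contr3_vecTor _ _ wedge_antisymm, hg.trT_wedge_binNon X' sX', hg.binNon_pure hX0,
      isLinearMap_wedge.map_zero, hg.contr3_comm, contr3_zero_right, pair_zero]; simp
  rw [z1] at d1
  rw [z2] at d2
  rw [z3] at d3
  rw [z4] at d4
  rw [z5] at d5
  rw [hg.trT_of_pure hT0, hg.trLam_of_pure hX0, hg.trQ_of_pure hX0] at d6
  have := ((((((d1.const_mul p.a1).add (d2.const_mul p.a3)).const_mul (1 / 2)).add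
    (d3.const_mul p.b1)).add (d4.const_mul p.b2)).sub (d5.const_mul p.c1)).add d6
  refine HasDerivAt.congr_deriv this ?_
  ring

theorem quadForm_pure (p : Params) {T X : Arr3} (hT : T = vecTor g τ)
    (hX : X = vecNon g l + weylNon g q) : quadForm p g gi T X = traceForm p gi τ l q := by
  rw [hg.quadForm_eq p T X (by rw [hT]; exact vecTor_antisymm τ)
    (by rw [hX]; exact hg.pure_symm), hg.trT_of_pure hT, hg.trLam_of_pure hX, hg.trQ_of_pure hX,
    hg.binNon_pure hX, hg.triNon_pure hX, isLinearMap_wedge.map_zero, hg.contr3_comm 0 T]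
  simp only [contr3_zero_right, hT, hg.tenTor_vecTor, hg.axTor_vecTor]
  ring

end IsMetricPair

/-! ### First variation of the Lagrangian -/

-- Derivatives at the identity suffice, since a variation of the coordinate coframe has the matrix
-- `1 + t • w`. The operator norm makes matrices a normed algebra, in which the ring inverse is
-- differentiable.
open scoped Matrix.Norms.Operator in
theorem hasDerivAt_matrix_inv (M : Matrix (Fin 4) (Fin 4) ℝ) (a b : Fin 4) :
    HasDerivAt (fun t : ℝ => (1 + t • M)⁻¹ a b) (-M a b) 0 := by
  have h1 : HasDerivAt (fun t : ℝ => (1 : Matrix (Fin 4) (Fin 4) ℝ) + t • M) ((1 : ℝ) • M) 0 :=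
    ((hasDerivAt_id (0 : ℝ)).smul_const M).const_add 1
  have h2 := hasFDerivAt_ringInverse (𝕜 := ℝ) (1 : (Matrix (Fin 4) (Fin 4) ℝ)ˣ)
  have h2' : HasFDerivAt Ring.inverse (-(((ContinuousLinearMap.mulLeftRight ℝ
      (Matrix (Fin 4) (Fin 4) ℝ)) 1) 1)) ((1 : Matrix (Fin 4) (Fin 4) ℝ) + (0 : ℝ) • M) := by
    simpa using h2
  have h3 := hasDerivAt_of_isLinearMap (f := fun N : Matrix (Fin 4) (Fin 4) ℝ => N a b)
    ⟨fun _ _ => rfl, fun _ _ => rfl⟩ (h2'.comp_hasDerivAt (0 : ℝ) h1)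
  simpa [Matrix.nonsing_inv_eq_ringInverse] using h3

theorem hasDerivAt_matrix_det (M : Matrix (Fin 4) (Fin 4) ℝ) :
    HasDerivAt (fun t : ℝ => (1 + t • M).det) M.trace 0 := by
  have e : (fun t : ℝ => (1 + t • M).det) = fun t : ℝ =>
      ((1 + (Polynomial.X : Polynomial ℝ) • M.map (Polynomial.C (R := ℝ))).det).eval t := by
    funext t
    rw [← Polynomial.coe_evalRingHom, RingHom.map_det]
    congr 1
    ext i j
    rcases eq_or_ne i j with rfl | h <;> simp [*, mul_comm t]
  rw [e]
  have := ((1 + (Polynomial.X : Polynomial ℝ) • M.map (Polynomial.C (R := ℝ))).det).hasDerivAt 0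
  rwa [Matrix.derivative_det_one_add_X_smul] at this

namespace Jet

/-- The natural coframe `θ^a = dx^a`. -/
def HasUnitCoframe (J : Jet) : Prop := J.e = fun μ a => if μ = a then 1 else 0

/-- Variation of all fields but the anholonomic metric. -/
def vary (J V : Jet) (t : ℝ) : Jet where
  g := J.g
  dg := J.dg
  e := J.e + t • V.e
  de := J.de + t • V.de
  Γ := J.Γ + t • V.Γ
  dΓ := J.dΓ + t • V.dΓ
  A := J.A + t • V.A
  dA := J.dA + t • V.dA

/-- Coordinate components of the torsion. -/
def torRaw (J : Jet) (d μ ν : Fin 4) : ℝ :=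
  J.de μ ν d - J.de ν μ d + ∑ a, (J.Γ μ a d * J.e ν a - J.Γ ν a d * J.e μ a)

/-- Coordinate components of the nonmetricity. -/
def nonRaw (J : Jet) (a b μ : Fin 4) : ℝ :=
  - J.dg μ a b + ∑ c, (J.Γ μ a c * J.g c b + J.Γ μ b c * J.g a c)

/-- Coordinate components of the curvature. -/
def curvRaw (J : Jet) (a b μ ν : Fin 4) : ℝ :=
  J.dΓ μ ν a b - J.dΓ ν μ a b + ∑ c, (J.Γ μ c b * J.Γ ν a c - J.Γ ν c b * J.Γ μ a c)

/-- Coordinate components of the electromagnetic field. -/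
def fieldRaw (J : Jet) (μ ν : Fin 4) : ℝ := J.dA μ ν - J.dA ν μ

/-- First variation of `torRaw`. -/
def torRaw' (J V : Jet) (d μ ν : Fin 4) : ℝ :=
  V.de μ ν d - V.de ν μ d + ∑ a, (V.Γ μ a d * J.e ν a + J.Γ μ a d * V.e ν a
    - (V.Γ ν a d * J.e μ a + J.Γ ν a d * V.e μ a))

/-- First variation of `nonRaw`. -/
def nonRaw' (J V : Jet) (a b μ : Fin 4) : ℝ :=
  ∑ c, (V.Γ μ a c * J.g c b + V.Γ μ b c * J.g a c)

/-- First variation of `curvRaw`. -/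
def curvRaw' (J V : Jet) (a b μ ν : Fin 4) : ℝ :=
  V.dΓ μ ν a b - V.dΓ ν μ a b + ∑ c, (V.Γ μ c b * J.Γ ν a c + J.Γ μ c b * V.Γ ν a c
    - (V.Γ ν c b * J.Γ μ a c + J.Γ ν c b * V.Γ μ a c))

/-- First variation of the frame components of a 1-form. -/
def oneVar (w : Arr2) (X X' : Arr1) : Arr1 := fun a => X' a - ∑ μ, w a μ * X μ

/-- First variation of the frame components of a 2-form. -/
def twoVar (w : Arr2) (X X' : Arr2) : Arr2 := fun a b =>
  X' a b - (∑ μ, w a μ * X μ b) - ∑ ν, w b ν * X a ν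

/-- First variation of the torsion. -/
def torVar (J V : Jet) : Arr3 := fun m n c =>
  ∑ d, J.g c d * twoVar V.e (J.torRaw d) (torRaw' J V d) m n

/-- First variation of the nonmetricity. -/
def nonVar (J V : Jet) : Arr3 := fun m a b => oneVar V.e (J.nonRaw a b) (nonRaw' J V a b) m

/-- First variation of the curvature. -/
def curvVar (J V : Jet) : Arr4 := fun m n a b =>
  twoVar V.e (J.curvRaw a b) (curvRaw' J V a b) m n

/-- First variation of the electromagnetic field. -/
def fieldVar (J V : Jet) : Arr2 := twoVar V.e J.fieldRaw V.fieldRaw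

/-- The trace `R_c^c` of the curvature. -/
def curvTr (J : Jet) : Arr2 := fun m n => ∑ c, J.curv m n c c

/-- First variation of `curvTr`. -/
def curvTrVar (J V : Jet) : Arr2 := fun m n => ∑ c, curvVar J V m n c c

/-- First variation of the curvature scalar. -/
def scalarVar (J V : Jet) : ℝ := ∑ m, ∑ n, ∑ a, J.gi m a * curvVar J V m n a n

variable {J : Jet}

theorem HasUnitCoframe.apply (h : J.HasUnitCoframe) (μ a : Fin 4) :
    J.e μ a = if μ = a then 1 else 0 := congrFun (congrFun h μ) a

theorem HasUnitCoframe.frame_eq (h : J.HasUnitCoframe) (a μ : Fin 4) :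
    J.frame a μ = if a = μ then 1 else 0 := by
  have : Matrix.of J.e = 1 := by ext i j; simp [h.apply, Matrix.one_apply]
  simp [Jet.frame, this, Matrix.one_apply]

theorem HasUnitCoframe.ofOneForm_eq (h : J.HasUnitCoframe) (X : Arr1) : J.ofOneForm X = X := by
  funext a; simp [Jet.ofOneForm, h.frame_eq]

theorem HasUnitCoframe.ofTwoForm_eq (h : J.HasUnitCoframe) (X : Arr2) : J.ofTwoForm X = X := by
  funext a b; simp [Jet.ofTwoForm, h.frame_eq]

theorem vary_zero (J V : Jet) : J.vary V 0 = J := by simp [vary]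

theorem HasUnitCoframe.hasDerivAt_frame (h : J.HasUnitCoframe) (V : Jet) (a μ : Fin 4) :
    HasDerivAt (fun t => (J.vary V t).frame a μ) (-V.e a μ) 0 := by
  have : ∀ t : ℝ, Matrix.of (J.vary V t).e = 1 + t • Matrix.of V.e := fun t => by
    ext i j; simp [vary, h.apply, Matrix.one_apply]
  simp only [frame, this]
  exact hasDerivAt_matrix_inv _ a μ

theorem HasUnitCoframe.hasDerivAt_ofOneForm (h : J.HasUnitCoframe) (V : Jet) {X : ℝ → Arr1}
    {X' : Arr1} (hX : ∀ a, HasDerivAt (fun t => X t a) (X' a) 0) (a : Fin 4) :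
    HasDerivAt (fun t => (J.vary V t).ofOneForm (X t) a) (oneVar V.e (X 0) X' a) 0 := by
  unfold Jet.ofOneForm
  refine (HasDerivAt.fun_sum fun μ _ => (h.hasDerivAt_frame V a μ).mul (hX μ)).congr_deriv ?_
  simp [vary_zero, h.frame_eq, Finset.sum_add_distrib, oneVar]; ring

theorem HasUnitCoframe.hasDerivAt_ofTwoForm (h : J.HasUnitCoframe) (V : Jet) {X : ℝ → Arr2}
    {X' : Arr2} (hX : ∀ a b, HasDerivAt (fun t => X t a b) (X' a b) 0) (a b : Fin 4) :
    HasDerivAt (fun t => (J.vary V t).ofTwoForm (X t) a b) (twoVar V.e (X 0) X' a b) 0 := by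
  unfold Jet.ofTwoForm
  refine (HasDerivAt.fun_sum fun μ _ => HasDerivAt.fun_sum fun ν _ =>
    ((h.hasDerivAt_frame V a μ).mul (h.hasDerivAt_frame V b ν)).mul (hX μ ν)).congr_deriv ?_
  simp [vary_zero, h.frame_eq, Finset.sum_add_distrib, twoVar, add_mul]; ring

theorem hasDerivAt_affine (x y : ℝ) : HasDerivAt (fun t => x + t * y) y 0 := by
  simpa using ((hasDerivAt_id (0 : ℝ)).mul_const y).const_add x

theorem hasDerivAt_torRaw (J V : Jet) (d μ ν : Fin 4) :
    HasDerivAt (fun t => (J.vary V t).torRaw d μ ν) (torRaw' J V d μ ν) 0 := by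
  simp only [torRaw, vary, Pi.add_apply, Pi.smul_apply, smul_eq_mul]
  have := ((hasDerivAt_affine (J.de μ ν d) (V.de μ ν d)).sub
    (hasDerivAt_affine (J.de ν μ d) (V.de ν μ d))).add
    (HasDerivAt.fun_sum (u := Finset.univ) fun a _ =>
      ((hasDerivAt_affine (J.Γ μ a d) (V.Γ μ a d)).mul (hasDerivAt_affine (J.e ν a) (V.e ν a))).sub
      ((hasDerivAt_affine (J.Γ ν a d) (V.Γ ν a d)).mul (hasDerivAt_affine (J.e μ a) (V.e μ a))))
  refine this.congr_deriv ?_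
  simp [torRaw']

theorem hasDerivAt_nonRaw (J V : Jet) (a b μ : Fin 4) :
    HasDerivAt (fun t => (J.vary V t).nonRaw a b μ) (nonRaw' J V a b μ) 0 := by
  simp only [nonRaw, vary, Pi.add_apply, Pi.smul_apply, smul_eq_mul]
  exact (HasDerivAt.fun_sum (u := Finset.univ) fun c _ =>
      ((hasDerivAt_affine (J.Γ μ a c) (V.Γ μ a c)).mul_const (J.g c b)).add
      ((hasDerivAt_affine (J.Γ μ b c) (V.Γ μ b c)).mul_const (J.g a c))).const_add _

theorem hasDerivAt_curvRaw (J V : Jet) (a b μ ν : Fin 4) :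
    HasDerivAt (fun t => (J.vary V t).curvRaw a b μ ν) (curvRaw' J V a b μ ν) 0 := by
  simp only [curvRaw, vary, Pi.add_apply, Pi.smul_apply, smul_eq_mul]
  have := ((hasDerivAt_affine (J.dΓ μ ν a b) (V.dΓ μ ν a b)).sub
    (hasDerivAt_affine (J.dΓ ν μ a b) (V.dΓ ν μ a b))).add
    (HasDerivAt.fun_sum (u := Finset.univ) fun c _ =>
      ((hasDerivAt_affine (J.Γ μ c b) (V.Γ μ c b)).mul
        (hasDerivAt_affine (J.Γ ν a c) (V.Γ ν a c))).sub
      ((hasDerivAt_affine (J.Γ ν c b) (V.Γ ν c b)).mul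
        (hasDerivAt_affine (J.Γ μ a c) (V.Γ μ a c))))
  refine this.congr_deriv ?_
  simp [curvRaw']

theorem hasDerivAt_fieldRaw (J V : Jet) (μ ν : Fin 4) :
    HasDerivAt (fun t => (J.vary V t).fieldRaw μ ν) (V.fieldRaw μ ν) 0 := by
  simp only [fieldRaw, vary, Pi.add_apply, Pi.smul_apply, smul_eq_mul]
  exact (hasDerivAt_affine (J.dA μ ν) (V.dA μ ν)).sub (hasDerivAt_affine (J.dA ν μ) (V.dA ν μ))

theorem HasUnitCoframe.hasDerivAt_torsion (h : J.HasUnitCoframe) (V : Jet) :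
    HasDerivAt (fun t => (J.vary V t).torsion) (torVar J V) 0 := by
  refine hasDerivAt_pi.2 fun m => hasDerivAt_pi.2 fun n => hasDerivAt_pi.2 fun c => ?_
  refine (HasDerivAt.fun_sum (u := Finset.univ) fun d _ =>
    (h.hasDerivAt_ofTwoForm V (hasDerivAt_torRaw J V d) m n).const_mul (J.g c d)).congr_deriv ?_
  simp [torVar, vary_zero]

theorem HasUnitCoframe.hasDerivAt_nonmet (h : J.HasUnitCoframe) (V : Jet) :
    HasDerivAt (fun t => (J.vary V t).nonmet) (nonVar J V) 0 := by
  refine hasDerivAt_pi.2 fun m => hasDerivAt_pi.2 fun a => hasDerivAt_pi.2 fun b => ?_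
  refine (h.hasDerivAt_ofOneForm V (hasDerivAt_nonRaw J V a b) m).congr_deriv ?_
  simp [nonVar, vary_zero]

theorem HasUnitCoframe.hasDerivAt_curv (h : J.HasUnitCoframe) (V : Jet) (m n a b : Fin 4) :
    HasDerivAt (fun t => (J.vary V t).curv m n a b) (curvVar J V m n a b) 0 := by
  refine (h.hasDerivAt_ofTwoForm V (hasDerivAt_curvRaw J V a b) m n).congr_deriv ?_
  simp [curvVar, vary_zero]

theorem HasUnitCoframe.hasDerivAt_fieldStrength (h : J.HasUnitCoframe) (V : Jet) (m n : Fin 4) :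
    HasDerivAt (fun t => (J.vary V t).fieldStrength m n) (fieldVar J V m n) 0 := by
  refine (h.hasDerivAt_ofTwoForm V (hasDerivAt_fieldRaw J V) m n).congr_deriv ?_
  simp [fieldVar, vary_zero]

theorem HasUnitCoframe.hasDerivAt_curvTr (h : J.HasUnitCoframe) (V : Jet) (m n : Fin 4) :
    HasDerivAt (fun t => (J.vary V t).curvTr m n) (curvTrVar J V m n) 0 :=
  HasDerivAt.fun_sum fun c _ => h.hasDerivAt_curv V m n c c

theorem HasUnitCoframe.hasDerivAt_curvScalar (h : J.HasUnitCoframe) (V : Jet) :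
    HasDerivAt (fun t => (J.vary V t).curvScalar) (scalarVar J V) 0 :=
  HasDerivAt.fun_sum fun m _ => HasDerivAt.fun_sum fun n _ => HasDerivAt.fun_sum fun a _ =>
    (h.hasDerivAt_curv V m n a n).const_mul (J.gi m a)

theorem HasUnitCoframe.hasDerivAt_vol (h : J.HasUnitCoframe) (V : Jet) :
    HasDerivAt (fun t => (J.vary V t).vol)
      (Real.sqrt |(Matrix.of J.g).det| * ∑ a, V.e a a) 0 := by
  have : ∀ t : ℝ, Matrix.of (J.vary V t).e = 1 + t • Matrix.of V.e := fun t => by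
    ext i j; simp [vary, h.apply, Matrix.one_apply]
  simp only [vol, this]
  exact (hasDerivAt_matrix_det (Matrix.of V.e)).const_mul (Real.sqrt |(Matrix.of J.g).det|)

theorem hasDerivAt_ip2 (J : Jet) {X : ℝ → Arr2} {X' : Arr2}
    (hs : ∀ a b, J.gi a b = J.gi b a)
    (hX : ∀ a b, HasDerivAt (fun t => X t a b) (X' a b) 0) :
    HasDerivAt (fun t => J.ip2 (X t) (X t)) (2 * J.ip2 (X 0) X') 0 := by
  unfold ip2
  refine (HasDerivAt.fun_sum fun a _ => HasDerivAt.fun_sum fun b _ => HasDerivAt.fun_sum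
    fun a' _ => HasDerivAt.fun_sum fun b' _ =>
      ((hX a b).const_mul (J.gi a a' * J.gi b b')).mul (hX a' b')).congr_deriv ?_
  simp only [Finset.sum_add_distrib]
  rw [two_mul]
  congr 1
  have key : ∀ F : Fin 4 → Fin 4 → Fin 4 → Fin 4 → ℝ,
      ∑ a, ∑ b, ∑ a', ∑ b', F a b a' b' = ∑ a, ∑ b, ∑ a', ∑ b', F a' b' a b := by
    intro F
    calc _ = ∑ a, ∑ a', ∑ b, ∑ b', F a b a' b' := by congr! 1; rw [Finset.sum_comm]
      _ = ∑ a', ∑ a, ∑ b', ∑ b, F a b a' b' := by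
        rw [Finset.sum_comm]; congr! 2; rw [Finset.sum_comm]
      _ = _ := by congr! 1; rw [Finset.sum_comm]
  rw [key]
  congr! 4 with a _ b _ a' _ b' _
  rw [hs a' a, hs b' b]; ring

/-- The factor is `(1/4)²` from the definition of `⁽⁵⁾Z` times the full contraction `g_{ab} g^{ab} =
4`. It accounts for the coefficient `z₅/(16ρ)` in `lagScalar`. -/
theorem ip4_curvZ5_eq (hg : IsMetricPair J.g J.gi) :
    J.ip4 J.curvZ5 J.curvZ5 = 1 / 4 * J.ip2 J.curvTr J.curvTr := by
  -- Symmetrization does not affect the trace, so `Z_c^c = R_c^c`.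
  have hZ : ∀ m n a b, J.curvZ5 m n a b = 1 / 4 * (J.g a b * J.curvTr m n) := by
    intro m n a b
    have e1 : ∑ c, ∑ d, J.gi c d * J.curvLow m n c d = J.curvTr m n := by
      simp only [curvLow, curvTr, Finset.mul_sum]
      congr! 1 with c
      have : ∀ d e, J.gi c d * (J.curv m n c e * J.g e d)
          = J.curv m n c e * (J.gi c d * J.g d e) := fun d e => by rw [hg.symm e d]; ring
      rw [Finset.sum_comm]
      simp only [this, ← Finset.mul_sum, hg.inv]
      simp
    have e2 : ∑ c, ∑ d, J.gi c d * J.curvSym m n c d = J.curvTr m n := by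
      have : ∑ c, ∑ d, J.gi c d * J.curvSym m n c d
          = 1 / 2 * ((∑ c, ∑ d, J.gi c d * J.curvLow m n c d)
            + ∑ d, ∑ c, J.gi c d * J.curvLow m n d c) := by
        rw [Finset.sum_comm (f := fun d c => J.gi c d * J.curvLow m n d c)]
        simp only [curvSym, ← Finset.sum_add_distrib, Finset.mul_sum]
        congr! 2; ring
      rw [this, e1]
      have : ∑ d, ∑ c, J.gi c d * J.curvLow m n d c = J.curvTr m n := by
        rw [← e1]; congr! 2 with c _ d; rw [hg.symm_inv]
      rw [this]; ring
    simp only [curvZ5, e2]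
  have h1 : ∀ c d, ∑ c', ∑ d', J.gi c c' * J.gi d d' * J.g c' d' = J.gi c d := by
    intro c d
    have : ∀ c', ∑ d', J.gi c c' * J.gi d d' * J.g c' d' = J.gi c c' * (if d = c' then 1 else 0) :=
      fun c' => by
        rw [← hg.inv, Finset.mul_sum]; congr! 1 with d'; rw [hg.symm c' d']; ring
    simp [this]
  have h2 : ∑ c, ∑ d, J.g c d * J.gi c d = 4 := by
    have := hg.trace_self 1
    simp only [mul_one] at this
    rw [← this]; congr! 2; ring
  have h3 : ∑ c, ∑ d, ∑ c', ∑ d', J.gi c c' * J.gi d d' * J.g c d * J.g c' d' = 4 := by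
    rw [← h2]
    congr! 2 with c _ d
    rw [← h1 c d]
    simp only [Finset.mul_sum]
    congr! 2; ring
  unfold ip4 ip2
  simp only [hZ]
  rw [Finset.mul_sum]
  refine Finset.sum_congr rfl fun a _ => ?_
  rw [Finset.mul_sum]
  refine Finset.sum_congr rfl fun b _ => ?_
  calc ∑ c, ∑ d, ∑ a', ∑ b', ∑ c', ∑ d', J.gi a a' * J.gi b b' * J.gi c c' * J.gi d d'
        * (1 / 4 * (J.g c d * J.curvTr a b)) * (1 / 4 * (J.g c' d' * J.curvTr a' b'))
      = ∑ a', ∑ b', ∑ c, ∑ d, ∑ c', ∑ d', J.gi a a' * J.gi b b' * J.gi c c' * J.gi d d'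
        * (1 / 4 * (J.g c d * J.curvTr a b)) * (1 / 4 * (J.g c' d' * J.curvTr a' b')) := by
        have sw : ∀ F : Fin 4 → Fin 4 → Fin 4 → Fin 4 → ℝ,
            ∑ c, ∑ d, ∑ a', ∑ b', F c d a' b' = ∑ a', ∑ b', ∑ c, ∑ d, F c d a' b' := by
          intro F
          calc _ = ∑ c, ∑ a', ∑ d, ∑ b', F c d a' b' := by congr! 1; rw [Finset.sum_comm]
            _ = ∑ a', ∑ c, ∑ b', ∑ d, F c d a' b' := by
              rw [Finset.sum_comm]; congr! 2; rw [Finset.sum_comm]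
            _ = _ := by congr! 1; rw [Finset.sum_comm]
        exact sw fun c d a' b' => ∑ c', ∑ d', J.gi a a' * J.gi b b' * J.gi c c' * J.gi d d'
          * (1 / 4 * (J.g c d * J.curvTr a b)) * (1 / 4 * (J.g c' d' * J.curvTr a' b'))
    _ = ∑ a', ∑ b', (1 / 16 * (J.gi a a' * J.gi b b' * J.curvTr a b * J.curvTr a' b'))
          * ∑ c, ∑ d, ∑ c', ∑ d', J.gi c c' * J.gi d d' * J.g c d * J.g c' d' := by
        simp only [Finset.mul_sum]
        congr! 6; ring
    _ = _ := by
        rw [h3]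
        simp only [Finset.mul_sum]
        congr! 2; ring

/-- The Lagrangian without the volume factor. -/
def lagScalar (p : Params) (J : Jet) : ℝ :=
  -(1 / (2 * p.κ)) * (2 * p.lam - p.a0 * J.curvScalar + quadForm p J.g J.gi J.torsion J.nonmet)
    - p.z5 / (16 * p.ρ) * J.ip2 J.curvTr J.curvTr
    - 1 / 4 * J.ip2 J.fieldStrength J.fieldStrength

theorem lagrangian_eq (p : Params) (hg : IsMetricPair J.g J.gi) :
    lagrangian p J = lagScalar p J * J.vol := by
  unfold lagrangian lagScalar
  rw [weakBracket_eq, ip4_curvZ5_eq hg]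
  ring

theorem ofTwoForm_antisymm (J : Jet) {X : Arr2} (hX : ∀ a b, X a b = -X b a) (a b : Fin 4) :
    J.ofTwoForm X a b = -J.ofTwoForm X b a := by
  simp only [ofTwoForm]
  rw [Finset.sum_comm, ← Finset.sum_neg_distrib]
  simp only [← Finset.sum_neg_distrib]
  congr! 2 with μ _ ν; rw [hX]; ring

theorem torsion_antisymm (J : Jet) (m n c : Fin 4) : J.torsion m n c = -J.torsion n m c := by
  simp only [torsion]
  rw [← Finset.sum_neg_distrib]
  congr! 1 with d
  rw [ofTwoForm_antisymm]
  · ring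
  · intro μ ν
    have : ∑ a, (J.Γ μ a d * J.e ν a - J.Γ ν a d * J.e μ a)
        = -∑ a, (J.Γ ν a d * J.e μ a - J.Γ μ a d * J.e ν a) := by
      rw [← Finset.sum_neg_distrib]; congr! 1; ring
    rw [this]; ring

theorem nonmet_symm (J : Jet) (hd : ∀ μ a b, J.dg μ a b = J.dg μ b a)
    (hg : ∀ a b, J.g a b = J.g b a) (m a b : Fin 4) : J.nonmet m a b = J.nonmet m b a := by
  simp only [nonmet]
  congr! 2 with μ
  rw [hd μ a b]
  congr! 2 with c
  rw [hg c b, hg a c]; ring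

theorem torVar_antisymm (J V : Jet) (m n c : Fin 4) : torVar J V m n c = -torVar J V n m c := by
  have h1 : ∀ d μ ν, J.torRaw d μ ν = -J.torRaw d ν μ := fun d μ ν => by
    have : ∑ a, (J.Γ μ a d * J.e ν a - J.Γ ν a d * J.e μ a)
        = -∑ a, (J.Γ ν a d * J.e μ a - J.Γ μ a d * J.e ν a) := by
      rw [← Finset.sum_neg_distrib]; congr! 1; ring
    simp only [torRaw, this]; ring
  have h2 : ∀ d μ ν, torRaw' J V d μ ν = -torRaw' J V d ν μ := fun d μ ν => by
    have : ∑ a, (V.Γ μ a d * J.e ν a + J.Γ μ a d * V.e ν a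
          - (V.Γ ν a d * J.e μ a + J.Γ ν a d * V.e μ a))
        = -∑ a, (V.Γ ν a d * J.e μ a + J.Γ ν a d * V.e μ a
          - (V.Γ μ a d * J.e ν a + J.Γ μ a d * V.e ν a)) := by
      rw [← Finset.sum_neg_distrib]; congr! 1; ring
    simp only [torRaw', this]; ring
  simp only [torVar, twoVar]
  rw [← Finset.sum_neg_distrib]
  congr! 1 with d
  have h3 : ∑ μ, V.e m μ * J.torRaw d μ n = -∑ μ, V.e m μ * J.torRaw d n μ := by
    rw [← Finset.sum_neg_distrib]; congr! 1 with μ; rw [h1]; ring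
  have h4 : ∑ μ, V.e n μ * J.torRaw d m μ = -∑ μ, V.e n μ * J.torRaw d μ m := by
    rw [← Finset.sum_neg_distrib]; congr! 1 with μ; rw [h1]; ring
  rw [h2, h3, h4]; ring

theorem nonVar_symm (J V : Jet) (hd : ∀ μ a b, J.dg μ a b = J.dg μ b a)
    (hg : ∀ a b, J.g a b = J.g b a) (m a b : Fin 4) : nonVar J V m a b = nonVar J V m b a := by
  have h1 : J.nonRaw a b = J.nonRaw b a := by
    funext μ; simp only [nonRaw]; rw [hd μ a b]; congr! 2 with c; rw [hg c b, hg a c]; ring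
  have h2 : nonRaw' J V a b = nonRaw' J V b a := by
    funext μ; simp only [nonRaw']; congr! 1 with c; rw [hg c b, hg a c]; ring
  simp only [nonVar, h1, h2]

/-- The first variation of the Lagrangian at pure-trace fields in a coordinate coframe. -/
def lagVar (p : Params) (J V : Jet) (τ l q : Arr1) : ℝ :=
  Real.sqrt |(Matrix.of J.g).det| * (lagScalar p J * (∑ a, V.e a a)
    + (-(1 / (2 * p.κ)) * (-(p.a0 * scalarVar J V)
        + traceForm' p J.gi τ l q (trT J.gi (torVar J V)) (trLam J.gi (nonVar J V))
          (trQ J.gi (nonVar J V)))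
      - p.z5 / (8 * p.ρ) * J.ip2 J.curvTr (curvTrVar J V)
      - 1 / 2 * J.ip2 J.fieldStrength (fieldVar J V)))

/-- The product rule for scalar times volume. The symmetry of `dg` keeps the varied nonmetricity
symmetric, as the irreducible decomposition requires. -/
theorem HasUnitCoframe.hasDerivAt_lagrangian (h : J.HasUnitCoframe)
    (hg : IsMetricPair J.g J.gi) (hd : ∀ μ a b, J.dg μ a b = J.dg μ b a) (p : Params) (V : Jet)
    {τ l q : Arr1} (hT : J.torsion = vecTor J.g τ)
    (hQ : J.nonmet = vecNon J.g l + weylNon J.g q) :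
    HasDerivAt (fun t => lagrangian p (J.vary V t)) (lagVar p J V τ l q) 0 := by
  have e : (fun t => lagrangian p (J.vary V t)) = fun t => lagScalar p (J.vary V t)
      * (J.vary V t).vol := funext fun t => lagrangian_eq (J := J.vary V t) p hg
  rw [e]
  have dq := hg.hasDerivAt_quadForm p (h.hasDerivAt_torsion V) (h.hasDerivAt_nonmet V)
    (fun s => (J.vary V s).torsion_antisymm) (fun s => (J.vary V s).nonmet_symm hd hg.symm)
    (torVar_antisymm J V) (nonVar_symm J V hd hg.symm)
    (by simpa only [vary_zero] using hT) (by simpa only [vary_zero] using hQ)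
  have dR := h.hasDerivAt_curvScalar V
  have dZ := hasDerivAt_ip2 J hg.symm_inv (h.hasDerivAt_curvTr V)
  have dF := hasDerivAt_ip2 J hg.symm_inv (h.hasDerivAt_fieldStrength V)
  have dl := ((((dR.const_mul p.a0).const_sub (2 * p.lam)).add dq).const_mul
    (-(1 / (2 * p.κ)))).sub (dZ.const_mul (p.z5 / (16 * p.ρ))) |>.sub (dF.const_mul (1 / 4))
  have := dl.mul (h.hasDerivAt_vol V)
  refine HasDerivAt.congr_deriv (f := fun t => lagScalar p (J.vary V t) * (J.vary V t).vol)
    this ?_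
  have hv : J.vol = Real.sqrt |(Matrix.of J.g).det| := by
    have : Matrix.of J.e = 1 := by ext i j; simp [h.apply, Matrix.one_apply]
    simp [vol, this]
  simp only [Pi.sub_apply, Pi.add_apply, vary_zero, hv, lagVar]
  simp only [lagScalar]
  ring

end Jet

/-! ### The Kundt metric and its triplet connection at a point -/

/-- The metric `2 du h (S du + dv) - k (dx² + dy²)`. -/
def kMetric (h S k : ℝ) : Arr2 :=
  ![![2 * h * S, h, 0, 0], ![h, 0, 0, 0], ![0, 0, -k, 0], ![0, 0, 0, -k]]

/-- The inverse of `kMetric`. -/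
def kInv (h S k : ℝ) : Arr2 :=
  ![![0, h⁻¹, 0, 0], ![h⁻¹, -(2 * S * h⁻¹), 0, 0], ![0, 0, -k⁻¹, 0], ![0, 0, 0, -k⁻¹]]

/-- The functions entering the connection: `η = ∂_u ln h`, `p = ∇ ln h`, `r = ∇ ln k`, `m = h / k`,
the amplitude `ψ` of the triplet and `S` with its first derivatives. -/
structure KJet where
  (S Su Sv Sx Sy η px py rx ry m ψ : ℝ)

/-- The triplet connection: Levi-Civita plus `A φ_μ δ_a^b + B δ_μ^b φ_a + C g_{μa} φ^b`. -/
def conn (A B C : ℝ) (j : KJet) : Arr3 :=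
  ![![![j.η - j.Sv + A * j.ψ + B * j.ψ, j.Su - j.S * j.η + 2 * j.S * j.Sv + 2 * C * j.S * j.ψ,
        j.m * (j.Sx + j.S * j.px), j.m * (j.Sy + j.S * j.py)],
      ![0, j.Sv + A * j.ψ + C * j.ψ, j.m * j.px / 2, j.m * j.py / 2],
      ![j.px / 2, j.Sx, A * j.ψ, 0],
      ![j.py / 2, j.Sy, 0, A * j.ψ]],
    ![![0, j.Sv + B * j.ψ + C * j.ψ, j.m * j.px / 2, j.m * j.py / 2],
      ![0, 0, 0, 0],
      ![0, j.px / 2, 0, 0],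
      ![0, j.py / 2, 0, 0]],
    ![![j.px / 2, j.Sx, B * j.ψ, 0],
      ![0, j.px / 2, 0, 0],
      ![0, -(C * j.ψ * j.m⁻¹), j.rx / 2, -(j.ry / 2)],
      ![0, 0, j.ry / 2, j.rx / 2]],
    ![![j.py / 2, j.Sy, 0, B * j.ψ],
      ![0, j.py / 2, 0, 0],
      ![0, 0, j.ry / 2, j.rx / 2],
      ![0, -(C * j.ψ * j.m⁻¹), -(j.rx / 2), j.ry / 2]]]

/-- The derivative of `conn` at `j` in the direction `d`. -/
def dconn (A B C : ℝ) (j d : KJet) : Arr3 :=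
  ![![![d.η - d.Sv + A * d.ψ + B * d.ψ, d.Su - (d.S * j.η + j.S * d.η)
          + 2 * (d.S * j.Sv + j.S * d.Sv) + 2 * C * (d.S * j.ψ + j.S * d.ψ),
        d.m * (j.Sx + j.S * j.px) + j.m * (d.Sx + (d.S * j.px + j.S * d.px)),
        d.m * (j.Sy + j.S * j.py) + j.m * (d.Sy + (d.S * j.py + j.S * d.py))],
      ![0, d.Sv + A * d.ψ + C * d.ψ, (d.m * j.px + j.m * d.px) / 2,
        (d.m * j.py + j.m * d.py) / 2],
      ![d.px / 2, d.Sx, A * d.ψ, 0],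
      ![d.py / 2, d.Sy, 0, A * d.ψ]],
    ![![0, d.Sv + B * d.ψ + C * d.ψ, (d.m * j.px + j.m * d.px) / 2,
        (d.m * j.py + j.m * d.py) / 2],
      ![0, 0, 0, 0],
      ![0, d.px / 2, 0, 0],
      ![0, d.py / 2, 0, 0]],
    ![![d.px / 2, d.Sx, B * d.ψ, 0],
      ![0, d.px / 2, 0, 0],
      ![0, -(C * (d.ψ * j.m⁻¹ - j.ψ * d.m * (j.m⁻¹) ^ 2)), d.rx / 2, -(d.ry / 2)],
      ![0, 0, d.ry / 2, d.rx / 2]],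
    ![![d.py / 2, d.Sy, 0, B * d.ψ],
      ![0, d.py / 2, 0, 0],
      ![0, 0, d.ry / 2, d.rx / 2],
      ![0, -(C * (d.ψ * j.m⁻¹ - j.ψ * d.m * (j.m⁻¹) ^ 2)), -(d.rx / 2), d.ry / 2]]]

/-- The first derivatives of `kMetric`. -/
def dkMetric (h k : ℝ) (j : KJet) : Fin 4 → Arr2 :=
  ![![![2 * h * (j.η * j.S + j.Su), h * j.η, 0, 0], ![h * j.η, 0, 0, 0],
      ![0, 0, 0, 0], ![0, 0, 0, 0]],
    ![![2 * h * j.Sv, 0, 0, 0], ![0, 0, 0, 0], ![0, 0, 0, 0], ![0, 0, 0, 0]],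
    ![![2 * h * (j.px * j.S + j.Sx), h * j.px, 0, 0], ![h * j.px, 0, 0, 0],
      ![0, 0, -(k * j.rx), 0], ![0, 0, 0, -(k * j.rx)]],
    ![![2 * h * (j.py * j.S + j.Sy), h * j.py, 0, 0], ![h * j.py, 0, 0, 0],
      ![0, 0, -(k * j.ry), 0], ![0, 0, 0, -(k * j.ry)]]]

theorem isMetricPair_kMetric {h S k : ℝ} (hh : h ≠ 0) (hk : k ≠ 0) :
    IsMetricPair (kMetric h S k) (kInv h S k) where
  symm a b := by fin_cases a <;> fin_cases b <;> simp [kMetric]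
  symm_inv a b := by fin_cases a <;> fin_cases b <;> simp [kInv]
  inv a c := by
    fin_cases a <;> fin_cases c <;> simp [kMetric, kInv, Fin.sum_univ_four, hh, hk]
    field_simp; ring

theorem inv_kMetric {h S k : ℝ} (hh : h ≠ 0) (hk : k ≠ 0) :
    (Matrix.of (kMetric h S k))⁻¹ = Matrix.of (kInv h S k) := by
  refine Matrix.inv_eq_left_inv ?_
  ext a c
  simpa [Matrix.mul_apply, Matrix.one_apply] using (isMetricPair_kMetric hh hk).inv a c

theorem sqrt_det_kMetric {h S k : ℝ} (hh : 0 < h) (hk : 0 < k) :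
    Real.sqrt |(Matrix.of (kMetric h S k)).det| = h * k := by
  have : (Matrix.of (kMetric h S k)).det = -(h * k) ^ 2 := by
    rw [Matrix.det_succ_row_zero]
    simp [Fin.sum_univ_four, Matrix.det_fin_three, kMetric, Fin.succAbove]
    ring
  rw [this, abs_neg, abs_of_nonneg (by positivity), Real.sqrt_sq (by positivity)]

/-- The `du` 1-form with amplitude `ψ`. -/
def duForm (ψ : ℝ) : Arr1 := ![ψ, 0, 0, 0]

/-- The coefficients of the triplet connection. -/
def Params.cA (p : Params) : ℝ := p.k0 / 2 - p.k1 / 18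

/-- The coefficients of the triplet connection. -/
def Params.cB (p : Params) : ℝ := p.cA + p.k2 / 3

/-- The coefficients of the triplet connection. -/
def Params.cC (p : Params) : ℝ := 2 / 9 * p.k1 - p.cB

namespace Jet

theorem HasUnitCoframe.torsion_eq {J : Jet} (h : J.HasUnitCoframe) (hde : J.de = 0)
    (m n c : Fin 4) : J.torsion m n c = (∑ d, J.Γ m n d * J.g c d) - ∑ d, J.Γ n m d * J.g c d := by
  rw [← Finset.sum_sub_distrib]
  simp only [torsion, h.ofTwoForm_eq, hde]
  congr! 1 with d
  simp [h.apply, Finset.sum_sub_distrib]; ring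

theorem HasUnitCoframe.nonmet_eq {J : Jet} (h : J.HasUnitCoframe) (m a b : Fin 4) :
    J.nonmet m a b = - J.dg m a b + ((∑ c, J.Γ m a c * J.g c b) + ∑ c, J.Γ m b c * J.g a c) := by
  simp only [nonmet, h.ofOneForm_eq, Finset.sum_add_distrib]

end Jet

/-- The jets of the fields of the Ansatz, without the derivatives of the connection. -/
structure IsKundtJet (h k : ℝ) (j : KJet) (J : Jet) : Prop where
  h_pos : 0 < h
  k_pos : 0 < k
  m_eq : j.m = h / k
  g_eq : J.g = kMetric h j.S k
  dg_eq : J.dg = dkMetric h k j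
  unit : J.HasUnitCoframe
  de_eq : J.de = 0

namespace IsKundtJet

variable {h k : ℝ} {j : KJet} {J : Jet} (H : IsKundtJet h k j J)
include H

theorem gi_eq : J.gi = kInv h j.S k := by
  funext a b
  simp only [Jet.gi, H.g_eq]
  rw [inv_kMetric H.h_pos.ne' H.k_pos.ne']; rfl

theorem metricPair : IsMetricPair J.g J.gi := by
  rw [H.g_eq, H.gi_eq]; exact isMetricPair_kMetric H.h_pos.ne' H.k_pos.ne'

-- Koszul's argument: the nonmetricity prescribes the symmetric part of the lowered connection in
-- its last two indices, the torsion its antisymmetric part in the first two, and together these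
-- determine it.
set_option maxHeartbeats 2000000 in
theorem conn_unique (p : Params) (hT : J.torsion = vecTor J.g (p.k2 • duForm j.ψ))
    (hN : J.nonmet = vecNon J.g (p.k1 • duForm j.ψ) + weylNon J.g (p.k0 • duForm j.ψ)) :
    J.Γ = conn p.cA p.cB p.cC j := by
  have hh := H.h_pos.ne'
  have hk := H.k_pos.ne'
  have gs := H.metricPair.symm
  set L : Arr3 := fun m a b => ∑ c, J.Γ m a c * J.g c b with hL
  set T := vecTor J.g (p.k2 • duForm j.ψ) with hTd
  set N := vecNon J.g (p.k1 • duForm j.ψ) + weylNon J.g (p.k0 • duForm j.ψ) with hNd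
  have e1 : ∀ m a b, L m a b + L m b a = J.dg m a b + N m a b := fun m a b => by
    have := H.unit.nonmet_eq m a b
    rw [hN] at this
    simp only [hL, this]
    simp only [fun c => gs c a]; ring
  have e2 : ∀ m n c, L m n c - L n m c = T m n c := fun m n c => by
    have := H.unit.torsion_eq H.de_eq m n c
    rw [hT] at this
    simp only [hL, this, fun d => gs c d]
  -- The Christoffel formula with nonmetricity and torsion, obtained by combining `e1` and `e2` over
  -- the permutations of the indices.
  have e3 : ∀ m a b, L m a b = 1 / 2 * (J.dg m a b + N m a b + (J.dg a m b + N a m b)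
      - (J.dg b m a + N b m a) + T m a b - T m b a - T a b m) := fun m a b => by
    linarith [e1 m a b, e1 a m b, e1 b m a, e2 m a b, e2 m b a, e2 a b m]
  have l0 : ∀ m a, L m a 0 = J.Γ m a 0 * (2 * h * j.S) + J.Γ m a 1 * h := fun m a => by
    simp [hL, Fin.sum_univ_four, H.g_eq, kMetric]
  have l1 : ∀ m a, L m a 1 = J.Γ m a 0 * h := fun m a => by
    simp [hL, Fin.sum_univ_four, H.g_eq, kMetric]
  have l2 : ∀ m a, L m a 2 = -(J.Γ m a 2 * k) := fun m a => by
    simp [hL, Fin.sum_univ_four, H.g_eq, kMetric]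
  have l3 : ∀ m a, L m a 3 = -(J.Γ m a 3 * k) := fun m a => by
    simp [hL, Fin.sum_univ_four, H.g_eq, kMetric]
  -- The index is raised by solving the block-triangular system `l0`–`l3`.
  have c0 : ∀ m a, J.Γ m a 0 = L m a 1 / h := fun m a => by rw [l1]; field_simp
  have c1 : ∀ m a, J.Γ m a 1 = L m a 0 / h - 2 * j.S * (L m a 1 / h) := fun m a => by
    rw [l0, l1]; field_simp; ring
  have c2 : ∀ m a, J.Γ m a 2 = -(L m a 2 / k) := fun m a => by rw [l2]; field_simp
  have c3 : ∀ m a, J.Γ m a 3 = -(L m a 3 / k) := fun m a => by rw [l3]; field_simp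
  funext m a b
  fin_cases b <;> [refine (c0 m a).trans ?_; refine (c1 m a).trans ?_;
    refine (c2 m a).trans ?_; refine (c3 m a).trans ?_] <;>
  simp only [e3, hTd, hNd, H.g_eq, H.dg_eq] <;>
  fin_cases m <;> fin_cases a <;>
  simp [vecTor, vecNon, weylNon, kMetric, dkMetric, duForm, conn, Params.cC, Params.cB,
    Params.cA, H.m_eq] <;>
  (try field_simp) <;> (try ring)

-- The converse of `conn_unique`, checked componentwise. It shows that a triplet connection exists
-- for every choice of wave data.
set_option maxHeartbeats 2000000 in
theorem pure_of_conn (p : Params) (hΓ : J.Γ = conn p.cA p.cB p.cC j) :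
    J.torsion = vecTor J.g (p.k2 • duForm j.ψ) ∧
    J.nonmet = vecNon J.g (p.k1 • duForm j.ψ) + weylNon J.g (p.k0 • duForm j.ψ) := by
  have hh := H.h_pos.ne'
  have hk := H.k_pos.ne'
  constructor
  · funext m n c
    rw [H.unit.torsion_eq H.de_eq, hΓ, H.g_eq]
    fin_cases m <;> fin_cases n <;> fin_cases c <;>
    simp [vecTor, kMetric, duForm, conn, Params.cC, Params.cB, Params.cA, H.m_eq,
      Fin.sum_univ_four] <;>
    (try field_simp) <;> (try ring)
  · funext m a b
    rw [H.unit.nonmet_eq, hΓ, H.g_eq, H.dg_eq]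
    fin_cases m <;> fin_cases a <;> fin_cases b <;>
    simp [vecNon, weylNon, kMetric, dkMetric, duForm, conn, Params.cC, Params.cB, Params.cA,
      H.m_eq, Fin.sum_univ_four] <;>
    (try field_simp) <;> (try ring)

end IsKundtJet

/-! ### Evaluation of the first variation on the Ansatz -/

/-- The relations between the functions of the Ansatz and their derivatives `d ν = ∂_ν j`. -/
structure KRel (lam h : ℝ) (j : KJet) (d : Fin 4 → KJet) : Prop where
  S0 : (d 0).S = j.Su
  S1 : (d 1).S = j.Sv
  S2 : (d 2).S = j.Sx
  S3 : (d 3).S = j.Sy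
  m0 : (d 0).m = j.m * j.η
  m1 : (d 1).m = 0
  m2 : (d 2).m = j.m * (j.px - j.rx)
  m3 : (d 3).m = j.m * (j.py - j.ry)
  η1 : (d 1).η = 0
  px1 : (d 1).px = 0
  py1 : (d 1).py = 0
  rx1 : (d 1).rx = 0
  ry1 : (d 1).ry = 0
  ψ1 : (d 1).ψ = 0
  rx0 : (d 0).rx = 0
  ry0 : (d 0).ry = 0
  Su1 : (d 1).Su = (d 0).Sv
  Sx1 : (d 1).Sx = (d 2).Sv
  Sy1 : (d 1).Sy = (d 3).Sv
  Sv2 : (d 2).Sv = (d 2).η / 2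
  Sv3 : (d 3).Sv = (d 3).η / 2
  px0 : (d 0).px = (d 2).η
  py0 : (d 0).py = (d 3).η
  rx3 : (d 3).rx = (d 2).ry
  px3 : (d 3).px = (d 2).py
  long : -2 * (d 1).Sv - j.m * (j.px ^ 2 + j.py ^ 2 + (d 2).px + (d 3).py) = 2 * lam * h
  trans2 : j.m * (j.px * j.rx - j.px ^ 2 - 2 * (d 2).px - j.py * j.ry - (d 2).rx - (d 3).ry)
    = 2 * lam * h
  trans3 : j.m * (j.py * j.ry - j.py ^ 2 - 2 * (d 3).py - j.px * j.rx - (d 2).rx - (d 3).ry)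
    = 2 * lam * h
  mixed : 2 * (d 2).py = j.px * j.ry + j.py * j.rx - j.px * j.py

/-- The 2-form `df ∧ du`. -/
def duTwoForm (fx fy : ℝ) : Arr2 :=
  ![![0, 0, -fx, -fy], ![0, 0, 0, 0], ![fx, 0, 0, 0], ![fy, 0, 0, 0]]

/-- The jets of the fields of the Ansatz. -/
structure IsConfigJet (p : Params) (h k : ℝ) (j : KJet) (d : Fin 4 → KJet) (fx fy : ℝ) (J : Jet) :
    Prop extends IsKundtJet h k j J where
  rel : KRel p.lam h j d
  conn_eq : J.Γ = conn p.cA p.cB p.cC j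
  dconn_eq : J.dΓ = fun ν => dconn p.cA p.cB p.cC j (d ν)
  field_eq : J.fieldRaw = duTwoForm fx fy

/-- Raising the index of `du` gives a multiple of `∂_v`, so only components with one index 1 and one
transverse index survive. A 2-form `du ∧ df` without a `dv` component therefore has zero square. -/
theorem ip2_duTwoForm {h k : ℝ} {j : KJet} {J : Jet} (H : IsKundtJet h k j J) (fx fy : ℝ)
    (X : Arr2) : J.ip2 (duTwoForm fx fy) X
      = (h * k)⁻¹ * (fx * (X 1 2 - X 2 1) + fy * (X 1 3 - X 3 1)) := by
  simp only [Jet.ip2, H.gi_eq]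
  simp [Fin.sum_univ_four, kInv, duTwoForm]
  ring

/-- The only nonzero `g^{0b}` is `g^{01} = h⁻¹`. Hence only the component 1 of each trace variation
is needed below. -/
theorem pair_duForm {h k : ℝ} {j : KJet} {J : Jet} (H : IsKundtJet h k j J) (r ψ : ℝ) (X : Arr1) :
    pair J.gi (r • duForm ψ) X = r * ψ * h⁻¹ * X 1 := by
  simp only [pair, H.gi_eq]
  simp only [Fin.sum_univ_four, kInv, duForm]
  simp
  ring_nf
  simp

theorem traceForm'_duForm {h k : ℝ} {j : KJet} {J : Jet} (H : IsKundtJet h k j J) (p : Params)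
    (r s t ψ : ℝ) (τ l q : Arr1) :
    traceForm' p J.gi (r • duForm ψ) (s • duForm ψ) (t • duForm ψ) τ l q
      = ψ * h⁻¹ * ((2 / 3 * p.a2 * r - 2 / 3 * p.c2 * s + 2 * p.c3 * t) * τ 1
        + (8 / 9 * p.b3 * s - 2 * p.b5 * t - 2 / 3 * p.c2 * r) * l 1
        + (8 * p.b4 * t - 2 * p.b5 * s + 2 * p.c3 * r) * q 1) := by
  simp only [traceForm', pair_duForm H]
  ring

/-! ### Effective trace couplings and the mass -/

/-- The coefficient of the torsion trace in the first variation. -/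
def Params.cT (p : Params) : ℝ := 2 / 3 * p.a2 * p.k2 - 2 / 3 * p.c2 * p.k1 + 2 * p.c3 * p.k0

/-- The coefficient of the second nonmetricity trace in the first variation. -/
def Params.cL (p : Params) : ℝ := 8 / 9 * p.b3 * p.k1 - 2 * p.b5 * p.k0 - 2 / 3 * p.c2 * p.k2

/-- The coefficient of the Weyl covector in the first variation. -/
def Params.cQ (p : Params) : ℝ := 8 * p.b4 * p.k0 - 2 * p.b5 * p.k1 + 2 * p.c3 * p.k2

/-- The coefficient of the mass term. -/
def Params.massCoeff (p : Params) : ℝ :=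
  p.cQ - 2 * p.cT - p.cL - 2 * p.a0 * (p.cB + p.cC)

/-- Expanded, this and `cT_eq` are two homogeneous linear equations in `(k₀, k₁, k₂)`. The
definitions of the `kᵢ` are a multiple of the cross product of the two coefficient vectors, so both
equations hold for all couplings. -/
theorem Params.cL_eq (p : Params) : p.cL = -p.a0 * (3 * p.cB + p.cC) := by
  simp only [cL, cC, cB, cA, k0, k1, k2]; ring

theorem Params.cT_eq (p : Params) : p.cT = p.a0 * (2 * p.cB - 2 * p.cC) := by
  simp only [cT, cC, cB, cA, k0, k1, k2]; ring

/-- The right side is `-2 k₀` times the bracket in `m²`, which identifies `massCoeff` with `2 z₅ κ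
k₀ m²`. -/
theorem Params.massCoeff_eq (p : Params) : p.massCoeff
    = -2 * (p.k0 * (-4 * p.b4 + 3 * p.a0 / 2) + p.k1 / 2 * (2 * p.b5 - p.a0)
      + p.k2 * (-p.c3 + p.a0)) := by
  simp only [massCoeff, cL, cT, cQ, cC, cB, cA, k0, k1, k2]; ring

theorem Params.massCoeff_eq_zero_of_mSq (p : Params) (hk : p.k0 ≠ 0) (hκ : p.κ ≠ 0)
    (hz : p.z5 ≠ 0) : p.massCoeff = 0 ↔ p.mSq = 0 := by
  have : p.mSq = p.massCoeff / (2 * p.z5 * p.κ * p.k0) := by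
    rw [massCoeff_eq, mSq]; field_simp
  rw [this, div_eq_zero_iff]
  simp [hk, hκ, hz]

namespace IsConfigJet

variable {p : Params} {h k : ℝ} {j : KJet} {d : Fin 4 → KJet} {fx fy : ℝ} {J : Jet}
  (H : IsConfigJet p h k j d fx fy J)
include H

theorem curv_eq (m n a b : Fin 4) : J.curv m n a b = J.curvRaw a b m n := by
  simp only [Jet.curv, H.unit.ofTwoForm_eq, Jet.curvRaw]

-- The trace of the commutator term of the curvature vanishes, so the traced curvature is linear in
-- the connection.
omit H in
theorem curvTr_raw (m n : Fin 4) : ∑ c, J.curvRaw c c m n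
    = (∑ c, J.dΓ m n c c) - ∑ c, J.dΓ n m c c := by
  simp only [Jet.curvRaw, Finset.sum_add_distrib, Finset.sum_sub_distrib]
  rw [Finset.sum_comm (f := fun c e => J.Γ n e c * J.Γ m c e)]
  simp only [fun c e => mul_comm (J.Γ n c e) (J.Γ m e c)]
  ring

/-- The traced curvature is the exterior derivative of the traced connection. The Levi-Civita part
of the latter is the gradient of `ln (hk)` and drops out; the triplet part is `(4A + B + C) φ = 2 k₀
φ`. -/
theorem curvTr_eq : J.curvTr = duTwoForm (2 * p.k0 * (d 2).ψ) (2 * p.k0 * (d 3).ψ) := by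
  have R := H.rel
  have : p.cB + p.cC = 2 / 9 * p.k1 := by simp only [Params.cC]; ring
  have hk : 4 * p.cA + p.cB + p.cC = 2 * p.k0 := by rw [add_assoc, this]; simp [Params.cA]; ring
  have hm : j.m ≠ 0 := by rw [H.m_eq]; exact (div_pos H.h_pos H.k_pos).ne'
  have t : ∀ ν, ∑ c, J.dΓ ν 0 c c = (d ν).η + 2 * p.k0 * (d ν).ψ := fun ν => by
    rw [← hk, H.dconn_eq]; simp [dconn, Fin.sum_univ_four]; ring
  have t1 : ∀ ν, ∑ c, J.dΓ ν 1 c c = 0 := fun ν => by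
    rw [H.dconn_eq]; simp [dconn, Fin.sum_univ_four]
  have t2 : ∀ ν, ∑ c, J.dΓ ν 2 c c = (d ν).px + (d ν).rx := fun ν => by
    rw [H.dconn_eq]; simp [dconn, Fin.sum_univ_four]; ring
  have t3 : ∀ ν, ∑ c, J.dΓ ν 3 c c = (d ν).py + (d ν).ry := fun ν => by
    rw [H.dconn_eq]; simp [dconn, Fin.sum_univ_four]; ring
  funext m n
  have : J.curvTr m n = (∑ c, J.dΓ m n c c) - ∑ c, J.dΓ n m c c := by
    simp only [Jet.curvTr, H.curv_eq, curvTr_raw]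
  rw [this]
  fin_cases m <;> fin_cases n <;>
    simp [t, t1, t2, t3, duTwoForm, R.η1, R.ψ1, R.px1, R.py1, R.rx1, R.ry1, R.rx0, R.ry0, R.px0,
      R.py0, R.rx3, R.px3]

/-- The coefficient of `-w_m^μ` in the first variation of the curvature scalar under a variation `w`
of the coframe. -/
def _root_.MAG.Jet.ricCoeff (J : Jet) (m μ : Fin 4) : ℝ :=
  (∑ a, J.gi m a * ∑ n, J.curvRaw a n μ n) + ∑ q, ∑ a, J.gi q a * J.curvRaw a m q μ

-- With the connection fixed, the coordinate curvature does not change, and only the two frame legs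
-- that convert it to frame components are varied. Each leg contributes one contraction to
-- `ricCoeff`.
omit H in
theorem scalarVar_coframe {V : Jet} (h1 : V.Γ = 0) (h2 : V.dΓ = 0) :
    J.scalarVar V = -∑ m, ∑ μ, V.e m μ * J.ricCoeff m μ := by
  have hc : ∀ a b μ ν, Jet.curvRaw' J V a b μ ν = 0 := fun a b μ ν => by
    simp [Jet.curvRaw', h1, h2]
  simp only [Jet.scalarVar, Jet.curvVar, Jet.twoVar, hc, Jet.ricCoeff, mul_add,
    Finset.sum_add_distrib, mul_sub, Finset.sum_sub_distrib]
  have e1 : ∑ m, ∑ n, ∑ a, J.gi m a * ∑ μ, V.e m μ * J.curvRaw a n μ n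
      = ∑ m, ∑ μ, V.e m μ * ∑ a, J.gi m a * ∑ n, J.curvRaw a n μ n := by
    simp only [Finset.mul_sum]
    congr! 1 with m
    calc _ = ∑ n, ∑ μ, ∑ a, J.gi m a * (V.e m μ * J.curvRaw a n μ n) := by
          congr! 1; rw [Finset.sum_comm]
      _ = ∑ μ, ∑ a, ∑ n, J.gi m a * (V.e m μ * J.curvRaw a n μ n) := by
          rw [Finset.sum_comm]; congr! 1; rw [Finset.sum_comm]
      _ = _ := by congr! 3; ring
  have e2 : ∑ m, ∑ n, ∑ a, J.gi m a * ∑ ν, V.e n ν * J.curvRaw a n m ν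
      = ∑ m, ∑ μ, V.e m μ * ∑ q, ∑ a, J.gi q a * J.curvRaw a m q μ := by
    simp only [Finset.mul_sum]
    rw [Finset.sum_comm]
    congr! 1 with n
    calc _ = ∑ m, ∑ ν, ∑ a, J.gi m a * (V.e n ν * J.curvRaw a n m ν) := by
          congr! 1; rw [Finset.sum_comm]
      _ = _ := by rw [Finset.sum_comm]; congr! 3; ring
  rw [e1, e2]; simp; ring

theorem curvRaw_eq (a b μ ν : Fin 4) : J.curvRaw a b μ ν
    = dconn p.cA p.cB p.cC j (d μ) ν a b - dconn p.cA p.cB p.cC j (d ν) μ a b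
      + ∑ c, (conn p.cA p.cB p.cC j μ c b * conn p.cA p.cB p.cC j ν a c
        - conn p.cA p.cB p.cC j ν c b * conn p.cA p.cB p.cC j μ a c) := by
  simp only [Jet.curvRaw, H.conn_eq, H.dconn_eq]

end IsConfigJet

/-! ### Ricci contractions of the triplet connection -/

/-- The wave operator `Δσ + p·∇σ` on the last coefficient of the metric. -/
def waveOp (j : KJet) (d : Fin 4 → KJet) : ℝ :=
  (d 2).Sx + (d 3).Sy + j.px * j.Sx + j.py * j.Sy

/-- The values of `h * ricCoeff`. -/
def ricValue (lam B C h : ℝ) (j : KJet) (d : Fin 4 → KJet) : Arr2 :=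
  ![![2 * lam * h, 0, 0, 0],
    ![-(2 * (B - C) * ((j.η - j.Sv) * j.ψ - (d 0).ψ) + 2 * (B ^ 2 + C ^ 2) * j.ψ ^ 2
        + 2 * j.m * waveOp j d), 2 * lam * h,
      -((B - C) * (j.ψ * j.px - 2 * (d 2).ψ)), -((B - C) * (j.ψ * j.py - 2 * (d 3).ψ))],
    ![(B - C) * j.m * j.ψ * j.px, 0, 2 * lam * h, 0],
    ![(B - C) * j.m * j.ψ * j.py, 0, 0, 2 * lam * h]]

namespace IsConfigJet

variable {p : Params} {h k : ℝ} {j : KJet} {d : Fin 4 → KJet} {fx fy : ℝ} {J : Jet}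
  (H : IsConfigJet p h k j d fx fy J)
include H

-- Both contractions in `ricCoeff` give the Ricci tensor on the Levi-Civita part, hence `2λ` on the
-- diagonal: `long`, `trans2`, `trans3`, `mixed` express that the background is Einstein up to the
-- null component `(1, 0)`, which carries the wave operator. The coefficient `A` cancels because it
-- changes the curvature only by `δ_a^b dφ`, on which the two contractions are opposite.
set_option maxHeartbeats 4000000 in
theorem mul_ricCoeff (m μ : Fin 4) :
    h * J.ricCoeff m μ = ricValue p.lam p.cB p.cC h j d m μ := by
  have R := H.rel
  have hh := H.h_pos.ne'
  have hk := H.k_pos.ne'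
  have hm : j.m ≠ 0 := by rw [H.m_eq]; exact (div_pos H.h_pos H.k_pos).ne'
  have hm' : k = h * j.m⁻¹ := by rw [H.m_eq]; field_simp
  simp only [Jet.ricCoeff, H.gi_eq, H.curvRaw_eq, ricValue]
  fin_cases m <;> fin_cases μ <;>
  simp [Fin.sum_univ_four, kInv, conn, dconn, waveOp, R.S0, R.S1, R.S2, R.S3, R.m0, R.m1, R.m2,
    R.m3, R.η1, R.px1, R.py1, R.rx1, R.ry1, R.ψ1, R.rx0, R.ry0, R.Su1, R.Sx1, R.Sy1, R.Sv2, R.Sv3,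
    R.px0, R.py0, R.rx3, R.px3] <;>
  -- Replacing `k` by `h m⁻¹` leaves `h` and `m` as the only metric factors.
  (try simp only [hm']) <;> (try field_simp) <;>
  -- The remaining alternatives after `ring1` supply the Einstein relations, on the diagonal and in
  -- the mixed transverse components.
  first
  | ring1
  | linear_combination 4 * R.long
  | linear_combination 4 * R.trans2
  | linear_combination 4 * R.trans3
  | exact Or.inr (by linear_combination (-4 * j.m) * R.mixed)

end IsConfigJet

/-! ### First variations in the separate directions -/

namespace Jet

/-- The zero variation. -/
def zero : Jet := ⟨0, 0, 0, 0, 0, 0, 0, 0⟩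

/-- Variation of the coframe. -/
def varE (w : Arr2) : Jet := { zero with e := w }

/-- Variation of the derivatives of the coframe. -/
def varDE (w : Fin 4 → Arr2) : Jet := { zero with de := w }

/-- Variation of the connection. -/
def varG (w : Arr3) : Jet := { zero with Γ := w }

/-- Variation of the derivatives of the connection. -/
def varDG (w : Fin 4 → Arr3) : Jet := { zero with dΓ := w }

/-- Variation of the potential. -/
def varA (w : Arr1) : Jet := { zero with A := w }

/-- Variation of the derivatives of the potential. -/
def varDA (w : Fin 4 → Arr1) : Jet := { zero with dA := w }

theorem ip2_zero_right (J : Jet) (X : Arr2) : J.ip2 X 0 = 0 := by simp [ip2]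

end Jet

/-- The inverse metric density `√g g^{ab}`. -/
def kDens (h S k : ℝ) : Arr2 :=
  ![![0, k, 0, 0], ![k, -(2 * (S * k)), 0, 0], ![0, 0, -h, 0], ![0, 0, 0, -h]]

/-- The first derivatives of `kDens`. -/
def dkDens (h k : ℝ) (j : KJet) (ν : Fin 4) : Arr2 :=
  let h' := ![h * j.η, 0, h * j.px, h * j.py] ν
  let k' := ![0, 0, k * j.rx, k * j.ry] ν
  let S' := ![j.Su, j.Sv, j.Sx, j.Sy] ν
  ![![0, k', 0, 0], ![k', -(2 * (S' * k + j.S * k')), 0, 0], ![0, 0, -h', 0], ![0, 0, 0, -h']]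

namespace IsConfigJet

open Jet

variable {p : Params} {h k : ℝ} {j : KJet} {d : Fin 4 → KJet} {fx fy : ℝ} {J : Jet}
  (H : IsConfigJet p h k j d fx fy J)
include H

theorem m_ne : j.m ≠ 0 := by rw [H.m_eq]; exact (div_pos H.h_pos H.k_pos).ne'

theorem k_eq : k = h * j.m⁻¹ := by
  have := H.h_pos.ne'
  have := H.k_pos.ne'
  rw [H.m_eq]; field_simp

theorem fieldStrength_eq : J.fieldStrength = duTwoForm fx fy := by
  rw [← H.field_eq]; simp only [Jet.fieldStrength, H.unit.ofTwoForm_eq]; rfl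

/-- Each of the two contractions in `ricCoeff` has the curvature scalar as its trace, while the
diagonal of `ricValue` sums to `8λh`. The triplet contributes nothing to this diagonal. -/
theorem curvScalar_eq : J.curvScalar = 4 * p.lam := by
  have h0 := H.h_pos.ne'
  have e : ∑ m, J.ricCoeff m m = 2 * J.curvScalar := by
    have e1 : ∑ m, ∑ a, J.gi m a * ∑ n, J.curvRaw a n m n = J.curvScalar := by
      simp only [Jet.curvScalar, H.curv_eq, Finset.mul_sum]
      congr! 1; rw [Finset.sum_comm]
    have e2 : ∑ m, ∑ q, ∑ a, J.gi q a * J.curvRaw a m q m = J.curvScalar := by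
      simp only [Jet.curvScalar, H.curv_eq]
      rw [Finset.sum_comm]
    simp only [Jet.ricCoeff, Finset.sum_add_distrib, e1, e2]; ring
  have e3 : h * ∑ m, J.ricCoeff m m = 8 * p.lam * h := by
    simp only [Finset.mul_sum, H.mul_ricCoeff]
    simp [ricValue, Fin.sum_univ_four]; ring
  rw [e] at e3
  apply mul_left_cancel₀ h0
  linarith

/-- All other invariants are squares of forms along the null covector `du`: the trace pairings, the
square of `dφ` and the square of `F`. -/
theorem lagScalar_eq (hT : J.torsion = vecTor J.g (p.k2 • duForm j.ψ))
    (hN : J.nonmet = vecNon J.g (p.k1 • duForm j.ψ) + weylNon J.g (p.k0 • duForm j.ψ)) :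
    lagScalar p J = -(1 / (2 * p.κ)) * (2 * p.lam - p.a0 * (4 * p.lam)) := by
  rw [lagScalar, H.metricPair.quadForm_pure p hT hN, H.curvScalar_eq, H.fieldStrength_eq,
    H.curvTr_eq, ip2_duTwoForm H.toIsKundtJet, ip2_duTwoForm H.toIsKundtJet]
  simp only [traceForm, pair_duForm H.toIsKundtJet]
  simp [duForm, duTwoForm]

theorem lagVar_eq (V : Jet) : lagVar p J V (p.k2 • duForm j.ψ) (p.k1 • duForm j.ψ)
      (p.k0 • duForm j.ψ)
    = h * k * (lagScalar p J * (∑ a, V.e a a)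
    + (-(1 / (2 * p.κ)) * (-(p.a0 * scalarVar J V)
        + j.ψ * h⁻¹ * (p.cT * trT J.gi (torVar J V) 1 + p.cL * trLam J.gi (nonVar J V) 1
          + p.cQ * trQ J.gi (nonVar J V) 1))
      - p.z5 / (8 * p.ρ) * J.ip2 J.curvTr (curvTrVar J V)
      - 1 / 2 * J.ip2 J.fieldStrength (fieldVar J V))) := by
  rw [lagVar, traceForm'_duForm H.toIsKundtJet, H.g_eq, sqrt_det_kMetric H.h_pos H.k_pos]
  rfl

theorem lagVar_varA (w : Arr1) : lagVar p J (varA w) (p.k2 • duForm j.ψ) (p.k1 • duForm j.ψ)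
    (p.k0 • duForm j.ψ) = 0 := by
  have z : fieldVar J (varA w) = 0 := by
    funext a b; simp [fieldVar, varA, Jet.zero, twoVar, fieldRaw]
  have z2 : curvTrVar J (varA w) = 0 := by
    funext a b; simp [curvTrVar, curvVar, varA, Jet.zero, twoVar, curvRaw']
  have z3 : torVar J (varA w) = 0 := by
    funext a b c; simp [torVar, varA, Jet.zero, twoVar, torRaw']
  have z4 : nonVar J (varA w) = 0 := by
    funext a b c; simp [nonVar, varA, Jet.zero, oneVar, nonRaw']
  have z5 : scalarVar J (varA w) = 0 := by
    simp [scalarVar, curvVar, varA, Jet.zero, twoVar, curvRaw']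
  rw [H.lagVar_eq, z, z2, z3, z4, z5, ip2_zero_right, ip2_zero_right]
  simp [trT, trLam, trQ, varA, Jet.zero]

theorem lagVar_varDA (ν : Fin 4) (w : Arr1) :
    lagVar p J (varDA (Pi.single ν w)) (p.k2 • duForm j.ψ) (p.k1 • duForm j.ψ)
      (p.k0 • duForm j.ψ)
    = ![0, -(fx * w 2 + fy * w 3), fx * w 1, fy * w 1] ν := by
  have h0 := H.h_pos.ne'
  have k0 := H.k_pos.ne'
  have z2 : curvTrVar J (varDA (Pi.single ν w)) = 0 := by
    funext a b; simp [curvTrVar, curvVar, varDA, Jet.zero, twoVar, curvRaw']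
  have z3 : torVar J (varDA (Pi.single ν w)) = 0 := by
    funext a b c; simp [torVar, varDA, Jet.zero, twoVar, torRaw']
  have z4 : nonVar J (varDA (Pi.single ν w)) = 0 := by
    funext a b c; simp [nonVar, varDA, Jet.zero, oneVar, nonRaw']
  have z5 : scalarVar J (varDA (Pi.single ν w)) = 0 := by
    simp [scalarVar, curvVar, varDA, Jet.zero, twoVar, curvRaw']
  rw [H.lagVar_eq, z2, z3, z4, z5, ip2_zero_right, H.fieldStrength_eq,
    ip2_duTwoForm H.toIsKundtJet]
  fin_cases ν <;>
  simp [trT, trLam, trQ, varDA, Jet.zero, fieldVar, twoVar, fieldRaw, Pi.single_apply] <;>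
  field_simp <;> ring

theorem trT_torVar_varDE (ν : Fin 4) (w : Arr2) :
    trT J.gi (torVar J (varDE (Pi.single ν w))) 1
      = w 1 ν - (if ν = 1 then ∑ b, w b b else 0) := by
  have h0 := H.h_pos.ne'
  have k0 := H.k_pos.ne'
  simp only [trT, H.gi_eq, torVar, H.g_eq, twoVar, torRaw']
  fin_cases ν <;>
  simp [Fin.sum_univ_four, kInv, kMetric, varDE, Jet.zero, twoVar, Pi.single_apply] <;>
  field_simp <;> ring

/-- The momenta of the coframe come from the torsion trace alone. Their divergence later cancels the
`cT` terms of `lagVar_varE`. -/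
theorem lagVar_varDE (ν : Fin 4) (w : Arr2) :
    lagVar p J (varDE (Pi.single ν w)) (p.k2 • duForm j.ψ) (p.k1 • duForm j.ψ)
      (p.k0 • duForm j.ψ)
    = -(p.cT / (2 * p.κ)) * (k * j.ψ) * (w 1 ν - (if ν = 1 then ∑ b, w b b else 0)) := by
  have h0 := H.h_pos.ne'
  have z : fieldVar J (varDE (Pi.single ν w)) = 0 := by
    funext a b; simp [fieldVar, varDE, Jet.zero, twoVar, fieldRaw]
  have z2 : curvTrVar J (varDE (Pi.single ν w)) = 0 := by
    funext a b; simp [curvTrVar, curvVar, varDE, Jet.zero, twoVar, curvRaw']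
  have z4 : nonVar J (varDE (Pi.single ν w)) = 0 := by
    funext a b c; simp [nonVar, varDE, Jet.zero, oneVar, nonRaw']
  have z5 : scalarVar J (varDE (Pi.single ν w)) = 0 := by
    simp [scalarVar, curvVar, varDE, Jet.zero, twoVar, curvRaw']
  rw [H.lagVar_eq, z, z2, z4, z5, ip2_zero_right, ip2_zero_right, H.trT_torVar_varDE]
  have e : (varDE (Pi.single ν w)).e = 0 := rfl
  simp only [e, trLam, trQ, Pi.zero_apply, mul_zero, Finset.sum_const_zero]
  field_simp
  ring

omit H in
theorem scalarVar_varDG (ν : Fin 4) (w : Arr3) : scalarVar J (varDG (Pi.single ν w))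
    = (∑ n, ∑ a, J.gi ν a * w n a n) - ∑ m, ∑ a, J.gi m a * w m a ν := by
  have e : ∀ m n a, curvVar J (varDG (Pi.single ν w)) m n a n
      = (if m = ν then w n a n else 0) - (if n = ν then w m a n else 0) := fun m n a => by
    simp only [curvVar, curvRaw', twoVar, varDG, Jet.zero, Pi.zero_apply, zero_mul, mul_zero,
      add_zero, sub_zero, Finset.sum_const_zero, Pi.single_apply]
    split_ifs <;> simp
  simp only [scalarVar, e, mul_sub, Finset.sum_sub_distrib]
  congr 1
  · rw [Finset.sum_eq_single ν] <;> simp +contextual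
  · congr! 1 with m
    rw [Finset.sum_eq_single ν] <;> simp +contextual

/-- The momenta of the connection are the Einstein–Hilbert part, with the density `√g g^{ab}`, and a
Maxwell-like current of the Weyl covector. -/
theorem lagVar_varDG (ν : Fin 4) (w : Arr3) :
    lagVar p J (varDG (Pi.single ν w)) (p.k2 • duForm j.ψ) (p.k1 • duForm j.ψ)
      (p.k0 • duForm j.ψ)
    = p.a0 / (2 * p.κ) * ((∑ n, ∑ a, kDens h j.S k ν a * w n a n)
        - ∑ m, ∑ a, kDens h j.S k m a * w m a ν)
      + p.z5 * p.k0 / (2 * p.ρ) * ![0, -((d 2).ψ * (∑ c, w 2 c c) + (d 3).ψ * ∑ c, w 3 c c),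
        (d 2).ψ * ∑ c, w 1 c c, (d 3).ψ * ∑ c, w 1 c c] ν := by
  have h0 := H.h_pos.ne'
  have k0 := H.k_pos.ne'
  have z : fieldVar J (varDG (Pi.single ν w)) = 0 := by
    funext a b; simp [fieldVar, varDG, Jet.zero, twoVar, fieldRaw]
  have z3 : torVar J (varDG (Pi.single ν w)) = 0 := by
    funext a b c; simp [torVar, varDG, Jet.zero, twoVar, torRaw']
  have z4 : nonVar J (varDG (Pi.single ν w)) = 0 := by
    funext a b c; simp [nonVar, varDG, Jet.zero, oneVar, nonRaw']
  have t : ∀ m n, curvTrVar J (varDG (Pi.single ν w)) m n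
      = (if m = ν then ∑ c, w n c c else 0) - (if n = ν then ∑ c, w m c c else 0) := fun m n => by
    simp only [curvTrVar, curvVar, curvRaw', twoVar, varDG, Jet.zero, Pi.zero_apply, zero_mul,
      mul_zero, add_zero, sub_zero, Finset.sum_const_zero, Pi.single_apply,
      Finset.sum_sub_distrib]
    split_ifs <;> simp
  have e : (varDG (Pi.single ν w)).e = 0 := rfl
  have g : ∀ a b, kDens h j.S k a b = h * k * J.gi a b := fun a b => by
    rw [H.gi_eq]
    fin_cases a <;> fin_cases b <;> simp [kDens, kInv] <;> field_simp
  have g1 : (∑ n, ∑ a, kDens h j.S k ν a * w n a n) - ∑ m, ∑ a, kDens h j.S k m a * w m a ν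
      = h * k * scalarVar J (varDG (Pi.single ν w)) := by
    simp only [scalarVar_varDG, g, mul_sub, Finset.mul_sum, mul_assoc]
  rw [H.lagVar_eq, z, z3, z4, ip2_zero_right, H.curvTr_eq, ip2_duTwoForm H.toIsKundtJet, g1]
  simp only [e, trLam, trQ, trT, Pi.zero_apply, mul_zero, Finset.sum_const_zero, t]
  fin_cases ν <;> simp <;> field_simp <;> ring

set_option maxHeartbeats 1000000 in
theorem trT_torVar_varE (w : Arr2) :
    trT J.gi (torVar J (varE w)) 1 = w 1 0 * ((3 * p.cA + p.cB) * j.ψ + j.η - j.Sv)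
      + w 1 2 * (j.px / 2 + j.rx) + w 1 3 * (j.py / 2 + j.ry)
      - w 2 0 * (j.m * j.px / 2) - w 3 0 * (j.m * j.py / 2) := by
  have h0 := H.h_pos.ne'
  have hm := H.m_ne
  have hr : ∀ dd m n, J.torRaw dd m n = conn p.cA p.cB p.cC j m n dd
      - conn p.cA p.cB p.cC j n m dd := fun dd m n => by
    simp [torRaw, H.de_eq, H.unit.apply, H.conn_eq, Finset.sum_sub_distrib]
  simp only [trT, H.gi_eq, torVar, H.g_eq, twoVar, torRaw', hr, H.conn_eq]
  simp [Fin.sum_univ_four, kInv, kMetric, varE, Jet.zero, twoVar, conn, H.unit.apply]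
  simp only [H.k_eq]
  field_simp
  ring

set_option maxHeartbeats 1000000 in
theorem trQ_nonVar_varE (w : Arr2)
    (hN : J.nonmet = vecNon J.g (p.k1 • duForm j.ψ) + weylNon J.g (p.k0 • duForm j.ψ)) :
    trQ J.gi (nonVar J (varE w)) 1 = -(p.k0 * j.ψ * w 1 0) := by
  have h0 := H.h_pos.ne'
  have hm := H.m_ne
  have hr : ∀ a b m, J.nonRaw a b m = J.nonmet m a b := fun a b m => by
    simp only [nonRaw, Jet.nonmet, H.unit.ofOneForm_eq]
  simp only [trQ, H.gi_eq, nonVar, oneVar, nonRaw', hr, hN, H.g_eq]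
  simp [Fin.sum_univ_four, kInv, kMetric, varE, Jet.zero, oneVar, vecNon, weylNon, duForm]
  simp only [H.k_eq]
  field_simp
  ring

set_option maxHeartbeats 1000000 in
theorem trLam_nonVar_varE (w : Arr2)
    (hN : J.nonmet = vecNon J.g (p.k1 • duForm j.ψ) + weylNon J.g (p.k0 • duForm j.ψ)) :
    trLam J.gi (nonVar J (varE w)) 1 = -(p.k1 / 9 * j.ψ * w 1 0) := by
  have h0 := H.h_pos.ne'
  have hm := H.m_ne
  have hr : ∀ a b m, J.nonRaw a b m = J.nonmet m a b := fun a b m => by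
    simp only [nonRaw, Jet.nonmet, H.unit.ofOneForm_eq]
  have e : trLam J.gi (nonVar J (varE w)) 1 = (∑ b, ∑ c, J.gi b c * nonVar J (varE w) b c 1)
    - trQ J.gi (nonVar J (varE w)) 1 := rfl
  rw [e, H.trQ_nonVar_varE w hN]
  simp only [H.gi_eq, nonVar, oneVar, nonRaw', hr, hN, H.g_eq]
  simp [Fin.sum_univ_four, kInv, kMetric, varE, Jet.zero, oneVar, vecNon, weylNon, duForm]
  field_simp
  ring

theorem mul_scalarVar_varE (w : Arr2) : h * scalarVar J (varE w)
    = -∑ m, ∑ μ, w m μ * ricValue p.lam p.cB p.cC h j d m μ := by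
  rw [scalarVar_coframe rfl rfl]
  simp only [← H.mul_ricCoeff, varE, mul_neg, Finset.mul_sum]
  congr! 3; ring

/-- A null 2-form has the stress tensor of pure radiation: only the variation `w 1 0` contributes.
This one computation serves both `F` and `dφ`. -/
theorem ip2_twoVar_duTwoForm (w : Arr2) (gx gy : ℝ) :
    J.ip2 (duTwoForm gx gy) (twoVar w (duTwoForm gx gy) 0)
      = (h * k)⁻¹ * (2 * (gx ^ 2 + gy ^ 2) * w 1 0) := by
  rw [ip2_duTwoForm H.toIsKundtJet]
  simp [twoVar, duTwoForm, Fin.sum_univ_four]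
  left; ring

-- The subtracted sum is the divergence of the Hilbert momenta. It cancels the Levi-Civita part of
-- the force, since that connection is metric and torsion-free. Among the triplet terms, `cL_eq` and
-- `cT_eq` remove every structure except the trace `∑ c, w 1 c c`.
set_option maxHeartbeats 4000000 in
theorem lagVar_varG (w : Arr3) :
    lagVar p J (varG w) (p.k2 • duForm j.ψ) (p.k1 • duForm j.ψ) (p.k0 • duForm j.ψ)
      - p.a0 / (2 * p.κ) * ∑ ν, ((∑ n, ∑ a, dkDens h k j ν ν a * w n a n)
        - ∑ m, ∑ a, dkDens h k j ν m a * w m a ν)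
    = -(p.massCoeff / (4 * p.κ)) * k * j.ψ * ∑ c, w 1 c c := by
  have h0 := H.h_pos.ne'
  have k0 := H.k_pos.ne'
  have hm := H.m_ne
  have hkm : h = k * j.m := by rw [H.m_eq]; field_simp
  have z : fieldVar J (varG w) = 0 := by
    funext a b; simp [fieldVar, varG, Jet.zero, twoVar, fieldRaw]
  -- The undifferentiated variation enters the curvature through a commutator, which is trace-free.
  have z2 : curvTrVar J (varG w) = 0 := by
    funext a b
    simp only [curvTrVar, curvVar, curvRaw', varG, Jet.zero, twoVar, Pi.zero_apply, zero_mul,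
      sub_zero, zero_add, Finset.sum_const_zero, Finset.sum_sub_distrib, Finset.sum_add_distrib]
    rw [Finset.sum_comm (f := fun c e => J.Γ a e c * w b c e),
      Finset.sum_comm (f := fun c e => J.Γ b e c * w a c e)]
    simp only [mul_comm (J.Γ _ _ _)]
    ring
  have e1 : trT J.gi (torVar J (varG w)) 1 = (∑ b, w b 1 b) - ∑ b, w 1 b b := by
    simp only [trT, H.gi_eq, torVar, H.g_eq, twoVar, torRaw']
    simp [Fin.sum_univ_four, kInv, kMetric, varG, Jet.zero, H.unit.apply]
    field_simp
    ring
  have e2 : trQ J.gi (nonVar J (varG w)) 1 = 1 / 2 * ∑ b, w 1 b b := by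
    simp only [trQ, H.gi_eq, nonVar, oneVar, nonRaw', H.g_eq]
    simp [Fin.sum_univ_four, kInv, kMetric, varG, Jet.zero]
    field_simp
    ring
  have e3 : trLam J.gi (nonVar J (varG w)) 1 = (∑ b, w b 1 b) - 1 / 2 * (∑ b, w 1 b b)
      + (w 0 1 0 + w 1 0 0 - 2 * j.S * w 1 1 0 - j.m * (w 2 2 0 + w 3 3 0)) := by
    have e : trLam J.gi (nonVar J (varG w)) 1 = (∑ b, ∑ c, J.gi b c * nonVar J (varG w) b c 1)
      - trQ J.gi (nonVar J (varG w)) 1 := rfl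
    rw [e, e2]
    simp only [H.gi_eq, nonVar, oneVar, nonRaw', H.g_eq]
    simp [Fin.sum_univ_four, kInv, kMetric, varG, Jet.zero]
    simp only [H.k_eq]
    field_simp
    ring
  have we : (varG w).e = 0 := rfl
  -- Trading `cQ` for `massCoeff` exposes the cancellation that `cL_eq` and `cT_eq` then complete.
  have hM : p.cQ = p.massCoeff + 2 * p.cT + p.cL + 2 * p.a0 * (p.cB + p.cC) := by
    simp only [Params.massCoeff]; ring
  have e4 : h * scalarVar J (varG w) = ∑ m, ∑ n, ∑ a, h * kInv h j.S k m a * ∑ c,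
      (w m c n * conn p.cA p.cB p.cC j n a c + conn p.cA p.cB p.cC j m c n * w n a c
    - (w n c n * conn p.cA p.cB p.cC j m a c + conn p.cA p.cB p.cC j n c n * w m a c)) := by
    rw [← H.gi_eq]
    simp only [scalarVar, curvVar, curvRaw', twoVar, varG, Jet.zero, Pi.zero_apply, zero_mul,
      sub_zero, zero_add, Finset.sum_const_zero, H.conn_eq, Finset.mul_sum, mul_assoc]
  have e5 : scalarVar J (varG w) = h⁻¹ * ∑ m, ∑ n, ∑ a, h * kInv h j.S k m a * ∑ c,
      (w m c n * conn p.cA p.cB p.cC j n a c + conn p.cA p.cB p.cC j m c n * w n a c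
    - (w n c n * conn p.cA p.cB p.cC j m a c + conn p.cA p.cB p.cC j n c n * w m a c)) := by
    rw [← e4]; field_simp
  rw [H.lagVar_eq, z, z2, ip2_zero_right, ip2_zero_right, e1, e2, e3, we, e5, hM, p.cL_eq,
    p.cT_eq]
  simp [Fin.sum_univ_four, kInv, conn, dkDens]
  simp only [hkm]
  field_simp
  ring

/-- The trace term combines the volume variation with the Einstein diagonal. The `w 1 0` term
collects the wave operator, the mass term and the two radiation stresses; the last bracket is the
part to be balanced by the coframe momenta. -/
theorem lagVar_varE (w : Arr2) (hT : J.torsion = vecTor J.g (p.k2 • duForm j.ψ))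
    (hN : J.nonmet = vecNon J.g (p.k1 • duForm j.ψ) + weylNon J.g (p.k0 • duForm j.ψ)) :
    lagVar p J (varE w) (p.k2 • duForm j.ψ) (p.k1 • duForm j.ψ) (p.k0 • duForm j.ψ)
    = h * k * p.lam * (p.a0 - 1) / p.κ * (∑ a, w a a)
      + (p.a0 * h / p.κ * waveOp j d + k * p.k0 * p.massCoeff / (2 * p.κ) * j.ψ ^ 2
        - (fx ^ 2 + fy ^ 2)
        - p.z5 * p.k0 ^ 2 / p.ρ * ((d 2).ψ ^ 2 + (d 3).ψ ^ 2)) * w 1 0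
      - p.cT / (2 * p.κ) * k * ((d 0).ψ * w 1 0 + ((d 2).ψ + j.rx * j.ψ) * w 1 2
        + ((d 3).ψ + j.ry * j.ψ) * w 1 3) := by
  have h0 := H.h_pos.ne'
  have k0 := H.k_pos.ne'
  have hm := H.m_ne
  have we : (varE w).e = w := rfl
  have hR : scalarVar J (varE w)
      = h⁻¹ * -∑ m, ∑ μ, w m μ * ricValue p.lam p.cB p.cC h j d m μ := by
    rw [← H.mul_scalarVar_varE]; field_simp
  have f : fieldVar J (varE w) = twoVar w (duTwoForm fx fy) 0 := by
    have : (varE w).fieldRaw = (0 : Arr2) := by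
      funext a b; simp [fieldRaw, varE, Jet.zero]
    simp only [fieldVar, H.field_eq, this]; rfl
  have c : curvTrVar J (varE w)
      = twoVar w (duTwoForm (2 * p.k0 * (d 2).ψ) (2 * p.k0 * (d 3).ψ)) 0 := by
    funext a b
    have hz : ∀ a b μ ν, curvRaw' J (varE w) a b μ ν = 0 := fun a b μ ν => by
      simp [curvRaw', varE, Jet.zero]
    rw [← H.curvTr_eq]
    simp only [curvTrVar, curvVar, twoVar, hz, curvTr, H.curv_eq, we, Finset.mul_sum,
      Finset.sum_sub_distrib, Pi.zero_apply, Finset.sum_const_zero]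
    congr 1
    · congr 1; rw [Finset.sum_comm]
    · rw [Finset.sum_comm]
  rw [H.lagVar_eq, H.lagScalar_eq hT hN, H.trT_torVar_varE w, H.trQ_nonVar_varE w hN,
    H.trLam_nonVar_varE w hN, hR, H.fieldStrength_eq, f, c, H.curvTr_eq, H.ip2_twoVar_duTwoForm,
    H.ip2_twoVar_duTwoForm, p.cT_eq]
  have hM : p.cQ = p.massCoeff + 2 * p.cT + p.cL + 2 * p.a0 * (p.cB + p.cC) := by
    simp only [Params.massCoeff]; ring
  -- With `cA` and `k1` eliminated, the identity is polynomial in `k0`, `cB`, `cC` and no quadratic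
  -- formula for the `kᵢ` has to be expanded.
  have hcA : p.cA = (2 * p.k0 - p.cB - p.cC) / 4 := by
    simp only [Params.cC, Params.cA]; ring
  have hk1 : p.k1 = 9 / 2 * (p.cB + p.cC) := by simp only [Params.cC]; ring
  rw [hM, p.cL_eq, p.cT_eq, hk1, hcA, we]
  have hkm : h = k * j.m := by rw [H.m_eq]; field_simp
  simp only [ricValue, Fin.sum_univ_four]
  simp
  generalize waveOp j d = W
  simp only [hkm]
  field_simp
  ring

end IsConfigJet

/-! ### Partial derivatives -/

/-- `f` is differentiable at `x`, with partial derivatives `f'`. -/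
def HasPD {V : Type} [NormedAddCommGroup V] [NormedSpace ℝ V] (f : Pt → V) (f' : Fin 4 → V)
    (x : Pt) : Prop :=
  DifferentiableAt ℝ f x ∧ ∀ ν, pd ν f x = f' ν

namespace HasPD

variable {f g : Pt → ℝ} {f' g' : Fin 4 → ℝ} {x : Pt}

theorem congr_pd (hf : HasPD f f' x) (h : ∀ ν, f' ν = g' ν) : HasPD f g' x :=
  ⟨hf.1, fun ν => (hf.2 ν).trans (h ν)⟩

theorem congr_fun (hf : HasPD f f' x) (h : g =ᶠ[nhds x] f) : HasPD g f' x :=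
  ⟨hf.1.congr_of_eventuallyEq h, fun ν => by
    rw [← hf.2 ν]; simp only [pd, h.fderiv_eq]⟩

theorem of_differentiableAt (hf : DifferentiableAt ℝ f x) : HasPD f (fun ν => pd ν f x) x :=
  ⟨hf, fun _ => rfl⟩

theorem const (r : ℝ) : HasPD (fun _ => r) (fun _ => 0) x :=
  ⟨differentiableAt_const r, fun ν => by simp [pd]⟩

theorem coord (i : Fin 4) : HasPD (fun y => y i) (fun ν => if ν = i then 1 else 0) x :=
  ⟨differentiableAt_apply i x, fun ν => by
    have : fderiv ℝ (fun y : Pt => y i) x = ContinuousLinearMap.proj i :=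
      (ContinuousLinearMap.proj (R := ℝ) (φ := fun _ : Fin 4 => ℝ) i).fderiv
    rw [pd, this]
    simp [Pi.single_apply, eq_comm]⟩

theorem add (hf : HasPD f f' x) (hg : HasPD g g' x) :
    HasPD (fun y => f y + g y) (fun ν => f' ν + g' ν) x :=
  ⟨hf.1.add hg.1, fun ν => by
    beta_reduce
    rw [← hf.2, ← hg.2, pd, fderiv_fun_add hf.1 hg.1]; rfl⟩

theorem neg (hf : HasPD f f' x) : HasPD (fun y => -f y) (fun ν => -f' ν) x :=
  ⟨hf.1.neg, fun ν => by
    beta_reduce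
    rw [← hf.2, pd, fderiv_fun_neg]; rfl⟩

theorem sub (hf : HasPD f f' x) (hg : HasPD g g' x) :
    HasPD (fun y => f y - g y) (fun ν => f' ν - g' ν) x :=
  ⟨hf.1.sub hg.1, fun ν => by
    beta_reduce
    rw [← hf.2, ← hg.2, pd, fderiv_fun_sub hf.1 hg.1]; rfl⟩

theorem mul (hf : HasPD f f' x) (hg : HasPD g g' x) :
    HasPD (fun y => f y * g y) (fun ν => f' ν * g x + f x * g' ν) x :=
  ⟨hf.1.mul hg.1, fun ν => by
    beta_reduce
    rw [← hf.2, ← hg.2, pd, fderiv_fun_mul hf.1 hg.1]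
    simp [pd]; ring⟩

theorem const_mul (r : ℝ) (hf : HasPD f f' x) :
    HasPD (fun y => r * f y) (fun ν => r * f' ν) x :=
  ((const r).mul hf).congr_pd fun ν => by ring

theorem mul_const (hf : HasPD f f' x) (r : ℝ) :
    HasPD (fun y => f y * r) (fun ν => f' ν * r) x :=
  (hf.mul (const r)).congr_pd fun ν => by ring

theorem div_const (hf : HasPD f f' x) (r : ℝ) :
    HasPD (fun y => f y / r) (fun ν => f' ν / r) x :=
  hf.mul_const r⁻¹

theorem inv (hf : HasPD f f' x) (h : f x ≠ 0) :
    HasPD (fun y => (f y)⁻¹) (fun ν => -f' ν * ((f x)⁻¹) ^ 2) x := by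
  have := (hasDerivAt_inv h).comp_hasFDerivAt x hf.1.hasFDerivAt
  refine ⟨this.differentiableAt, fun ν => ?_⟩
  beta_reduce
  rw [← hf.2]
  have e : fderiv ℝ (fun y => (f y)⁻¹) x = -(f x ^ 2)⁻¹ • fderiv ℝ f x := this.fderiv
  rw [pd, e]
  simp [pd]; ring

theorem div (hf : HasPD f f' x) (hg : HasPD g g' x) (h : g x ≠ 0) :
    HasPD (fun y => f y / g y) (fun ν => (f' ν * g x - f x * g' ν) / (g x) ^ 2) x := by
  simp only [div_eq_mul_inv]
  exact (hf.mul (hg.inv h)).congr_pd fun ν => by field_simp; ring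

theorem log (hf : HasPD f f' x) (h : f x ≠ 0) :
    HasPD (fun y => Real.log (f y)) (fun ν => f' ν / f x) x := by
  refine ⟨hf.1.log h, fun ν => ?_⟩
  beta_reduce
  rw [← hf.2, pd, (hf.1.hasFDerivAt.log h).fderiv]
  simp [pd]; ring

theorem sq (hf : HasPD f f' x) : HasPD (fun y => f y ^ 2) (fun ν => 2 * f x * f' ν) x := by
  simp only [pow_two]
  exact (hf.mul hf).congr_pd fun ν => by ring

theorem sum {ι : Type*} (s : Finset ι) {F : ι → Pt → ℝ} {F' : ι → Fin 4 → ℝ}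
    (h : ∀ i ∈ s, HasPD (F i) (F' i) x) :
    HasPD (fun y => ∑ i ∈ s, F i y) (fun ν => ∑ i ∈ s, F' i ν) x := by
  refine ⟨DifferentiableAt.fun_sum fun i hi => (h i hi).1, fun ν => ?_⟩
  rw [pd, fderiv_fun_sum fun i hi => (h i hi).1]
  simp only [_root_.sum_apply]
  exact Finset.sum_congr rfl fun i hi => (h i hi).2 ν

/-- The coordinate line is parametrized by the value of the coordinate itself, so that partial
derivatives can be compared directly with one-variable ones such as `∂_u ln|Q|`. -/
theorem hasDerivAt_line (hf : HasPD f f' x) (ν : Fin 4) :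
    HasDerivAt (fun t : ℝ => f (x + (t - x ν) • Pi.single ν 1)) (f' ν) (x ν) := by
  rw [← hf.2 ν]
  have hl : HasDerivAt (fun t : ℝ => x + (t - x ν) • (Pi.single ν 1 : Pt))
      ((1 : ℝ) • Pi.single ν 1) (x ν) :=
    (((hasDerivAt_id (x ν)).sub_const _).smul_const _).const_add x
  have hx : HasFDerivAt f (fderiv ℝ f x) (x + (x ν - x ν) • (Pi.single ν 1 : Pt)) := by
    simpa using hf.1.hasFDerivAt
  have h := hx.comp_hasDerivAt (x ν) hl
  rw [one_smul] at h
  exact h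

theorem pd_of_line (hf : HasPD f f' x) {ν : Fin 4} {a : ℝ}
    (h : HasDerivAt (fun t : ℝ => f (x + (t - x ν) • Pi.single ν 1)) a (x ν)) : f' ν = a :=
  (hf.hasDerivAt_line ν).unique h

theorem pd_eq_zero_of_line (hf : HasPD f f' x) {ν : Fin 4}
    (h : ∀ t : ℝ, f (x + t • Pi.single ν 1) = f x) : f' ν = 0 :=
  hf.pd_of_line (by simpa only [h] using hasDerivAt_const (x ν) (f x))

end HasPD

theorem HasPD.vec4 {V : Type} [NormedAddCommGroup V] [NormedSpace ℝ V] {f₀ f₁ f₂ f₃ : Pt → V}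
    {f₀' f₁' f₂' f₃' : Fin 4 → V} {x : Pt} (h₀ : HasPD f₀ f₀' x) (h₁ : HasPD f₁ f₁' x)
    (h₂ : HasPD f₂ f₂' x) (h₃ : HasPD f₃ f₃' x) :
    HasPD (fun y => ![f₀ y, f₁ y, f₂ y, f₃ y]) (fun ν => ![f₀' ν, f₁' ν, f₂' ν, f₃' ν]) x := by
  have h : ∀ i : Fin 4, HasFDerivAt (fun y => (![f₀ y, f₁ y, f₂ y, f₃ y] : Fin 4 → V) i)
      ((![fderiv ℝ f₀ x, fderiv ℝ f₁ x, fderiv ℝ f₂ x, fderiv ℝ f₃ x] : Fin 4 → _) i) x := by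
    intro i
    fin_cases i
    exacts [h₀.1.hasFDerivAt, h₁.1.hasFDerivAt, h₂.1.hasFDerivAt, h₃.1.hasFDerivAt]
  have := hasFDerivAt_pi.2 h
  refine ⟨this.differentiableAt, fun ν => ?_⟩
  funext i
  rw [pd, this.fderiv]
  fin_cases i
  exacts [h₀.2 ν, h₁.2 ν, h₂.2 ν, h₃.2 ν]

theorem contDiffOn_pd {f : Pt → ℝ} {U : Set Pt} (hU : IsOpen U) (hf : ContDiffOn ℝ ∞ f U)
    (ν : Fin 4) : ContDiffOn ℝ ∞ (pd ν f) U :=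
  (hf.fderiv_of_isOpen hU (by simp)).clm_apply contDiffOn_const

theorem hasPD_of_contDiffOn {f : Pt → ℝ} {U : Set Pt} (hU : IsOpen U) (hf : ContDiffOn ℝ ∞ f U)
    {x : Pt} (hx : x ∈ U) : HasPD f (fun ν => pd ν f x) x :=
  HasPD.of_differentiableAt ((hf.contDiffAt (hU.mem_nhds hx)).differentiableAt (by simp))

theorem pd_comm {f : Pt → ℝ} {U : Set Pt} (hU : IsOpen U) (hf : ContDiffOn ℝ ∞ f U)
    {x : Pt} (hx : x ∈ U) (μ ν : Fin 4) : pd μ (pd ν f) x = pd ν (pd μ f) x := by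
  have hc := hf.contDiffAt (hU.mem_nhds hx)
  have hs : IsSymmSndFDerivAt ℝ f x := hc.isSymmSndFDerivAt (by
    rw [minSmoothness_of_isRCLikeNormedField]; exact ENat.LEInfty.out)
  have hd : DifferentiableAt ℝ (fderiv ℝ f) x :=
    (hc.fderiv_right (m := 1) (by norm_num; exact ENat.LEInfty.out)).differentiableAt (by simp)
  have e : ∀ μ ν, pd μ (pd ν f) x
      = fderiv ℝ (fderiv ℝ f) x (Pi.single μ 1) (Pi.single ν 1) := fun μ ν => by
    have : HasFDerivAt (fun y => fderiv ℝ f y (Pi.single ν 1)) _ x :=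
      hd.hasFDerivAt.clm_apply (hasFDerivAt_const (Pi.single ν 1 : Pt) x)
    change fderiv ℝ (fun y => fderiv ℝ f y (Pi.single ν 1)) x (Pi.single μ 1) = _
    rw [this.fderiv]; simp
  rw [e, e]
  exact hs _ _

/-! ### Jets of smooth functions -/

/-- The functions entering the connection, from `S`, `L = ln h`, `M = ln k`, `m` and `ψ`. -/
def kjetOf (S L M m ψ : Pt → ℝ) (x : Pt) : KJet :=
  ⟨S x, pd 0 S x, pd 1 S x, pd 2 S x, pd 3 S x, pd 0 L x, pd 2 L x, pd 3 L x, pd 2 M x, pd 3 M x,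
    m x, ψ x⟩

/-- The partial derivatives of `kjetOf`. -/
def dkjetOf (S L M m ψ : Pt → ℝ) (x : Pt) (ν : Fin 4) : KJet :=
  ⟨pd ν S x, pd ν (pd 0 S) x, pd ν (pd 1 S) x, pd ν (pd 2 S) x, pd ν (pd 3 S) x, pd ν (pd 0 L) x,
    pd ν (pd 2 L) x, pd ν (pd 3 L) x, pd ν (pd 2 M) x, pd ν (pd 3 M) x, pd ν m x, pd ν ψ x⟩

section

variable {U : Set Pt} (hU : IsOpen U) {S L M m ψ : Pt → ℝ} (hS : ContDiffOn ℝ ∞ S U)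
  (hL : ContDiffOn ℝ ∞ L U) (hM : ContDiffOn ℝ ∞ M U) (hm : ContDiffOn ℝ ∞ m U)
  (hψ : ContDiffOn ℝ ∞ ψ U) {x : Pt} (hx : x ∈ U)
include hU hS hL hM hm hψ hx

theorem pd_conn_kjetOf (A B C : ℝ) (hm0 : m x ≠ 0) (ν : Fin 4) :
    pd ν (fun y => conn A B C (kjetOf S L M m ψ y)) x
      = dconn A B C (kjetOf S L M m ψ x) (dkjetOf S L M m ψ x ν) := by
  have s := hasPD_of_contDiffOn hU hS hx
  have s0 := hasPD_of_contDiffOn hU (contDiffOn_pd hU hS 0) hx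
  have s1 := hasPD_of_contDiffOn hU (contDiffOn_pd hU hS 1) hx
  have s2 := hasPD_of_contDiffOn hU (contDiffOn_pd hU hS 2) hx
  have s3 := hasPD_of_contDiffOn hU (contDiffOn_pd hU hS 3) hx
  have l0 := hasPD_of_contDiffOn hU (contDiffOn_pd hU hL 0) hx
  have l2 := hasPD_of_contDiffOn hU (contDiffOn_pd hU hL 2) hx
  have l3 := hasPD_of_contDiffOn hU (contDiffOn_pd hU hL 3) hx
  have m2 := hasPD_of_contDiffOn hU (contDiffOn_pd hU hM 2) hx
  have m3 := hasPD_of_contDiffOn hU (contDiffOn_pd hU hM 3) hx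
  have mm := hasPD_of_contDiffOn hU hm hx
  have mi := mm.inv hm0
  have p := hasPD_of_contDiffOn hU hψ hx
  have z : HasPD (fun _ => (0 : ℝ)) (fun _ => 0) x := HasPD.const 0
  have pA := p.const_mul A
  have pB := p.const_mul B
  have sx : HasPD (fun y => m y * (pd 2 S y + S y * pd 2 L y)) _ x := mm.mul (s2.add (s.mul l2))
  have sy : HasPD (fun y => m y * (pd 3 S y + S y * pd 3 L y)) _ x := mm.mul (s3.add (s.mul l3))
  have e00 := ((l0.sub s1).add pA).add pB
  -- The derivative is brought to the shape of the corresponding entry of `dconn`, so that the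
  -- assembled array agrees with `dconn` by unfolding.
  have e01 : HasPD (fun y => pd 0 S y - S y * pd 0 L y + 2 * S y * pd 1 S y + 2 * C * S y * ψ y)
      (fun ν => pd ν (pd 0 S) x - (pd ν S x * pd 0 L x + S x * pd ν (pd 0 L) x)
          + 2 * (pd ν S x * pd 1 S x + S x * pd ν (pd 1 S) x)
          + 2 * C * (pd ν S x * ψ x + S x * pd ν ψ x)) x :=
    (((s0.sub (s.mul l0)).add ((s.const_mul 2).mul s1)).add
      ((s.const_mul (2 * C)).mul p)).congr_pd fun ν => by ring
  have m2' := (mm.mul l2).div_const 2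
  have m3' := (mm.mul l3).div_const 2
  have c : HasPD (fun y => -(C * ψ y * (m y)⁻¹))
      (fun ν => -(C * (pd ν ψ x * (m x)⁻¹ - ψ x * pd ν m x * (m x)⁻¹ ^ 2))) x :=
    ((p.const_mul C).mul mi).neg.congr_pd fun ν => by ring
  have ac := (s1.add pA).add (p.const_mul C)
  have bc := (s1.add pB).add (p.const_mul C)
  have h2 := l2.div_const 2
  have h3 := l3.div_const 2
  have r2 := m2.div_const 2
  have r3 := m3.div_const 2
  have zz := z.vec4 z z z
  have w0 := (e00.vec4 e01 sx sy).vec4 (z.vec4 ac m2' m3') (h2.vec4 s2 pA z) (h3.vec4 s3 z pA)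
  have w1 := (z.vec4 bc m2' m3').vec4 zz (z.vec4 h2 z z) (z.vec4 h3 z z)
  have w2 := (h2.vec4 s2 pB z).vec4 (z.vec4 h2 z z) (z.vec4 c r2 r3.neg) (z.vec4 z r3 r2)
  have w3 := (h3.vec4 s3 z pB).vec4 (z.vec4 h3 z z) (z.vec4 z r3 r2) (z.vec4 c r2.neg r3)
  exact (w0.vec4 w1 w2 w3).2 ν

omit hL hM hm hψ in
theorem pd_kMetric_kjetOf {h k : Pt → ℝ}
    (hh : HasPD h (fun ν => h x * pd ν L x) x) (hk : HasPD k (fun ν => k x * pd ν M x) x)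
    (hL1 : pd 1 L x = 0) (hM0 : pd 0 M x = 0) (hM1 : pd 1 M x = 0) :
    (fun ν => pd ν (fun y => kMetric (h y) (S y) (k y)) x)
      = dkMetric (h x) (k x) (kjetOf S L M m ψ x) := by
  have s := hasPD_of_contDiffOn hU hS hx
  have z : HasPD (fun _ => (0 : ℝ)) (fun _ => 0) x := HasPD.const 0
  have e := (hh.const_mul 2).mul s
  have w := ((e.vec4 hh z z).vec4 (hh.vec4 z z z) (z.vec4 z hk.neg z) (z.vec4 z z hk.neg)).2
  funext ν
  refine (w ν).trans ?_
  funext a b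
  fin_cases ν <;> fin_cases a <;> fin_cases b <;>
  simp [dkMetric, kjetOf, hL1, hM0, hM1] <;> ring

end

theorem pd_congr {f g : Pt → ℝ} {U : Set Pt} (hU : IsOpen U) (h : ∀ y ∈ U, f y = g y) {x : Pt}
    (hx : x ∈ U) (ν : Fin 4) : pd ν f x = pd ν g x := by
  have : f =ᶠ[nhds x] g := Filter.eventually_of_mem (hU.mem_nhds hx) h
  simp only [pd, this.fderiv_eq]

/-! ### The functions of the Ansatz on `ℝ⁴` -/

namespace WaveData

variable (c : ℝ) (D : WaveData)

/-- `P` as a function on `ℝ⁴`. -/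
def Pf (y : Pt) : ℝ := P c (zeta y)

/-- `Q` as a function on `ℝ⁴`. -/
def Qf (y : Pt) : ℝ := D.Q c (y 0) (zeta y)

/-- `S` as a function on `ℝ⁴`. -/
def Sf (y : Pt) : ℝ := D.S c (y 0) (y 1) (zeta y)

/-- The coefficient of `-v²` in `S`. -/
def quad (y : Pt) : ℝ := c / 6 * D.α (y 0) ^ 2 + Complex.normSq (D.β (y 0))

/-- The part of `S` that does not depend on `v`. -/
def sigma (y : Pt) : ℝ := Pf c y / (2 * D.Qf c y) * D.H (y 0) (zeta y)

/-- `ln |P|`. -/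
def lnP (y : Pt) : ℝ := Real.log (Pf c y)

/-- `ln |Q|`. -/
def lnQ (y : Pt) : ℝ := Real.log (D.Qf c y)

/-- `ln (Q/P)²`. -/
def lnH (y : Pt) : ℝ := 2 * (D.lnQ c y - lnP c y)

/-- `ln (1/P²)`. -/
def lnK (y : Pt) : ℝ := -(2 * lnP c y)

/-- The coefficient of the 1-form `(K + K*) du`. -/
def amp (K : ℝ → ℂ → ℂ) (y : Pt) : ℝ := 2 * (K (y 0) (zeta y)).re

/-- The data of the connection. -/
def kjet : Pt → KJet :=
  kjetOf (D.Sf c) (D.lnH c) (lnK c) (fun y => D.Qf c y ^ 2 / 2) (amp D.G)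

/-- The derivatives of the data of the connection. -/
def dkjet : Pt → Fin 4 → KJet :=
  dkjetOf (D.Sf c) (D.lnH c) (lnK c) (fun y => D.Qf c y ^ 2 / 2) (amp D.G)

theorem Pf_eq (y : Pt) : Pf c y = 1 + c / 6 * (y 2 * y 2 + y 3 * y 3) := by
  simp [Pf, P, zeta, Complex.normSq_apply]

theorem Qf_eq (y : Pt) : D.Qf c y = (1 - c / 6 * (y 2 * y 2 + y 3 * y 3)) * D.α (y 0)
    + 2 * (y 2 * (D.β (y 0)).re + y 3 * (D.β (y 0)).im) := by
  simp [Qf, Q, zeta, Complex.normSq_apply]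

theorem hasPD_Pf (x : Pt) : HasPD (Pf c) ![0, 0, c / 3 * x 2, c / 3 * x 3] x := by
  have h2 := HasPD.coord (x := x) 2
  have h3 := HasPD.coord (x := x) 3
  have := (HasPD.const (x := x) 1).add (((h2.mul h2).add (h3.mul h3)).const_mul (c / 6))
  rw [show Pf c = fun y => 1 + c / 6 * (y 2 * y 2 + y 3 * y 3) from funext (Pf_eq c)]
  refine this.congr_pd fun ν => ?_
  fin_cases ν <;> simp <;> ring

theorem contDiff_Pf : ContDiff ℝ ∞ (Pf c) := by
  rw [show Pf c = fun y => 1 + c / 6 * (y 2 * y 2 + y 3 * y 3) from funext (Pf_eq c)]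
  fun_prop

namespace IsRegular

variable {c D} {U : Set Pt} (R : D.IsRegular c U)
include R

theorem contDiffOn_re_β : ContDiffOn ℝ ∞ (fun y : Pt => (D.β (y 0)).re) U :=
  Complex.reCLM.contDiff.comp_contDiffOn R.β_smooth

theorem contDiffOn_im_β : ContDiffOn ℝ ∞ (fun y : Pt => (D.β (y 0)).im) U :=
  Complex.imCLM.contDiff.comp_contDiffOn R.β_smooth

theorem contDiffOn_Qf : ContDiffOn ℝ ∞ (D.Qf c) U := by
  rw [show D.Qf c = _ from funext (D.Qf_eq c)]
  have h1 := R.contDiffOn_re_β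
  have h2 := R.contDiffOn_im_β
  have h3 := R.α_smooth
  fun_prop

theorem contDiffOn_quad : ContDiffOn ℝ ∞ (D.quad c) U := by
  have h1 := R.contDiffOn_re_β
  have h2 := R.contDiffOn_im_β
  have h3 := R.α_smooth
  rw [show D.quad c = fun y => c / 6 * D.α (y 0) ^ 2 + ((D.β (y 0)).re * (D.β (y 0)).re
    + (D.β (y 0)).im * (D.β (y 0)).im) from funext fun y => by simp [quad, Complex.normSq_apply]]
  fun_prop

theorem contDiffOn_sigma : ContDiffOn ℝ ∞ (D.sigma c) U := by
  have h1 := (contDiff_Pf c).contDiffOn (s := U)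
  have h2 := R.contDiffOn_Qf
  exact (h1.div (contDiffOn_const.mul h2) fun y hy => mul_ne_zero two_ne_zero (R.Q_ne y hy)).mul
    R.H_smooth

theorem contDiffOn_lnP : ContDiffOn ℝ ∞ (lnP c) U :=
  (contDiff_Pf c).contDiffOn.log R.P_ne

theorem contDiffOn_lnQ : ContDiffOn ℝ ∞ (D.lnQ c) U := R.contDiffOn_Qf.log R.Q_ne

theorem contDiffOn_lnH : ContDiffOn ℝ ∞ (D.lnH c) U :=
  contDiffOn_const.mul (R.contDiffOn_lnQ.sub R.contDiffOn_lnP)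

theorem contDiffOn_lnK : ContDiffOn ℝ ∞ (lnK c) U :=
  (contDiffOn_const.mul R.contDiffOn_lnP).neg

theorem contDiffOn_m : ContDiffOn ℝ ∞ (fun y => D.Qf c y ^ 2 / 2) U :=
  (R.contDiffOn_Qf.pow 2).div_const 2

theorem contDiffOn_ampG : ContDiffOn ℝ ∞ (amp D.G) U :=
  contDiffOn_const.mul (Complex.reCLM.contDiff.comp_contDiffOn R.G_smooth)

theorem contDiffOn_ampF : ContDiffOn ℝ ∞ (amp D.F) U :=
  contDiffOn_const.mul (Complex.reCLM.contDiff.comp_contDiffOn R.F_smooth)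

end IsRegular

theorem line_zero (x : Pt) {ν : Fin 4} (h : ν ≠ 0) (t : ℝ) :
    (x + t • (Pi.single ν 1 : Pt)) 0 = x 0 := by simp [Pi.single_apply, h.symm]

theorem zeta_line_zero (x : Pt) (t : ℝ) : zeta (x + t • (Pi.single 0 1 : Pt)) = zeta x := by
  simp [zeta, Pi.single_apply]

theorem zeta_line_one (x : Pt) (t : ℝ) : zeta (x + t • (Pi.single 1 1 : Pt)) = zeta x := by
  simp [zeta, Pi.single_apply]

theorem zeta_line_two (x : Pt) (t : ℝ) : zeta (x + t • (Pi.single 2 1 : Pt)) = zeta x + t := by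
  simp [zeta, Pi.single_apply, Complex.ext_iff]

theorem zeta_line_three (x : Pt) (t : ℝ) :
    zeta (x + t • (Pi.single 3 1 : Pt)) = zeta x + t * Complex.I := by
  simp [zeta, Pi.single_apply, Complex.ext_iff]

namespace IsRegular

variable {c D} {U : Set Pt} (R : D.IsRegular c U) {x : Pt} (hx : x ∈ U)
include R hx

theorem pd_u {φ : ℝ → ℝ} (h : ContDiffOn ℝ ∞ (fun y : Pt => φ (y 0)) U) {ν : Fin 4} (hν : ν ≠ 0) :
    pd ν (fun y : Pt => φ (y 0)) x = 0 :=
  (hasPD_of_contDiffOn R.isOpen h hx).pd_eq_zero_of_line fun t => by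
    simp only [line_zero x hν]

theorem pd_one {φ : ℝ → ℂ → ℝ} (h : ContDiffOn ℝ ∞ (fun y : Pt => φ (y 0) (zeta y)) U) :
    pd 1 (fun y : Pt => φ (y 0) (zeta y)) x = 0 :=
  (hasPD_of_contDiffOn R.isOpen h hx).pd_eq_zero_of_line fun t => by
    simp only [line_zero x (by decide : (1 : Fin 4) ≠ 0), zeta_line_one]

theorem pd_Qf_two : pd 2 (D.Qf c) x = -(c / 3 * x 2 * D.α (x 0)) + 2 * (D.β (x 0)).re := by
  rw [show D.Qf c = _ from funext (D.Qf_eq c), (((((HasPD.const (x := x) 1).sub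
    ((((HasPD.coord 2).mul (HasPD.coord 2)).add ((HasPD.coord 3).mul (HasPD.coord 3))).const_mul
    (c / 6))).mul (hasPD_of_contDiffOn R.isOpen R.α_smooth hx)).add
    ((((HasPD.coord 2).mul (hasPD_of_contDiffOn R.isOpen R.contDiffOn_re_β hx)).add
    ((HasPD.coord 3).mul (hasPD_of_contDiffOn R.isOpen R.contDiffOn_im_β hx))).const_mul 2)).2 2)]
  have a := R.pd_u hx R.α_smooth (ν := 2) (by decide)
  have b := R.pd_u hx (φ := fun u => (D.β u).re) R.contDiffOn_re_β (ν := 2) (by decide)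
  have b' := R.pd_u hx (φ := fun u => (D.β u).im) R.contDiffOn_im_β (ν := 2) (by decide)
  simp only [a, b, b']
  simp only [Fin.isValue, Fin.reduceEq, if_true, if_false]; ring

theorem pd_Qf_three : pd 3 (D.Qf c) x = -(c / 3 * x 3 * D.α (x 0)) + 2 * (D.β (x 0)).im := by
  rw [show D.Qf c = _ from funext (D.Qf_eq c), (((((HasPD.const (x := x) 1).sub
    ((((HasPD.coord 2).mul (HasPD.coord 2)).add ((HasPD.coord 3).mul (HasPD.coord 3))).const_mul
    (c / 6))).mul (hasPD_of_contDiffOn R.isOpen R.α_smooth hx)).add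
    ((((HasPD.coord 2).mul (hasPD_of_contDiffOn R.isOpen R.contDiffOn_re_β hx)).add
    ((HasPD.coord 3).mul (hasPD_of_contDiffOn R.isOpen R.contDiffOn_im_β hx))).const_mul 2)).2 3)]
  have a := R.pd_u hx R.α_smooth (ν := 3) (by decide)
  have b := R.pd_u hx (φ := fun u => (D.β u).re) R.contDiffOn_re_β (ν := 3) (by decide)
  have b' := R.pd_u hx (φ := fun u => (D.β u).im) R.contDiffOn_im_β (ν := 3) (by decide)
  simp only [a, b, b']
  simp only [Fin.isValue, Fin.reduceEq, if_true, if_false]; ring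

theorem pd_Qf_one : pd 1 (D.Qf c) x = 0 := R.pd_one hx (φ := D.Q c) R.contDiffOn_Qf

theorem pd_pd_Qf : pd 2 (pd 2 (D.Qf c)) x = -(c / 3 * D.α (x 0)) ∧
    pd 3 (pd 3 (D.Qf c)) x = -(c / 3 * D.α (x 0)) ∧ pd 2 (pd 3 (D.Qf c)) x = 0 := by
  have h2 := HasPD.coord (x := x) 2
  have h3 := HasPD.coord (x := x) 3
  have a := hasPD_of_contDiffOn R.isOpen R.α_smooth hx
  have b := hasPD_of_contDiffOn R.isOpen R.contDiffOn_re_β hx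
  have b' := hasPD_of_contDiffOn R.isOpen R.contDiffOn_im_β hx
  have e2 := (((h2.const_mul (c / 3)).mul a).neg).add (b.const_mul 2)
  have e3 := (((h3.const_mul (c / 3)).mul a).neg).add (b'.const_mul 2)
  have a0 : ∀ ν : Fin 4, ν ≠ 0 → pd ν (fun y : Pt => D.α (y 0)) x = 0 := fun ν =>
    R.pd_u hx R.α_smooth
  have b0 : ∀ ν : Fin 4, ν ≠ 0 → pd ν (fun y : Pt => (D.β (y 0)).re) x = 0 := fun ν =>
    R.pd_u hx (φ := fun u => (D.β u).re) R.contDiffOn_re_β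
  have b0' : ∀ ν : Fin 4, ν ≠ 0 → pd ν (fun y : Pt => (D.β (y 0)).im) x = 0 := fun ν =>
    R.pd_u hx (φ := fun u => (D.β u).im) R.contDiffOn_im_β
  refine ⟨?_, ?_, ?_⟩
  · rw [pd_congr R.isOpen (fun y hy => R.pd_Qf_two hy) hx, e2.2]
    simp [a0, b0]
  · rw [pd_congr R.isOpen (fun y hy => R.pd_Qf_three hy) hx, e3.2]
    simp [a0, b0']
  · rw [pd_congr R.isOpen (fun y hy => R.pd_Qf_three hy) hx, e3.2]
    simp [a0, b0']

end IsRegular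

end WaveData

/-! ### Differential identities for `ln P` and `ln Q` -/

namespace WaveData

namespace IsRegular

variable {c : ℝ} {D : WaveData} {U : Set Pt} (R : D.IsRegular c U)

include R in
theorem hasPD_Qf {x : Pt} (hx : x ∈ U) : HasPD (D.Qf c) (fun ν => pd ν (D.Qf c) x) x :=
  hasPD_of_contDiffOn R.isOpen R.contDiffOn_Qf hx

include R in
theorem hasPD_lnP {x : Pt} (hx : x ∈ U) : HasPD (lnP c) (fun ν => pd ν (lnP c) x) x :=
  hasPD_of_contDiffOn R.isOpen R.contDiffOn_lnP hx

include R in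
theorem hasPD_lnQ {x : Pt} (hx : x ∈ U) : HasPD (D.lnQ c) (fun ν => pd ν (D.lnQ c) x) x :=
  hasPD_of_contDiffOn R.isOpen R.contDiffOn_lnQ hx

variable {x : Pt} (hx : x ∈ U)
include R hx

theorem pd_lnP (ν : Fin 4) :
    pd ν (lnP c) x = (![0, 0, c / 3 * x 2, c / 3 * x 3] : Fin 4 → ℝ) ν / Pf c x :=
  ((hasPD_Pf c x).log (R.P_ne x hx)).2 ν

theorem pd_lnQ (ν : Fin 4) : pd ν (D.lnQ c) x = pd ν (D.Qf c) x / D.Qf c x :=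
  ((R.hasPD_Qf hx).log (R.Q_ne x hx)).2 ν

theorem pd_lnQ_one : pd 1 (D.lnQ c) x = 0 := by rw [R.pd_lnQ hx, R.pd_Qf_one hx, zero_div]

theorem pd_pd_lnP : pd 2 (pd 2 (lnP c)) x = c / 3 / Pf c x - pd 2 (lnP c) x ^ 2 ∧
    pd 3 (pd 3 (lnP c)) x = c / 3 / Pf c x - pd 3 (lnP c) x ^ 2 ∧
    pd 2 (pd 3 (lnP c)) x = -(pd 2 (lnP c) x * pd 3 (lnP c) x) := by
  have hP : Pf c x ≠ 0 := R.P_ne x hx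
  have e2 := ((HasPD.coord (x := x) 2).const_mul (c / 3)).div (hasPD_Pf c x) hP
  have e3 := ((HasPD.coord (x := x) 3).const_mul (c / 3)).div (hasPD_Pf c x) hP
  rw [pd_congr R.isOpen (fun y hy => R.pd_lnP hy 2) hx,
    pd_congr R.isOpen (fun y hy => R.pd_lnP hy 3) hx,
    pd_congr R.isOpen (fun y hy => R.pd_lnP hy 3) hx, R.pd_lnP hx, R.pd_lnP hx]
  refine ⟨(e2.2 2).trans ?_, (e3.2 3).trans ?_, (e3.2 2).trans ?_⟩ <;>
  simp only [Fin.isValue, Fin.reduceEq, if_true, if_false, Matrix.cons_val] <;>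
  field_simp <;> ring

theorem pd_pd_lnQ : pd 2 (pd 2 (D.lnQ c)) x = -(c / 3 * D.α (x 0)) / D.Qf c x
        - pd 2 (D.lnQ c) x ^ 2 ∧
    pd 3 (pd 3 (D.lnQ c)) x = -(c / 3 * D.α (x 0)) / D.Qf c x - pd 3 (D.lnQ c) x ^ 2 ∧
    pd 2 (pd 3 (D.lnQ c)) x = -(pd 2 (D.lnQ c) x * pd 3 (D.lnQ c) x) := by
  have hQ : D.Qf c x ≠ 0 := R.Q_ne x hx
  have e2 := (hasPD_of_contDiffOn R.isOpen (contDiffOn_pd R.isOpen R.contDiffOn_Qf 2) hx).div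
    (R.hasPD_Qf hx) hQ
  have e3 := (hasPD_of_contDiffOn R.isOpen (contDiffOn_pd R.isOpen R.contDiffOn_Qf 3) hx).div
    (R.hasPD_Qf hx) hQ
  rw [pd_congr R.isOpen (fun y hy => R.pd_lnQ hy 2) hx,
    pd_congr R.isOpen (fun y hy => R.pd_lnQ hy 3) hx,
    pd_congr R.isOpen (fun y hy => R.pd_lnQ hy 3) hx, R.pd_lnQ hx, R.pd_lnQ hx]
  refine ⟨(e2.2 2).trans ?_, (e3.2 3).trans ?_, (e3.2 2).trans ?_⟩ <;>
  simp only [(R.pd_pd_Qf hx).1, (R.pd_pd_Qf hx).2.1, (R.pd_pd_Qf hx).2.2] <;>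
  field_simp <;> ring

/-- This is `|∇P|² = (2c/3)(P - 1)`, because `∇P = (c/3) (x², x³)` and `P - 1` is the square of the
radius times `c/6`. -/
theorem grad_lnP_sq : pd 2 (lnP c) x ^ 2 + pd 3 (lnP c) x ^ 2
    = 2 * c / 3 * (1 / Pf c x - 1 / Pf c x ^ 2) := by
  have hP : Pf c x ≠ 0 := R.P_ne x hx
  simp only [R.pd_lnP hx, Matrix.cons_val]
  field_simp
  rw [Pf_eq]; ring

/-- Equivalent to `∇P·∇Q = (c/3)(Q - αP)`, which follows by applying the radial derivative to the
quadratic polynomial `Q`. -/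
theorem grad_lnP_lnQ : pd 2 (lnP c) x * pd 2 (D.lnQ c) x + pd 3 (lnP c) x * pd 3 (D.lnQ c) x
    = c / 3 * (1 / Pf c x - D.α (x 0) / D.Qf c x) := by
  have hP : Pf c x ≠ 0 := R.P_ne x hx
  have hQ : D.Qf c x ≠ 0 := R.Q_ne x hx
  simp only [R.pd_lnP hx, R.pd_lnQ hx, R.pd_Qf_two hx, R.pd_Qf_three hx, Matrix.cons_val]
  field_simp
  rw [Pf_eq, Qf_eq]; ring

/-- This relation `|∇Q|² = 4 quad - (2c/3) α Q` dictates the coefficient of `v²` in `S`: it is what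
makes the relation `long` true. -/
theorem grad_lnQ_sq : pd 2 (D.lnQ c) x ^ 2 + pd 3 (D.lnQ c) x ^ 2
    = 4 * D.quad c x / D.Qf c x ^ 2 - 2 * c / 3 * D.α (x 0) / D.Qf c x := by
  have hQ : D.Qf c x ≠ 0 := R.Q_ne x hx
  simp only [R.pd_lnQ hx, R.pd_Qf_two hx, R.pd_Qf_three hx, quad, Complex.normSq_apply]
  field_simp
  rw [Qf_eq]; ring

/-- The logarithm of a negative number is that of its absolute value, so `lnQ` covers both signs of
`Q`. -/
theorem Sf_eq : D.Sf c x = -x 1 ^ 2 * D.quad c x + x 1 * pd 0 (D.lnQ c) x + D.sigma c x := by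
  have e : deriv (fun s => Real.log |D.Q c s (zeta x)|) (x 0) = pd 0 (D.lnQ c) x := by
    refine HasDerivAt.deriv ?_
    have h := (R.hasPD_lnQ hx).hasDerivAt_line 0
    refine h.congr_of_eventuallyEq (Filter.Eventually.of_forall fun t => ?_)
    simp [lnQ, Qf, zeta_line_zero, Real.log_abs]
  simp only [Sf, S, e]; rfl

/-- The first two terms add up to `ΔQ/Q`, whose dependence on `α` cancels against the cross term.
Since the right side does not involve `u`, the identity can be differentiated in `u`. -/
theorem laplace_lnQ : pd 2 (pd 2 (D.lnQ c)) x + pd 3 (pd 3 (D.lnQ c)) x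
    + (pd 2 (D.lnQ c) x ^ 2 + pd 3 (D.lnQ c) x ^ 2)
    - 2 * (pd 2 (lnP c) x * pd 2 (D.lnQ c) x + pd 3 (lnP c) x * pd 3 (D.lnQ c) x)
    = -(2 * c / 3) * (Pf c x)⁻¹ := by
  have hP : Pf c x ≠ 0 := R.P_ne x hx
  have hQ : D.Qf c x ≠ 0 := R.Q_ne x hx
  rw [(R.pd_pd_lnQ hx).1, (R.pd_pd_lnQ hx).2.1, R.grad_lnP_lnQ hx]
  field_simp; ring

/-- The term `v ∂_u ln|Q|` of `S` lies in the kernel of the wave operator `Δ + ∇ln h · ∇`. The proof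
takes the `u`-derivative of `laplace_lnQ`, in which `P` is constant. -/
theorem laplace_pd_lnQ : pd 2 (pd 2 (pd 0 (D.lnQ c))) x + pd 3 (pd 3 (pd 0 (D.lnQ c))) x
    + pd 2 (D.lnH c) x * pd 2 (pd 0 (D.lnQ c)) x + pd 3 (D.lnH c) x * pd 3 (pd 0 (D.lnQ c)) x
    = 0 := by
  have hU := R.isOpen
  have cQ := R.contDiffOn_lnQ
  have cP := R.contDiffOn_lnP
  have q2 := hasPD_of_contDiffOn hU (contDiffOn_pd hU cQ 2) hx
  have q3 := hasPD_of_contDiffOn hU (contDiffOn_pd hU cQ 3) hx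
  have p2 := hasPD_of_contDiffOn hU (contDiffOn_pd hU cP 2) hx
  have p3 := hasPD_of_contDiffOn hU (contDiffOn_pd hU cP 3) hx
  have q22 := hasPD_of_contDiffOn hU (contDiffOn_pd hU (contDiffOn_pd hU cQ 2) 2) hx
  have q33 := hasPD_of_contDiffOn hU (contDiffOn_pd hU (contDiffOn_pd hU cQ 3) 3) hx
  -- Both sides of `laplace_lnQ`, valid on all of the open set, are differentiated in `u`.
  have key := ((((q22.add q33).add (q2.sq.add q3.sq)).sub
    (((p2.mul q2).add (p3.mul q3)).const_mul 2)).2 0).symm.trans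
    ((pd_congr hU (fun y hy => R.laplace_lnQ hy) hx 0).trans
      ((((hasPD_Pf c x).inv (R.P_ne x hx)).const_mul _).2 0))
  have z : ∀ ν, pd 0 (pd ν (lnP c)) x = 0 := fun ν => by
    rw [pd_comm hU cP hx, pd_congr hU (g := fun _ => 0) (fun y hy => by simp [R.pd_lnP hy]) hx]
    exact (HasPD.const 0).2 ν
  have hL : ∀ ν, pd ν (D.lnH c) x = 2 * (pd ν (D.lnQ c) x - pd ν (lnP c) x) :=
    (((R.hasPD_lnQ hx).sub (R.hasPD_lnP hx)).const_mul 2).2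
  have e : ∀ ν, pd 0 (pd ν (pd ν (D.lnQ c))) x = pd ν (pd ν (pd 0 (D.lnQ c))) x := fun ν => by
    rw [pd_comm hU (contDiffOn_pd hU cQ ν) hx,
      pd_congr hU (fun y hy => pd_comm hU cQ hy 0 ν) hx]
  simp only [z, e, pd_comm hU cQ hx 0] at key
  rw [hL, hL]
  simp at key
  linear_combination key

end IsRegular

end WaveData

/-! ### Derivatives of the metric functions and the background relations -/

namespace WaveData

variable (c : ℝ) (D : WaveData)

/-- `(Q/P)²`, the coefficient of `2 du dv`. -/
def hf (y : Pt) : ℝ := (D.Qf c y / Pf c y) ^ 2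

/-- `2/P²`, the conformal factor of the transverse metric. -/
def kf (y : Pt) : ℝ := 2 / Pf c y ^ 2

namespace IsRegular

variable {c : ℝ} {D : WaveData} {U : Set Pt} (R : D.IsRegular c U)

include R in
theorem contDiffOn_Sf : ContDiffOn ℝ ∞ (D.Sf c) U := by
  have h1 := R.contDiffOn_quad
  have h2 := contDiffOn_pd R.isOpen R.contDiffOn_lnQ 0
  have h3 := R.contDiffOn_sigma
  refine ContDiffOn.congr (f := fun x => -x 1 ^ 2 * D.quad c x + x 1 * pd 0 (D.lnQ c) x
    + D.sigma c x) ?_ fun x hx => R.Sf_eq hx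
  fun_prop

variable {x : Pt} (hx : x ∈ U)
include R hx

theorem pd_lnH (ν : Fin 4) : pd ν (D.lnH c) x = 2 * (pd ν (D.lnQ c) x - pd ν (lnP c) x) :=
  (((R.hasPD_lnQ hx).sub (R.hasPD_lnP hx)).const_mul 2).2 ν

theorem pd_lnK (ν : Fin 4) : pd ν (lnK c) x = -(2 * pd ν (lnP c) x) :=
  (((R.hasPD_lnP hx).const_mul 2).neg).2 ν

theorem pd_pd_lnH (μ ν : Fin 4) : pd μ (pd ν (D.lnH c)) x
    = 2 * (pd μ (pd ν (D.lnQ c)) x - pd μ (pd ν (lnP c)) x) := by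
  rw [pd_congr R.isOpen (fun y hy => R.pd_lnH hy ν) hx]
  exact (((hasPD_of_contDiffOn R.isOpen (contDiffOn_pd R.isOpen R.contDiffOn_lnQ ν) hx).sub
    (hasPD_of_contDiffOn R.isOpen (contDiffOn_pd R.isOpen R.contDiffOn_lnP ν) hx)).const_mul 2).2 μ

theorem pd_pd_lnK (μ ν : Fin 4) : pd μ (pd ν (lnK c)) x = -(2 * pd μ (pd ν (lnP c)) x) := by
  rw [pd_congr R.isOpen (fun y hy => R.pd_lnK hy ν) hx]
  exact ((hasPD_of_contDiffOn R.isOpen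
    (contDiffOn_pd R.isOpen R.contDiffOn_lnP ν) hx).const_mul 2).neg.2 μ

theorem pd_lnP_zero : pd 0 (lnP c) x = 0 := by simp [R.pd_lnP hx]

theorem pd_lnP_one : pd 1 (lnP c) x = 0 := by simp [R.pd_lnP hx]

theorem pd_pd_eq_zero {f : Pt → ℝ} (hf : ContDiffOn ℝ ∞ f U) {μ : Fin 4}
    (h : ∀ y ∈ U, pd μ f y = 0) (ν : Fin 4) : pd μ (pd ν f) x = 0 := by
  rw [pd_comm R.isOpen hf hx, pd_congr R.isOpen (g := fun _ => 0) h hx]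
  exact (HasPD.const 0).2 ν

theorem pd_quad {ν : Fin 4} (hν : ν ≠ 0) : pd ν (D.quad c) x = 0 :=
  R.pd_u hx (φ := fun u => c / 6 * D.α u ^ 2 + Complex.normSq (D.β u)) R.contDiffOn_quad hν

theorem pd_sigma_one : pd 1 (D.sigma c) x = 0 :=
  R.pd_one hx (φ := fun u z => P c z / (2 * D.Q c u z) * D.H u z) R.contDiffOn_sigma

theorem pd_Sf (ν : Fin 4) : pd ν (D.Sf c) x = -(2 * x 1 * (if ν = 1 then 1 else 0)) * D.quad c x
    + -x 1 ^ 2 * pd ν (D.quad c) x + ((if ν = 1 then 1 else 0) * pd 0 (D.lnQ c) x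
    + x 1 * pd ν (pd 0 (D.lnQ c)) x) + pd ν (D.sigma c) x := by
  have hU := R.isOpen
  rw [pd_congr hU (fun y hy => R.Sf_eq hy) hx]
  exact (((((HasPD.coord (x := x) 1).sq.neg).mul (hasPD_of_contDiffOn hU R.contDiffOn_quad hx)).add
    ((HasPD.coord (x := x) 1).mul (hasPD_of_contDiffOn hU
      (contDiffOn_pd hU R.contDiffOn_lnQ 0) hx))).add
    (hasPD_of_contDiffOn hU R.contDiffOn_sigma hx)).2 ν

theorem pd_Sf_one : pd 1 (D.Sf c) x = -(2 * x 1) * D.quad c x + pd 0 (D.lnQ c) x := by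
  rw [R.pd_Sf hx, R.pd_quad hx (by decide), R.pd_sigma_one hx,
    R.pd_pd_eq_zero hx R.contDiffOn_lnQ (fun y hy => R.pd_lnQ_one hy)]
  simp

theorem pd_pd_Sf_one (ν : Fin 4) : pd ν (pd 1 (D.Sf c)) x
    = -(2 * (if ν = 1 then 1 else 0)) * D.quad c x + -(2 * x 1) * pd ν (D.quad c) x
      + pd ν (pd 0 (D.lnQ c)) x := by
  have hU := R.isOpen
  rw [pd_congr hU (fun y hy => R.pd_Sf_one hy) hx]
  exact ((((HasPD.coord (x := x) 1).const_mul 2).neg.mul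
    (hasPD_of_contDiffOn hU R.contDiffOn_quad hx)).add
      (hasPD_of_contDiffOn hU (contDiffOn_pd hU R.contDiffOn_lnQ 0) hx)).2 ν

theorem pd_Sf_trans {ν : Fin 4} (h0 : ν ≠ 0) (h1 : ν ≠ 1) : pd ν (D.Sf c) x
    = x 1 * pd ν (pd 0 (D.lnQ c)) x + pd ν (D.sigma c) x := by
  rw [R.pd_Sf hx, R.pd_quad hx h0]
  simp [h1]

theorem pd_pd_Sf_trans {ν : Fin 4} (h0 : ν ≠ 0) (h1 : ν ≠ 1) : pd ν (pd ν (D.Sf c)) x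
    = x 1 * pd ν (pd ν (pd 0 (D.lnQ c))) x + pd ν (pd ν (D.sigma c)) x := by
  have hU := R.isOpen
  rw [pd_congr hU (fun y hy => R.pd_Sf_trans hy h0 h1) hx]
  refine ((((HasPD.coord (x := x) 1).mul (hasPD_of_contDiffOn hU (contDiffOn_pd hU
    (contDiffOn_pd hU R.contDiffOn_lnQ 0) ν) hx)).add
      (hasPD_of_contDiffOn hU (contDiffOn_pd hU R.contDiffOn_sigma ν) hx)).2 ν).trans ?_
  simp [h1]

/-- The wave operator only sees the part of `S` that does not depend on `v`. -/
theorem waveOp_kjet : waveOp (D.kjet c x) (D.dkjet c x)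
    = pd 2 (pd 2 (D.sigma c)) x + pd 3 (pd 3 (D.sigma c)) x
      + pd 2 (D.lnH c) x * pd 2 (D.sigma c) x + pd 3 (D.lnH c) x * pd 3 (D.sigma c) x := by
  simp only [waveOp, kjet, dkjet, kjetOf, dkjetOf]
  rw [R.pd_Sf_trans hx (by decide) (by decide), R.pd_Sf_trans hx (by decide) (by decide),
    R.pd_pd_Sf_trans hx (by decide) (by decide), R.pd_pd_Sf_trans hx (by decide) (by decide)]
  linear_combination x 1 * R.laplace_pd_lnQ hx

theorem pd_m (ν : Fin 4) : pd ν (fun y => D.Qf c y ^ 2 / 2) x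
    = D.Qf c x ^ 2 / 2 * (2 * pd ν (D.lnQ c) x) := by
  refine (((R.hasPD_Qf hx).sq.div_const 2).2 ν).trans ?_
  have hQ : D.Qf c x ≠ 0 := R.Q_ne x hx
  rw [R.pd_lnQ hx]; field_simp

/-- Most relations are Schwarz symmetry or independence of a coordinate. The last four, the Einstein
relations, follow from the Hessians of `ln P`, `ln Q` and the three gradient identities. -/
theorem kRel : KRel c (D.hf c x) (D.kjet c x) (D.dkjet c x) := by
  have hU := R.isOpen
  have hP : Pf c x ≠ 0 := R.P_ne x hx
  have hQ : D.Qf c x ≠ 0 := R.Q_ne x hx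
  have cS := R.contDiffOn_Sf
  have cH := R.contDiffOn_lnH
  have H1 : ∀ y ∈ U, pd 1 (D.lnH c) y = 0 := fun y hy => by
    rw [R.pd_lnH hy, R.pd_lnQ_one hy, R.pd_lnP_one hy]; simp
  have K0 : ∀ y ∈ U, pd 0 (lnK c) y = 0 := fun y hy => by
    rw [R.pd_lnK hy, R.pd_lnP_zero hy]; simp
  have K1 : ∀ y ∈ U, pd 1 (lnK c) y = 0 := fun y hy => by
    rw [R.pd_lnK hy, R.pd_lnP_one hy]; simp
  have P0 : ∀ ν, pd ν (pd 0 (lnP c)) x = 0 := fun ν => by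
    rw [pd_comm hU R.contDiffOn_lnP hx,
      R.pd_pd_eq_zero hx R.contDiffOn_lnP fun y hy => R.pd_lnP_zero hy]
  obtain ⟨q1, q2, q3⟩ := R.pd_pd_lnQ hx
  obtain ⟨p1, p2, p3⟩ := R.pd_pd_lnP hx
  have g1 := R.grad_lnP_sq hx
  have g2 := R.grad_lnP_lnQ hx
  have g3 := R.grad_lnQ_sq hx
  constructor <;> simp only [kjet, dkjet, kjetOf, dkjetOf]
  · rw [R.pd_m hx, R.pd_lnH hx, R.pd_lnP_zero hx]; ring
  · rw [R.pd_m hx, R.pd_lnQ_one hx]; ring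
  · rw [R.pd_m hx, R.pd_lnH hx, R.pd_lnK hx]; ring
  · rw [R.pd_m hx, R.pd_lnH hx, R.pd_lnK hx]; ring
  · exact R.pd_pd_eq_zero hx cH H1 0
  · exact R.pd_pd_eq_zero hx cH H1 2
  · exact R.pd_pd_eq_zero hx cH H1 3
  · exact R.pd_pd_eq_zero hx R.contDiffOn_lnK K1 2
  · exact R.pd_pd_eq_zero hx R.contDiffOn_lnK K1 3
  · exact R.pd_one hx (φ := fun u z => 2 * (D.G u z).re) R.contDiffOn_ampG
  · exact R.pd_pd_eq_zero hx R.contDiffOn_lnK K0 2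
  · exact R.pd_pd_eq_zero hx R.contDiffOn_lnK K0 3
  · exact pd_comm hU cS hx 1 0
  · exact pd_comm hU cS hx 1 2
  · exact pd_comm hU cS hx 1 3
  · rw [R.pd_pd_Sf_one hx, R.pd_quad hx (by decide), R.pd_pd_lnH hx, P0]; simp
  · rw [R.pd_pd_Sf_one hx, R.pd_quad hx (by decide), R.pd_pd_lnH hx, P0]; simp
  · exact pd_comm hU cH hx 0 2
  · exact pd_comm hU cH hx 0 3
  · exact pd_comm hU R.contDiffOn_lnK hx 3 2
  · exact pd_comm hU cH hx 3 2
  · rw [R.pd_pd_Sf_one hx, R.pd_quad hx (by decide), R.pd_pd_eq_zero hx R.contDiffOn_lnQ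
      (fun y hy => R.pd_lnQ_one hy), R.pd_pd_lnH hx, R.pd_pd_lnH hx, R.pd_lnH hx, R.pd_lnH hx, q1,
      q2, p1, p2, hf]
    simp only [Fin.isValue, if_true]
    -- The weights: `|∇ln h|²` gives `4 g3 - 8 g2 + 4 g1`, and the squares in the second derivatives
    -- of `ln h` add `-2 g3 + 2 g1`. The prefactor is `-m`.
    linear_combination (norm := skip) (-(D.Qf c x ^ 2 / 2)) * (2 * g3 - 8 * g2 + 6 * g1)
    field_simp
    ring
  · rw [R.pd_pd_lnH hx, R.pd_pd_lnK hx, R.pd_pd_lnK hx, R.pd_lnH hx, R.pd_lnH hx, R.pd_lnK hx,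
      R.pd_lnK hx, q1, p1, p2, hf]
    linear_combination (norm := skip) (D.Qf c x ^ 2 / 2) * (4 * g2 - 6 * g1)
    field_simp
    ring
  · rw [R.pd_pd_lnH hx, R.pd_pd_lnK hx, R.pd_pd_lnK hx, R.pd_lnH hx, R.pd_lnH hx, R.pd_lnK hx,
      R.pd_lnK hx, q2, p1, p2, hf]
    linear_combination (norm := skip) (D.Qf c x ^ 2 / 2) * (4 * g2 - 6 * g1)
    field_simp
    ring
  · rw [R.pd_pd_lnH hx, R.pd_lnH hx, R.pd_lnH hx, R.pd_lnK hx, R.pd_lnK hx, q3, p3]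
    ring

end IsRegular

end WaveData

/-! ### Configurations and their jets -/

namespace WaveData

namespace IsRegular

variable {c : ℝ} {D : WaveData} {U : Set Pt} (R : D.IsRegular c U) {x : Pt} (hx : x ∈ U)
include R hx

theorem hf_pos : 0 < D.hf c x := by
  have hP : Pf c x ≠ 0 := R.P_ne x hx
  have hQ : D.Qf c x ≠ 0 := R.Q_ne x hx
  unfold hf; positivity

theorem kf_pos : 0 < kf c x := by
  have hP : Pf c x ≠ 0 := R.P_ne x hx
  unfold kf; positivity

theorem hasPD_hf : HasPD (D.hf c) (fun ν => D.hf c x * pd ν (D.lnH c) x) x := by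
  have hP : Pf c x ≠ 0 := R.P_ne x hx
  have hQ : D.Qf c x ≠ 0 := R.Q_ne x hx
  refine ((R.hasPD_Qf hx).div (hasPD_Pf c x) hP).sq.congr_pd fun ν => ?_
  rw [R.pd_lnH hx, R.pd_lnQ hx, R.pd_lnP hx, hf]
  field_simp

theorem hasPD_kf : HasPD (kf c) (fun ν => kf c x * pd ν (lnK c) x) x := by
  have hP : Pf c x ≠ 0 := R.P_ne x hx
  refine ((HasPD.const (x := x) 2).div (hasPD_Pf c x).sq (pow_ne_zero 2 hP)).congr_pd fun ν => ?_
  rw [R.pd_lnK hx, R.pd_lnP hx, kf]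
  field_simp
  ring

theorem isKundtJet (Γ : Pt → Arr3) :
    IsKundtJet (D.hf c x) (kf c x) (D.kjet c x) ((D.fields c Γ).jet x) where
  h_pos := R.hf_pos hx
  k_pos := R.kf_pos hx
  m_eq := by
    have hP : Pf c x ≠ 0 := R.P_ne x hx
    simp only [kjet, kjetOf, hf, kf]; field_simp
  g_eq := rfl
  dg_eq := by
    refine pd_kMetric_kjetOf R.isOpen R.contDiffOn_Sf hx (R.hasPD_hf hx) (R.hasPD_kf hx) ?_ ?_ ?_
    · rw [R.pd_lnH hx, R.pd_lnQ_one hx, R.pd_lnP_one hx]; simp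
    · rw [R.pd_lnK hx, R.pd_lnP_zero hx]; simp
    · rw [R.pd_lnK hx, R.pd_lnP_one hx]; simp
  unit := rfl
  de_eq := by
    funext ν
    simp [Fields.jet, fields, pd]

omit R hx in
theorem _root_.MAG.Jet.HasUnitCoframe.ofOneForm_waveForm {J : Jet} (h : J.HasUnitCoframe)
    (K : ℝ → ℂ → ℂ) (y : Pt) : J.ofOneForm (waveForm K y) = duForm (amp K y) := by
  funext m; rw [h.ofOneForm_eq]; rfl

/-- The parts `non3`, `non4`, `tor2` are the trace operators applied to the actual traces.
Prescribing the traces thus makes the fields explicit, and `conn_unique` and `pure_of_conn` give the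
two directions. -/
theorem isTriplet_iff (p : Params) (Γ : Pt → Arr3) :
    ((let J := (D.fields c Γ).jet x
      J.nonmet = J.non3 + J.non4 ∧ J.torsion = J.tor2 ∧
      J.traceQ = p.k0 • J.ofOneForm (waveForm D.G x) ∧
      J.traceLam = p.k1 • J.ofOneForm (waveForm D.G x) ∧
      J.traceT = p.k2 • J.ofOneForm (waveForm D.G x))) ↔
    Γ x = conn p.cA p.cB p.cC (D.kjet c x) := by
  have K := R.isKundtJet hx Γ
  set J := (D.fields c Γ).jet x with hJ
  have e := K.unit.ofOneForm_waveForm D.G x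
  have G : J.Γ = Γ x := rfl
  constructor
  · rintro ⟨h1, h2, h3, h4, h5⟩
    rw [e] at h3 h4 h5
    rw [← G]
    refine K.conn_unique p ?_ ?_
    · rw [h2]; exact congrArg (vecTor J.g) h5
    · rw [h1]
      exact congrArg₂ (· + ·) (congrArg (vecNon J.g) h4) (congrArg (weylNon J.g) h3)
  · intro h
    obtain ⟨hT, hN⟩ := K.pure_of_conn p (G.trans h)
    have t1 : J.traceT = p.k2 • duForm (amp D.G x) := K.metricPair.trT_of_pure hT
    have t2 : J.traceLam = p.k1 • duForm (amp D.G x) := K.metricPair.trLam_of_pure hN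
    have t3 : J.traceQ = p.k0 • duForm (amp D.G x) := K.metricPair.trQ_of_pure hN
    refine ⟨?_, ?_, ?_, ?_, ?_⟩
    · rw [hN]
      exact congrArg₂ (· + ·) (congrArg (vecNon J.g) t2.symm) (congrArg (weylNon J.g) t3.symm)
    · rw [hT]; exact congrArg (vecTor J.g) t1.symm
    · rw [e]; exact t3
    · rw [e]; exact t2
    · rw [e]; exact t1

end IsRegular

/-- The derivatives of the real part of a holomorphic amplitude. -/
theorem pd_amp {K k : ℝ → ℂ → ℂ} {U : Set Pt} (hU : IsOpen U)
    (hK : ContDiffOn ℝ ∞ (fun x : Pt => K (x 0) (zeta x)) U)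
    (hk : ∀ x ∈ U, HasDerivAt (K (x 0)) (k (x 0) (zeta x)) (zeta x)) {x : Pt} (hx : x ∈ U) :
    pd 1 (amp K) x = 0 ∧ pd 2 (amp K) x = 2 * (k (x 0) (zeta x)).re ∧
    pd 3 (amp K) x = -2 * (k (x 0) (zeta x)).im ∧
    pd 2 (pd 2 (amp K)) x + pd 3 (pd 3 (amp K)) x = 0 := by
  have cr : ContDiffOn ℝ ∞ (amp K) U :=
    contDiffOn_const.mul (Complex.reCLM.contDiff.comp_contDiffOn hK)
  -- The harmonic conjugate, used for the Laplace equation through the Cauchy–Riemann equations.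
  set B : Pt → ℝ := fun y => 2 * (K (y 0) (zeta y)).im with hB
  have ci : ContDiffOn ℝ ∞ B U :=
    contDiffOn_const.mul (Complex.imCLM.contDiff.comp_contDiffOn hK)
  have d2 : ∀ y ∈ U, HasDerivAt (fun t : ℝ => K (y 0) (zeta y + ((t - y 2 : ℝ) : ℂ)))
      (k (y 0) (zeta y)) (y 2) := fun y hy => by
    have h1 : HasDerivAt (fun t : ℝ => zeta y + ((t - y 2 : ℝ) : ℂ)) 1 (y 2) := by
      have := (((hasDerivAt_id (y 2)).sub_const (y 2)).ofReal_comp).const_add (zeta y)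
      simpa using this
    have h2 : HasDerivAt (K (y 0)) (k (y 0) (zeta y)) (zeta y + ((y 2 - y 2 : ℝ) : ℂ)) := by
      simpa using hk y hy
    have := h2.scomp (y 2) h1
    rw [one_smul] at this
    exact this
  have d3 : ∀ y ∈ U, HasDerivAt (fun t : ℝ => K (y 0) (zeta y + ((t - y 3 : ℝ) : ℂ) * Complex.I))
      (Complex.I * k (y 0) (zeta y)) (y 3) := fun y hy => by
    have h1 : HasDerivAt (fun t : ℝ => zeta y + ((t - y 3 : ℝ) : ℂ) * Complex.I)
        Complex.I (y 3) := by
      have := ((((hasDerivAt_id (y 3)).sub_const (y 3)).ofReal_comp).mul_const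
        Complex.I).const_add (zeta y)
      simpa using this
    have h2 : HasDerivAt (K (y 0)) (k (y 0) (zeta y))
        (zeta y + ((y 3 - y 3 : ℝ) : ℂ) * Complex.I) := by
      simpa using hk y hy
    exact h2.scomp (y 3) h1
  have hr : ∀ y ∈ U, HasPD (amp K) (fun ν => pd ν (amp K) y) y := fun y hy =>
    hasPD_of_contDiffOn hU cr hy
  have hi : ∀ y ∈ U, HasPD B (fun ν => pd ν B y) y := fun y hy => hasPD_of_contDiffOn hU ci hy
  have r2 : ∀ y ∈ U, pd 2 (amp K) y = 2 * (k (y 0) (zeta y)).re := fun y hy =>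
    (hr y hy).pd_of_line (ν := 2) (by
      simpa [amp, zeta_line_two] using (Complex.reCLM.hasFDerivAt.comp_hasDerivAt _
        (d2 y hy)).const_mul 2)
  have i2 : ∀ y ∈ U, pd 2 B y = 2 * (k (y 0) (zeta y)).im := fun y hy =>
    (hi y hy).pd_of_line (ν := 2) (by
      simpa [hB, zeta_line_two] using (Complex.imCLM.hasFDerivAt.comp_hasDerivAt _
        (d2 y hy)).const_mul 2)
  have r3 : ∀ y ∈ U, pd 3 (amp K) y = -2 * (k (y 0) (zeta y)).im := fun y hy =>
    (hr y hy).pd_of_line (ν := 3) (by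
      simpa [amp, zeta_line_three] using (Complex.reCLM.hasFDerivAt.comp_hasDerivAt _
        (d3 y hy)).const_mul 2)
  have i3 : ∀ y ∈ U, pd 3 B y = 2 * (k (y 0) (zeta y)).re := fun y hy =>
    (hi y hy).pd_of_line (ν := 3) (by
      simpa [hB, zeta_line_three] using (Complex.imCLM.hasFDerivAt.comp_hasDerivAt _
        (d3 y hy)).const_mul 2)
  refine ⟨(hr x hx).pd_eq_zero_of_line (ν := 1) fun t => ?_, r2 x hx, r3 x hx, ?_⟩
  · simp only [amp, line_zero x (by decide : (1 : Fin 4) ≠ 0), zeta_line_one]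
  -- By Cauchy–Riemann, `∂₃ amp = -∂₂ B` and `∂₂ amp = ∂₃ B`; symmetry of the second derivatives of
  -- `B` finishes.
  · have e : pd 3 (pd 3 (amp K)) x = -(pd 3 (pd 2 B) x) := by
      rw [pd_congr hU (g := fun y => -pd 2 B y) (fun y hy => by rw [r3 y hy, i2 y hy]; ring) hx]
      exact (hasPD_of_contDiffOn hU (contDiffOn_pd hU ci 2) hx).neg.2 3
    rw [e, pd_comm hU ci hx, pd_congr hU (fun y hy => (r2 y hy).trans (i3 y hy).symm) hx]
    ring

namespace IsRegular

variable {c : ℝ} {D : WaveData} {U : Set Pt} (R : D.IsRegular c U) {x : Pt} (hx : x ∈ U)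
include R hx

theorem isConfigJet (p : Params) (hc : p.lam = c) {Γ : Pt → Arr3}
    (hΓ : ∀ y ∈ U, Γ y = conn p.cA p.cB p.cC (D.kjet c y)) :
    IsConfigJet p (D.hf c x) (kf c x) (D.kjet c x) (D.dkjet c x) (pd 2 (amp D.F) x)
      (pd 3 (amp D.F) x) ((D.fields c Γ).jet x) where
  toIsKundtJet := R.isKundtJet hx Γ
  rel := hc ▸ R.kRel hx
  conn_eq := hΓ x hx
  dconn_eq := by
    have hQ : D.Qf c x ≠ 0 := R.Q_ne x hx
    funext ν
    have : Γ =ᶠ[nhds x] fun y => conn p.cA p.cB p.cC (D.kjet c y) :=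
      Filter.eventually_of_mem (R.isOpen.mem_nhds hx) hΓ
    change pd ν Γ x = _
    rw [pd, this.fderiv_eq]
    exact pd_conn_kjetOf R.isOpen R.contDiffOn_Sf R.contDiffOn_lnH R.contDiffOn_lnK
      R.contDiffOn_m R.contDiffOn_ampG hx p.cA p.cB p.cC (by positivity) ν
  field_eq := by
    have z : HasPD (fun _ => (0 : ℝ)) (fun _ => 0) x := HasPD.const 0
    have a := (hasPD_of_contDiffOn R.isOpen R.contDiffOn_ampF hx)
    have h1 := (pd_amp R.isOpen R.F_smooth R.F_prim hx).1
    have w := (a.vec4 z z z).2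
    have e : ((D.fields c Γ).jet x).dA = fun ν => ![pd ν (amp D.F) x, 0, 0, 0] := funext w
    funext μ ν
    simp only [Jet.fieldRaw, e]
    fin_cases μ <;> fin_cases ν <;> simp [duTwoForm, h1]

end IsRegular

end WaveData

/-! ### The three variational derivatives on a configuration -/

/-- The force is needed only at `x`, but the momenta must be known on a neighbourhood, because they
are differentiated. -/
theorem eulerLagrange_eq {V : Type} [NormedAddCommGroup V] [NormedSpace ℝ V]
    {L : Pt → V → (Fin 4 → V) → ℝ} {q : Pt → V} {U : Set Pt} (hU : IsOpen U) {x : Pt} (hx : x ∈ U)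
    {w : V} {force : ℝ} {mom : Fin 4 → Pt → ℝ}
    (h1 : HasDerivAt (fun t : ℝ => L x (q x + t • w) (fun μ => pd μ q x)) force 0)
    (h2 : ∀ y ∈ U, ∀ ν, HasDerivAt (fun t : ℝ =>
      L y (q y) (fun μ => pd μ q y + t • (Pi.single ν w : Fin 4 → V) μ)) (mom ν y) 0) :
    eulerLagrange L q x w = force - ∑ ν, pd ν (mom ν) x := by
  rw [eulerLagrange, h1.deriv]
  congr! 2 with ν
  exact pd_congr hU (fun y hy => (h2 y hy ν).deriv) hx ν

namespace Jet

variable (J : Jet)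

theorem vary_varE (w : Arr2) (t : ℝ) :
    J.vary (varE w) t = { J with e := J.e + t • w } := by
  simp [vary, varE, Jet.zero]

theorem vary_varG (w : Arr3) (t : ℝ) :
    J.vary (varG w) t = { J with Γ := J.Γ + t • w } := by
  simp [vary, varG, Jet.zero]

theorem vary_varA (w : Arr1) (t : ℝ) :
    J.vary (varA w) t = { J with A := J.A + t • w } := by
  simp [vary, varA, Jet.zero]

theorem vary_varDE (w : Fin 4 → Arr2) (t : ℝ) :
    J.vary (varDE w) t = { J with de := fun μ => J.de μ + t • w μ } := by
  simp [vary, varDE, Jet.zero]; rfl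

theorem vary_varDG (w : Fin 4 → Arr3) (t : ℝ) :
    J.vary (varDG w) t = { J with dΓ := fun μ => J.dΓ μ + t • w μ } := by
  simp [vary, varDG, Jet.zero]; rfl

theorem vary_varDA (w : Fin 4 → Arr1) (t : ℝ) :
    J.vary (varDA w) t = { J with dA := fun μ => J.dA μ + t • w μ } := by
  simp [vary, varDA, Jet.zero]; rfl

end Jet

namespace WaveData

/-- The current of `du ∧ df` is conserved when `f` is independent of `v` and harmonic in the
transverse plane. This applies to the potential `A` and to the Weyl covector alike. -/
theorem sum_pd_current {f : Pt → ℝ} {U : Set Pt} (hU : IsOpen U) (hf : ContDiffOn ℝ ∞ f U)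
    {x : Pt} (hx : x ∈ U) (h1 : ∀ y ∈ U, pd 1 f y = 0)
    (h : pd 2 (pd 2 f) x + pd 3 (pd 3 f) x = 0) (a b e : ℝ) :
    ∑ ν, pd ν (fun y => (![0, -(pd 2 f y * a + pd 3 f y * b), pd 2 f y * e, pd 3 f y * e] :
      Fin 4 → ℝ) ν) x = 0 := by
  have d2 := hasPD_of_contDiffOn hU (contDiffOn_pd hU hf 2) hx
  have d3 := hasPD_of_contDiffOn hU (contDiffOn_pd hU hf 3) hx
  have z : ∀ ν, pd 1 (pd ν f) x = 0 := fun ν => by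
    rw [pd_comm hU hf hx, pd_congr hU (g := fun _ => 0) h1 hx]
    exact (HasPD.const 0).2 ν
  have e1 := ((d2.mul_const a).add (d3.mul_const b)).neg.2 1
  have e2 := (d2.mul_const e).2 2
  have e3 := (d3.mul_const e).2 3
  rw [Fin.sum_univ_four]
  simp only [Matrix.cons_val]
  rw [(HasPD.const 0).2, e1, e2, e3]
  beta_reduce
  rw [z, z]
  linear_combination e * h

theorem differentiableAt_current {f : Pt → ℝ} {U : Set Pt} (hU : IsOpen U)
    (hf : ContDiffOn ℝ ∞ f U) {x : Pt} (hx : x ∈ U) (a b e : ℝ) (ν : Fin 4) :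
    DifferentiableAt ℝ (fun y => (![0, -(pd 2 f y * a + pd 3 f y * b), pd 2 f y * e,
      pd 3 f y * e] : Fin 4 → ℝ) ν) x := by
  have d2 := (hasPD_of_contDiffOn hU (contDiffOn_pd hU hf 2) hx).1
  have d3 := (hasPD_of_contDiffOn hU (contDiffOn_pd hU hf 3) hx).1
  fin_cases ν
  exacts [differentiableAt_const 0, ((d2.mul_const a).add (d3.mul_const b)).neg, d2.mul_const e,
    d3.mul_const e]

namespace IsRegular

variable {p : Params} {D : WaveData} {U : Set Pt} (R : D.IsRegular p.lam U) {Γ : Pt → Arr3}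
  (hΓ : ∀ y ∈ U, Γ y = conn p.cA p.cB p.cC (D.kjet p.lam y)) {x : Pt} (hx : x ∈ U)
include R hΓ hx

theorem hasDerivAt_lagrangian (V : Jet) :
    HasDerivAt (fun t => lagrangian p (((D.fields p.lam Γ).jet x).vary V t))
      (Jet.lagVar p ((D.fields p.lam Γ).jet x) V (p.k2 • duForm (D.kjet p.lam x).ψ)
        (p.k1 • duForm (D.kjet p.lam x).ψ) (p.k0 • duForm (D.kjet p.lam x).ψ)) 0 := by
  have H := R.isConfigJet hx p rfl hΓ
  obtain ⟨hT, hN⟩ := H.pure_of_conn p H.conn_eq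
  refine H.unit.hasDerivAt_lagrangian H.metricPair (fun μ a b => ?_) p V hT hN
  rw [H.dg_eq]
  fin_cases μ <;> fin_cases a <;> fin_cases b <;> rfl

/-- The Lagrangian depends on `A` only through `dA`, so there is no force, and the divergence of the
momenta vanishes because the real part of `F` is harmonic. -/
theorem eulerLagrange_A (w : Arr1) :
    eulerLagrange (fun y q dq => lagrangian p { (D.fields p.lam Γ).jet y with A := q, dA := dq })
      (D.fields p.lam Γ).A x w = 0 := by
  obtain ⟨-, -, -, hh⟩ := pd_amp R.isOpen R.F_smooth R.F_prim hx
  rw [eulerLagrange_eq R.isOpen hx (force := 0) (mom := fun ν y => (![0,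
    -(pd 2 (amp D.F) y * w 2 + pd 3 (amp D.F) y * w 3), pd 2 (amp D.F) y * w 1,
      pd 3 (amp D.F) y * w 1] : Fin 4 → ℝ) ν)]
  · rw [sum_pd_current R.isOpen R.contDiffOn_ampF hx
      (fun y hy => (pd_amp R.isOpen R.F_smooth R.F_prim hy).1) hh, sub_zero]
  · have := R.hasDerivAt_lagrangian hΓ hx (Jet.varA w)
    rw [(R.isConfigJet hx p rfl hΓ).lagVar_varA w] at this
    simp only [Jet.vary_varA] at this
    exact this
  · intro y hy ν
    have := R.hasDerivAt_lagrangian hΓ hy (Jet.varDA (Pi.single ν w))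
    rw [(R.isConfigJet hy p rfl hΓ).lagVar_varDA ν w] at this
    simp only [Jet.vary_varDA] at this
    exact this

omit hΓ in
theorem hasPD_kDens (a b : Fin 4) :
    HasPD (fun y => kDens (D.hf p.lam y) (D.Sf p.lam y) (kf p.lam y) a b)
      (fun ν => dkDens (D.hf p.lam x) (kf p.lam x) (D.kjet p.lam x) ν a b) x := by
  have K0 : pd 0 (lnK p.lam) x = 0 := by rw [R.pd_lnK hx, R.pd_lnP_zero hx]; simp
  have K1 : pd 1 (lnK p.lam) x = 0 := by rw [R.pd_lnK hx, R.pd_lnP_one hx]; simp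
  have L1 : pd 1 (D.lnH p.lam) x = 0 := by
    rw [R.pd_lnH hx, R.pd_lnQ_one hx, R.pd_lnP_one hx]; simp
  have z : HasPD (fun _ => (0 : ℝ)) (fun _ => 0) x := HasPD.const 0
  have k : HasPD (kf p.lam) (![0, 0, kf p.lam x * (D.kjet p.lam x).rx,
      kf p.lam x * (D.kjet p.lam x).ry]) x := (R.hasPD_kf hx).congr_pd fun ν => by
    fin_cases ν <;> simp [K0, K1, kjet, kjetOf]
  have h : HasPD (D.hf p.lam) (![D.hf p.lam x * (D.kjet p.lam x).η, 0,
      D.hf p.lam x * (D.kjet p.lam x).px, D.hf p.lam x * (D.kjet p.lam x).py]) x :=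
    (R.hasPD_hf hx).congr_pd fun ν => by
      fin_cases ν <;> simp [L1, kjet, kjetOf]
  have s : HasPD (D.Sf p.lam) (![(D.kjet p.lam x).Su, (D.kjet p.lam x).Sv, (D.kjet p.lam x).Sx,
      (D.kjet p.lam x).Sy]) x :=
    (hasPD_of_contDiffOn R.isOpen R.contDiffOn_Sf hx).congr_pd fun ν => by
      fin_cases ν <;> rfl
  have sk := ((s.mul k).const_mul 2).neg
  fin_cases a <;> fin_cases b
  exacts [z, k, z, z, k, sk, z, z, z, z, h.neg, z, z, z, z, h.neg]

/-- The Weyl current in the momenta is conserved, and the divergence of the Hilbert part is what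
`lagVar_varG` subtracts. Only the mass term is left. -/
theorem eulerLagrange_Γ (w : Arr3) :
    eulerLagrange (fun y q dq => lagrangian p { (D.fields p.lam Γ).jet y with Γ := q, dΓ := dq })
      (D.fields p.lam Γ).Γ x w
      = -(p.massCoeff / (4 * p.κ)) * kf p.lam x * amp D.G x * ∑ c, w 1 c c := by
  have H := R.isConfigJet hx p rfl hΓ
  have hU := R.isOpen
  obtain ⟨-, -, -, hh⟩ := pd_amp R.isOpen R.G_smooth R.G_prim hx
  have h1 := fun y hy => (pd_amp R.isOpen R.G_smooth R.G_prim (x := y) hy).1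
  rw [eulerLagrange_eq R.isOpen hx (force := _) (mom := _) (by
    have := R.hasDerivAt_lagrangian hΓ hx (Jet.varG w)
    simp only [Jet.vary_varG] at this
    exact this) (fun y hy ν => by
    have := R.hasDerivAt_lagrangian hΓ hy (Jet.varDG (Pi.single ν w))
    rw [(R.isConfigJet hy p rfl hΓ).lagVar_varDG ν w] at this
    simp only [Jet.vary_varDG] at this
    exact this)]
  have hd := R.hasPD_kDens hx
  have hs := sum_pd_current hU R.contDiffOn_ampG hx h1 hh (∑ c, w 2 c c) (∑ c, w 3 c c)
    (∑ c, w 1 c c)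
  have hc := fun ν => HasPD.of_differentiableAt (differentiableAt_current hU R.contDiffOn_ampG hx
    (∑ c, w 2 c c) (∑ c, w 3 c c) (∑ c, w 1 c c) ν)
  have e := fun ν => ((((HasPD.sum Finset.univ fun n _ => HasPD.sum Finset.univ fun a _ =>
      (hd ν a).mul_const (w n a n)).sub (HasPD.sum Finset.univ fun m _ =>
      HasPD.sum Finset.univ fun a _ => (hd m a).mul_const (w m a ν))).const_mul
      (p.a0 / (2 * p.κ))).add ((hc ν).const_mul (p.z5 * p.k0 / (2 * p.ρ)))).2 ν
  refine (congrArg₂ _ rfl (Finset.sum_congr rfl fun ν _ => e ν)).trans ?_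
  rw [Finset.sum_add_distrib, ← Finset.mul_sum, ← Finset.mul_sum, hs, mul_zero, add_zero]
  exact H.lagVar_varG w

/-- The momenta are multiples of `k ψ`, which is independent of `v`, while `k` is also independent
of `u`. Hence their divergence equals the `cT` bracket in the force, and the two cancel. -/
theorem eulerLagrange_e (w : Arr2) :
    eulerLagrange (fun y q dq => lagrangian p { (D.fields p.lam Γ).jet y with e := q, de := dq })
      (D.fields p.lam Γ).e x w
      = D.hf p.lam x * kf p.lam x * p.lam * (p.a0 - 1) / p.κ * (∑ a, w a a)
      + (p.a0 * D.hf p.lam x / p.κ * waveOp (D.kjet p.lam x) (D.dkjet p.lam x)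
        + kf p.lam x * p.k0 * p.massCoeff / (2 * p.κ) * amp D.G x ^ 2
        - (pd 2 (amp D.F) x ^ 2 + pd 3 (amp D.F) x ^ 2)
        - p.z5 * p.k0 ^ 2 / p.ρ * (pd 2 (amp D.G) x ^ 2 + pd 3 (amp D.G) x ^ 2)) * w 1 0 := by
  have H := R.isConfigJet hx p rfl hΓ
  obtain ⟨hT, hN⟩ := H.pure_of_conn p H.conn_eq
  have hU := R.isOpen
  have g1 := (pd_amp R.isOpen R.G_smooth R.G_prim hx).1
  have g := hasPD_of_contDiffOn hU R.contDiffOn_ampG hx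
  rw [eulerLagrange_eq R.isOpen hx (force := _) (mom := _) (by
    have := R.hasDerivAt_lagrangian hΓ hx (Jet.varE w)
    rw [H.lagVar_varE w hT hN] at this
    simp only [Jet.vary_varE] at this
    exact this) (fun y hy ν => by
    have := R.hasDerivAt_lagrangian hΓ hy (Jet.varDE (Pi.single ν w))
    rw [(R.isConfigJet hy p rfl hΓ).lagVar_varDE ν w] at this
    simp only [Jet.vary_varDE] at this
    exact this)]
  have e := fun ν => ((((R.hasPD_kf hx).mul g).const_mul (-(p.cT / (2 * p.κ)))).mul_const
    (w 1 ν - (if ν = 1 then ∑ b, w b b else 0))).2 ν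
  have e' := Finset.sum_congr (s₁ := Finset.univ) rfl fun ν _ => e ν
  refine (congrArg₂ _ rfl (e'.trans (Fin.sum_univ_four _))).trans ?_
  have K0 : pd 0 (lnK p.lam) x = 0 := by rw [R.pd_lnK hx, R.pd_lnP_zero hx]; simp
  have K1 : pd 1 (lnK p.lam) x = 0 := by rw [R.pd_lnK hx, R.pd_lnP_one hx]; simp
  simp only [K0, K1, g1, kjet, dkjet, kjetOf, dkjetOf, Fin.isValue, Fin.reduceEq,
    if_true, if_false]
  ring

end IsRegular

end WaveData

/-! ### The wave equation -/

/-- The embedding of the transverse plane through `x`. -/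
def plane (x : Pt) (w : ℂ) : Pt := ![x 0, x 1, w.re, w.im]

theorem plane_zeta (x : Pt) : plane x (zeta x) = x := by
  funext i; fin_cases i <;> rfl

/-- The differential of `plane`. -/
def planeLin : ℂ →L[ℝ] Pt := Complex.reCLM.smulRight (Pi.single 2 1) +
  Complex.imCLM.smulRight (Pi.single 3 1)

theorem hasFDerivAt_plane (x : Pt) (w : ℂ) : HasFDerivAt (plane x) planeLin w := by
  have : plane x = fun w => (![x 0, x 1, 0, 0] : Pt) + planeLin w := by
    funext w i
    fin_cases i <;> simp [plane, planeLin]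
  rw [this]
  exact (planeLin.hasFDerivAt).const_add _

theorem hasFDerivAt_comp_plane {f : Pt → ℝ} {x : Pt} {w : ℂ}
    (hf : DifferentiableAt ℝ f (plane x w)) :
    HasFDerivAt (fun w => (f (plane x w) : ℂ))
      (Complex.ofRealCLM ∘L (fderiv ℝ f (plane x w) ∘L planeLin)) w :=
  Complex.ofRealCLM.hasFDerivAt.comp w (hf.hasFDerivAt.comp w (hasFDerivAt_plane x w))

theorem planeLin_one : planeLin 1 = Pi.single 2 1 := by simp [planeLin]

theorem planeLin_I : planeLin Complex.I = Pi.single 3 1 := by simp [planeLin]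

/-- `∂_ζ ∂_{ζ*}` is a quarter of the Laplacian; the imaginary parts cancel by symmetry of second
derivatives. -/
theorem dz_dzbar {f : Pt → ℝ} {U : Set Pt} (hU : IsOpen U) (hf : ContDiffOn ℝ ∞ f U) {x : Pt}
    (hx : x ∈ U) : dz (dzbar (fun w => (f (plane x w) : ℂ))) (zeta x)
      = (((pd 2 (pd 2 f) x + pd 3 (pd 3 f) x) / 4 : ℝ) : ℂ) := by
  have hV : ∀ᶠ w in nhds (zeta x), plane x w ∈ U :=
    (hasFDerivAt_plane x (zeta x)).continuousAt.preimage_mem_nhds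
      (hU.mem_nhds (by rw [plane_zeta]; exact hx))
  have e : dzbar (fun w => (f (plane x w) : ℂ)) =ᶠ[nhds (zeta x)]
      fun w => (1 / 2 : ℂ) * (((pd 2 f (plane x w) : ℝ) : ℂ)
        + Complex.I * ((pd 3 f (plane x w) : ℝ) : ℂ)) := by
    filter_upwards [hV] with w hw
    have d := (hf.contDiffAt (hU.mem_nhds hw)).differentiableAt (by simp)
    rw [dzbar, (hasFDerivAt_comp_plane d).fderiv]
    simp [planeLin_one, planeLin_I, pd]
    ring
  have d2 := hasFDerivAt_comp_plane (x := x) (w := zeta x)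
    (by rw [plane_zeta]; exact (hasPD_of_contDiffOn hU (contDiffOn_pd hU hf 2) hx).1)
  have d3 := hasFDerivAt_comp_plane (x := x) (w := zeta x)
    (by rw [plane_zeta]; exact (hasPD_of_contDiffOn hU (contDiffOn_pd hU hf 3) hx).1)
  have E : fderiv ℝ (fun w => (1 / 2 : ℂ) * (((pd 2 f (plane x w) : ℝ) : ℂ)
      + Complex.I * ((pd 3 f (plane x w) : ℝ) : ℂ))) (zeta x) = _ :=
    ((d2.add (d3.const_mul Complex.I)).const_mul (1 / 2 : ℂ)).fderiv
  rw [dz, e.fderiv_eq, E]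
  simp only [plane_zeta, _root_.add_apply, _root_.smul_apply, ContinuousLinearMap.comp_apply,
    planeLin_one, planeLin_I, smul_eq_mul, Complex.ofRealCLM_apply]
  have c := pd_comm hU hf hx 2 3
  simp only [pd] at c ⊢
  rw [c]
  push_cast
  linear_combination (-(1 / 4) * ((fderiv ℝ (pd 3 f) x (Pi.single 3 1) : ℝ) : ℂ)) * Complex.I_sq

namespace WaveData

namespace IsRegular

variable {c : ℝ} {D : WaveData} {U : Set Pt} (R : D.IsRegular c U) {x : Pt} (hx : x ∈ U)
include R hx

/-- Here `H = 2 √h σ` up to sign, with `√h = |Q/P|`. Conjugation by `Q/P` trades the first-order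
term of the wave operator for a potential. -/
theorem laplace_H :
    pd 2 (pd 2 (fun y => D.H (y 0) (zeta y))) x + pd 3 (pd 3 (fun y => D.H (y 0) (zeta y))) x
      = 2 * (D.Qf c x / Pf c x) * (waveOp (D.kjet c x) (D.dkjet c x)
        - 4 * c / (3 * Pf c x ^ 2) * D.sigma c x) := by
  have hU := R.isOpen
  have hP : ∀ y ∈ U, Pf c y ≠ 0 := R.P_ne
  have hQ : ∀ y ∈ U, D.Qf c y ≠ 0 := R.Q_ne
  have q : ∀ y ∈ U, HasPD (fun y => D.Qf c y / Pf c y)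
      (fun ν => D.Qf c y / Pf c y * (pd ν (D.lnH c) y / 2)) y := fun y hy =>
    ((R.hasPD_Qf hy).div (hasPD_Pf c y) (hP y hy)).congr_pd fun ν => by
      have := hP y hy
      have := hQ y hy
      rw [R.pd_lnH hy, R.pd_lnQ hy, R.pd_lnP hy]; field_simp
  have s : ∀ y ∈ U, HasPD (D.sigma c) (fun ν => pd ν (D.sigma c) y) y := fun y hy =>
    hasPD_of_contDiffOn hU R.contDiffOn_sigma hy
  have e0 : ∀ y ∈ U, D.H (y 0) (zeta y) = 2 * (D.Qf c y / Pf c y * D.sigma c y) := fun y hy => by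
    have := hP y hy
    have := hQ y hy
    rw [sigma]; field_simp
  have e1 : ∀ ν, ∀ y ∈ U, pd ν (fun y => D.H (y 0) (zeta y)) y = 2 * (D.Qf c y / Pf c y *
      (pd ν (D.lnH c) y / 2 * D.sigma c y + pd ν (D.sigma c) y)) := fun ν y hy => by
    rw [pd_congr hU e0 hy]
    refine ((((q y hy).mul (s y hy)).const_mul 2).2 ν).trans ?_
    ring
  have e2 : ∀ ν, pd ν (pd ν (fun y => D.H (y 0) (zeta y))) x = 2 * (D.Qf c x / Pf c x *
      (pd ν (pd ν (D.sigma c)) x + pd ν (D.lnH c) x * pd ν (D.sigma c) x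
        + (pd ν (pd ν (D.lnH c)) x / 2 + (pd ν (D.lnH c) x / 2) ^ 2) * D.sigma c x)) := fun ν => by
    rw [pd_congr hU (e1 ν) hx]
    refine ((((q x hx).mul (((hasPD_of_contDiffOn hU (contDiffOn_pd hU R.contDiffOn_lnH ν)
      hx).div_const 2).mul (s x hx) |>.add (hasPD_of_contDiffOn hU (contDiffOn_pd hU
      R.contDiffOn_sigma ν) hx))).const_mul 2).2 ν).trans ?_
    ring
  -- This is the potential `Δ(Q/P) / (Q/P)`; the dependence on `Q` drops out by `laplace_lnQ`.
  have l : (pd 2 (pd 2 (D.lnH c)) x + pd 3 (pd 3 (D.lnH c)) x) / 2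
      + (pd 2 (D.lnH c) x ^ 2 + pd 3 (D.lnH c) x ^ 2) / 4 = -(4 * c / (3 * Pf c x ^ 2)) := by
    have := hP x hx
    rw [R.pd_pd_lnH hx, R.pd_pd_lnH hx, R.pd_lnH hx, R.pd_lnH hx, (R.pd_pd_lnP hx).1,
      (R.pd_pd_lnP hx).2.1]
    linear_combination (norm := skip) R.laplace_lnQ hx + 2 * R.grad_lnP_sq hx
    field_simp
    ring
  rw [e2, e2, R.waveOp_kjet hx]
  linear_combination 2 * (D.Qf c x / Pf c x) * D.sigma c x * l

/-- The term `λ/(3P²) H` cancels the potential from `laplace_H`. What remains on both sides carries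
the nonvanishing factor `P/(2Q)`. -/
theorem wave_iff (κ : ℝ) :
    (dz (dzbar (fun w => (D.H (x 0) w : ℂ))) (zeta x)
      + ((c / (3 * WaveData.P c (zeta x) ^ 2) * D.H (x 0) (zeta x) : ℝ) : ℂ)
    = ((2 * κ * WaveData.P c (zeta x) / D.Q c (x 0) (zeta x)
        * (‖D.f (x 0) (zeta x)‖ ^ 2 + ‖D.g (x 0) (zeta x)‖ ^ 2) : ℝ) : ℂ)) ↔
    D.hf c x * waveOp (D.kjet c x) (D.dkjet c x)
      = 4 * κ * (‖D.f (x 0) (zeta x)‖ ^ 2 + ‖D.g (x 0) (zeta x)‖ ^ 2) := by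
  have hP : Pf c x ≠ 0 := R.P_ne x hx
  have hQ : D.Qf c x ≠ 0 := R.Q_ne x hx
  have e : dz (dzbar (fun w => (D.H (x 0) w : ℂ))) (zeta x) = _ :=
    dz_dzbar R.isOpen R.H_smooth hx
  rw [e, R.laplace_H hx, ← Complex.ofReal_add, Complex.ofReal_inj]
  have e0 : D.H (x 0) (zeta x) = 2 * (D.Qf c x / Pf c x * D.sigma c x) := by
    rw [sigma]; field_simp
  rw [e0]
  change _ + c / (3 * Pf c x ^ 2) * _ = 2 * κ * Pf c x / D.Qf c x * _ ↔ _
  rw [hf]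
  set W := waveOp (D.kjet c x) (D.dkjet c x)
  set N := ‖D.f (x 0) (zeta x)‖ ^ 2 + ‖D.g (x 0) (zeta x)‖ ^ 2
  have e1 : 2 * (D.Qf c x / Pf c x) * (W - 4 * c / (3 * Pf c x ^ 2) * D.sigma c x) / 4
      + c / (3 * Pf c x ^ 2) * (2 * (D.Qf c x / Pf c x * D.sigma c x))
      = Pf c x / (2 * D.Qf c x) * ((D.Qf c x / Pf c x) ^ 2 * W) := by
    field_simp; ring
  have e2 : 2 * κ * Pf c x / D.Qf c x * N = Pf c x / (2 * D.Qf c x) * (4 * κ * N) := by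
    field_simp; ring
  rw [e1, e2]
  have : Pf c x / (2 * D.Qf c x) ≠ 0 := by positivity
  exact ⟨fun h => mul_left_cancel₀ this h, fun h => by rw [h]⟩

end IsRegular

end WaveData

/-! ### The field equations -/

theorem isConfiguration_iff (p : Params) (U : Set Pt) (D : WaveData) (Γ : Pt → Arr3) :
    IsConfiguration p U D Γ ↔ D.IsRegular p.lam U ∧
      ∀ y ∈ U, Γ y = conn p.cA p.cB p.cC (D.kjet p.lam y) := by
  refine and_congr_right fun R => ?_
  exact forall₂_congr fun y hy => R.isTriplet_iff hy p Γ

namespace WaveData.IsRegular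

variable {p : Params} {D : WaveData} {U : Set Pt} (R : D.IsRegular p.lam U) {Γ : Pt → Arr3}
include R

theorem pd_ampF_sq {x : Pt} (hx : x ∈ U) :
    pd 2 (amp D.F) x ^ 2 + pd 3 (amp D.F) x ^ 2 = 4 * ‖D.f (x 0) (zeta x)‖ ^ 2 := by
  obtain ⟨-, h2, h3, -⟩ := pd_amp R.isOpen R.F_smooth R.F_prim hx
  rw [h2, h3, Complex.sq_norm, Complex.normSq_apply]; ring

theorem pd_ampG_sq {x : Pt} (hx : x ∈ U) :
    pd 2 (amp D.G) x ^ 2 + pd 3 (amp D.G) x ^ 2 = 4 * ‖D.g (x 0) (zeta x)‖ ^ 2 := by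
  obtain ⟨-, h2, h3, -⟩ := pd_amp R.isOpen R.G_smooth R.G_prim hx
  rw [h2, h3, Complex.sq_norm, Complex.normSq_apply]; ring

/-- The three conditions are the coefficients of the independent variations `∑ a, w a a` and `w 1 0`
of the coframe and `∑ c, w 1 c c` of the connection. The mass term in the coframe equation is a
multiple of the connection equation. -/
theorem isSolution_iff (hκ : p.κ ≠ 0)
    (hΓ : ∀ y ∈ U, Γ y = conn p.cA p.cB p.cC (D.kjet p.lam y)) :
    IsSolution p U (D.fields p.lam Γ) ↔ ∀ x ∈ U,
      p.lam * (p.a0 - 1) = 0 ∧ p.massCoeff * amp D.G x = 0 ∧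
      p.a0 / p.κ * (D.hf p.lam x * waveOp (D.kjet p.lam x) (D.dkjet p.lam x))
        = 4 * ‖D.f (x 0) (zeta x)‖ ^ 2
          + 4 * (p.z5 * p.k0 ^ 2 / p.ρ) * ‖D.g (x 0) (zeta x)‖ ^ 2 := by
  refine forall₂_congr fun x hx => ?_
  simp only [R.eulerLagrange_e hΓ hx, R.eulerLagrange_Γ hΓ hx, R.eulerLagrange_A hΓ hx,
    R.pd_ampF_sq hx, R.pd_ampG_sq hx, implies_true, and_true]
  have hh := (R.hf_pos hx).ne'
  have hk := (R.kf_pos hx).ne'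
  set W := waveOp (D.kjet p.lam x) (D.dkjet p.lam x)
  set ψ := amp D.G x
  constructor
  · rintro ⟨he, hg⟩
    have m0 : p.massCoeff * ψ = 0 := by
      have := hg (fun _ _ _ => 1)
      simp only [Finset.sum_const, Finset.card_univ, Fintype.card_fin, nsmul_eq_mul, mul_one,
        mul_eq_zero, neg_eq_zero, div_eq_zero_iff, hκ, hk, OfNat.ofNat_ne_zero, or_false,
        Nat.cast_ofNat] at this
      rcases this with h | h <;> simp [h]
    refine ⟨?_, m0, ?_⟩
    -- This variation has trace 1 and `w 1 0 = 0`; the next one has trace 0 and `w 1 0 = 1`.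
    · have := he ![![1, 0, 0, 0], 0, 0, 0]
      simpa [Fin.sum_univ_four, hh, hk, hκ] using this
    · have := he ![0, ![1, 0, 0, 0], 0, 0]
      simp [Fin.sum_univ_four] at this
      linear_combination this - kf p.lam x * p.k0 / (2 * p.κ) * ψ * m0
  · rintro ⟨h1, h2, h3⟩
    constructor
    · intro w
      linear_combination (D.hf p.lam x * kf p.lam x / p.κ * ∑ a, w a a) * h1
        + w 1 0 * h3 + kf p.lam x * p.k0 / (2 * p.κ) * ψ * w 1 0 * h2
    · intro w
      linear_combination (-(1 / (4 * p.κ)) * kf p.lam x * ∑ c, w 1 c c) * h2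

theorem waveEquation_iff : WaveEquation p U D ↔ ∀ x ∈ U,
    D.hf p.lam x * waveOp (D.kjet p.lam x) (D.dkjet p.lam x)
      = 4 * p.κ * (‖D.f (x 0) (zeta x)‖ ^ 2 + ‖D.g (x 0) (zeta x)‖ ^ 2) :=
  forall₂_congr fun _ hx => R.wave_iff hx p.κ

/-- If `2 Re G` vanished on the open set, so would its gradient, whose square is `4|g|²`. -/
theorem exists_ampG_ne_zero (h : ∃ x ∈ U, D.g (x 0) (zeta x) ≠ 0) : ∃ x ∈ U, amp D.G x ≠ 0 := by
  by_contra! h0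
  obtain ⟨x, hx, hg⟩ := h
  have e := R.pd_ampG_sq hx
  have z : ∀ ν, pd ν (amp D.G) x = 0 := fun ν => by
    rw [pd_congr R.isOpen (g := fun _ => 0) h0 hx]
    exact (HasPD.const 0).2 ν
  rw [z, z] at e
  simp at e
  exact hg e

end WaveData.IsRegular

theorem constraints_of_isSolution {p : Params} (hκ : p.κ ≠ 0) (hρ : p.ρ ≠ 0) (hk : p.k0 ≠ 0)
    {U : Set Pt} {D : WaveData} {Γ : Pt → Arr3} (hC : IsConfiguration p U D Γ)
    (hN : IsNondegenerate p U D) (hW : WaveEquation p U D)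
    (hS : IsSolution p U (D.fields p.lam Γ)) : p.Constraints := by
  obtain ⟨R, hΓ⟩ := (isConfiguration_iff p U D Γ).1 hC
  rw [R.waveEquation_iff] at hW
  rw [R.isSolution_iff hκ hΓ] at hS
  -- The wave equation is inserted into the null component of the coframe equation, which eliminates
  -- the metric function.
  have key : ∀ x ∈ U, p.a0 * (‖D.f (x 0) (zeta x)‖ ^ 2 + ‖D.g (x 0) (zeta x)‖ ^ 2)
      = ‖D.f (x 0) (zeta x)‖ ^ 2 + p.z5 * p.k0 ^ 2 / p.ρ * ‖D.g (x 0) (zeta x)‖ ^ 2 :=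
    fun x hx => by
      have := (hS x hx).2.2
      rw [hW x hx] at this
      field_simp at this ⊢
      linear_combination this
  obtain ⟨x, hx, hg⟩ := hN.1
  have hm : p.massCoeff = 0 := by
    obtain ⟨y, hy, h⟩ := R.exists_ampG_ne_zero hN.1
    exact (mul_eq_zero.1 (hS y hy).2.1).resolve_right h
  have ha : p.a0 = 1 := by
    by_contra ha
    have hl : p.lam = 0 := (mul_eq_zero.1 (hS x hx).1).resolve_right (sub_ne_zero.2 ha)
    -- If `a₀ ≠ 1`, then `λ = 0` and `key` can be solved for `|f|²`, with this ratio as constant;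
    -- nondegeneracy excludes that.
    obtain ⟨y, hy, h⟩ := hN.2 hl ((p.z5 * p.k0 ^ 2 / p.ρ - p.a0) / (p.a0 - 1))
    refine h ?_
    have h1 : p.a0 - 1 ≠ 0 := sub_ne_zero.2 ha
    rw [div_mul_eq_mul_div, eq_div_iff h1]
    linear_combination key y hy
  have hz : p.z5 = p.ρ / p.k0 ^ 2 := by
    have h := key x hx
    have hg' : ‖D.g (x 0) (zeta x)‖ ^ 2 ≠ 0 := pow_ne_zero 2 (norm_ne_zero_iff.2 hg)
    have : p.z5 * p.k0 ^ 2 / p.ρ = 1 := mul_right_cancel₀ hg' (by rw [ha] at h; linear_combination -h)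
    rw [div_eq_one_iff_eq hρ] at this
    rw [eq_div_iff (pow_ne_zero 2 hk), this]
  have hz0 : p.z5 ≠ 0 := by rw [hz]; exact div_ne_zero hρ (pow_ne_zero 2 hk)
  exact ⟨ha, hz, (p.massCoeff_eq_zero_of_mSq hk hκ hz0).1 hm⟩

theorem isSolution_iff_waveEquation {p : Params} (hκ : p.κ ≠ 0) (hρ : p.ρ ≠ 0) (hk : p.k0 ≠ 0)
    (hp : p.Constraints) {U : Set Pt} {D : WaveData} {Γ : Pt → Arr3}
    (hC : IsConfiguration p U D Γ) :
    IsSolution p U (D.fields p.lam Γ) ↔ WaveEquation p U D := by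
  obtain ⟨R, hΓ⟩ := (isConfiguration_iff p U D Γ).1 hC
  obtain ⟨ha, hz, hm⟩ := hp
  have hz0 : p.z5 ≠ 0 := by rw [hz]; exact div_ne_zero hρ (pow_ne_zero 2 hk)
  have hm' := (p.massCoeff_eq_zero_of_mSq hk hκ hz0).2 hm
  have hz1 : p.z5 * p.k0 ^ 2 / p.ρ = 1 := by rw [hz]; field_simp
  rw [R.isSolution_iff hκ hΓ, R.waveEquation_iff]
  refine forall₂_congr fun x _ => ?_
  simp only [ha, hm', hz1, sub_self, mul_zero, zero_mul, true_and, mul_one]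
  rw [div_mul_eq_mul_div, one_mul, div_eq_iff hκ]
  constructor <;> intro h <;> linear_combination h

/-! ### Witness configurations -/

/-- The connection of the Ansatz is given by the explicit formula `conn`, so a witness needs only
wave data that are regular, nondegenerate and satisfy (W). -/
theorem constraints_of_forall {p : Params} (hκ : p.κ ≠ 0) (hρ : p.ρ ≠ 0) (hk : p.k0 ≠ 0)
    {U : Set Pt} {D : WaveData} (R : D.IsRegular p.lam U) (hN : IsNondegenerate p U D)
    (hW : WaveEquation p U D)
    (h : ∀ (U : Set Pt) (D : WaveData) (Γ : Pt → Arr3),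
      IsConfiguration p U D Γ → WaveEquation p U D → IsSolution p U (D.fields p.lam Γ)) :
    p.Constraints := by
  have hC : IsConfiguration p U D (fun y => conn p.cA p.cB p.cC (D.kjet p.lam y)) :=
    (isConfiguration_iff p U D _).2 ⟨R, fun _ _ => rfl⟩
  exact constraints_of_isSolution hκ hρ hk hC hN hW (h U D _ hC hW)

/-- The plane wave data with `f = ζ` and `g = 1`. -/
def flatData (κ : ℝ) : WaveData where
  α _ := 1
  β _ := 0
  H _ z := 2 * κ * (Complex.normSq z ^ 2 / 4 + Complex.normSq z)
  f _ z := z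
  g _ _ := 1
  F _ z := z ^ 2 / 2
  G _ z := z

theorem contDiff_zeta : ContDiff ℝ ∞ zeta := by
  have : zeta = fun y => (y 2 : ℂ) + (y 3 : ℂ) * Complex.I := by
    funext y; apply Complex.ext <;> simp [zeta]
  rw [this]
  have h : ∀ i, ContDiff ℝ ∞ fun y : Pt => (y i : ℂ) := fun i =>
    Complex.ofRealCLM.contDiff.comp (contDiff_apply ℝ ℝ i)
  exact (h 2).add ((h 3).mul contDiff_const)

theorem normSq_zeta (y : Pt) : Complex.normSq (zeta y) = y 2 * y 2 + y 3 * y 3 := by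
  simp [zeta, Complex.normSq_apply]

/-- Naming the first derivatives `H2` and `H3` allows them to be simplified before the second
differentiation. -/
theorem dz_dzbar_of_hasPD {D : WaveData} {U : Set Pt} (hU : IsOpen U)
    (hH : ContDiffOn ℝ ∞ (fun y : Pt => D.H (y 0) (zeta y)) U) {H2 H3 : Pt → ℝ} {d2 d3 : Fin 4 → ℝ}
    (h1 : ∀ y ∈ U, ∃ d : Fin 4 → ℝ, HasPD (fun y => D.H (y 0) (zeta y)) d y ∧ d 2 = H2 y ∧ d 3 = H3 y)
    {x : Pt} (hx : x ∈ U) (h2 : HasPD H2 d2 x) (h3 : HasPD H3 d3 x) :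
    dz (dzbar (fun w => (D.H (x 0) w : ℂ))) (zeta x) = (((d2 2 + d3 3) / 4 : ℝ) : ℂ) := by
  have e : dz (dzbar (fun w => (D.H (x 0) w : ℂ))) (zeta x) = _ := dz_dzbar hU hH hx
  rw [e]
  congr 3
  · rw [pd_congr hU (fun y hy => by obtain ⟨d, h, e, -⟩ := h1 y hy; rw [h.2, e]) hx, h2.2]
  · rw [pd_congr hU (fun y hy => by obtain ⟨d, h, -, e⟩ := h1 y hy; rw [h.2, e]) hx, h3.2]

theorem flatData_isRegular (κ : ℝ) : (flatData κ).IsRegular 0 Set.univ where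
  isOpen := isOpen_univ
  P_ne x _ := by simp [WaveData.P]
  Q_ne x _ := by simp [WaveData.Q, flatData]
  α_smooth := contDiffOn_const
  β_smooth := contDiffOn_const
  H_smooth := by
    simp only [flatData, normSq_zeta]
    fun_prop
  F_smooth := ((contDiff_zeta.pow 2).div_const 2).contDiffOn
  G_smooth := contDiff_zeta.contDiffOn
  F_prim x _ := by
    simpa [flatData] using ((hasDerivAt_id (zeta x)).pow 2).div_const 2
  G_prim x _ := hasDerivAt_id _

/-- For `λ = 0` and this data `P = Q = 1`, and (W) reads `∂∂̄H = 2κ(|ζ|² + 1)`; the two terms of `H`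
account for `|f|²` and `|g|²`. -/
theorem flatData_wave {p : Params} (hl : p.lam = 0) :
    WaveEquation p Set.univ (flatData p.κ) := by
  intro x hx
  have h : ∀ y : Pt, HasPD (fun y => (flatData p.κ).H (y 0) (zeta y)) _ y := fun y =>
    ((((((HasPD.coord 2).mul (HasPD.coord 2)).add ((HasPD.coord 3).mul
      (HasPD.coord 3))).sq.div_const 4).add (((HasPD.coord 2).mul (HasPD.coord 2)).add
      ((HasPD.coord 3).mul (HasPD.coord 3)))).const_mul (2 * p.κ)).congr_fun
      (Filter.Eventually.of_forall fun y => by simp [flatData, normSq_zeta])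
  have c2 := HasPD.coord (x := x) 2
  have c3 := HasPD.coord (x := x) 3
  have e2 := (((((c2.mul c2).add (c3.mul c3)).add (HasPD.const 2)).mul c2).const_mul (2 * p.κ))
  have e3 := (((((c2.mul c2).add (c3.mul c3)).add (HasPD.const 2)).mul c3).const_mul (2 * p.κ))
  rw [dz_dzbar_of_hasPD isOpen_univ (flatData_isRegular p.κ).H_smooth (H2 := _) (H3 := _)
    (fun y _ => ⟨_, h y, ?_, ?_⟩) hx e2 e3, ← Complex.ofReal_add, Complex.ofReal_inj]
  · simp [flatData, WaveData.P, WaveData.Q, hl, Complex.sq_norm, normSq_zeta]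
    ring
  · simp only [Fin.isValue, Fin.reduceEq, if_true, if_false]; ring
  · simp only [Fin.isValue, Fin.reduceEq, if_true, if_false]; ring

theorem flatData_isNondegenerate (p : Params) :
    IsNondegenerate p Set.univ (flatData p.κ) := by
  refine ⟨⟨0, trivial, one_ne_zero⟩, fun _ r => ?_⟩
  by_contra! h
  -- At the origin `f = 0` and `g = 1`, so the ratio would be 0; at `ζ = 1` it would be 1.
  have h0 := h 0 trivial
  have h1 := h ![0, 0, 1, 0] trivial
  simp [flatData, Complex.sq_norm, normSq_zeta] at h0 h1
  rw [← h0] at h1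
  exact one_ne_zero h1

/-- The data with `α = 1`, `f = 0` and `g = 1` for `λ ≠ 0`. -/
def curvedData (κ c : ℝ) : WaveData where
  α _ := 1
  β _ := 0
  H _ z :=
    let s := c / 6 * Complex.normSq z
    12 * κ / c * (((1 - s) * s + 4 + 4 * ((1 - s) * Real.log (1 - s))) / (1 + s))
  f _ _ := 0
  g _ _ := 1
  F _ _ := 0
  G _ z := z

/-- The function `(λ/6) ζ ζ*`. -/
def radial (c : ℝ) (y : Pt) : ℝ := c / 6 * (y 2 * y 2 + y 3 * y 3)

/-- The domain `|(λ/6) ζ ζ*| < 1/2`. -/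
def curvedDomain (c : ℝ) : Set Pt := {y | |radial c y| < 1 / 2}

theorem continuous_radial (c : ℝ) : Continuous (radial c) := by unfold radial; fun_prop

theorem hasPD_radial (c : ℝ) (x : Pt) : HasPD (radial c) ![0, 0, c / 3 * x 2, c / 3 * x 3] x := by
  have h2 := HasPD.coord (x := x) 2
  have h3 := HasPD.coord (x := x) 3
  refine (((h2.mul h2).add (h3.mul h3)).const_mul (c / 6)).congr_pd fun ν => ?_
  fin_cases ν <;> simp <;> ring

theorem curvedDomain_pos {c : ℝ} {x : Pt} (hx : x ∈ curvedDomain c) :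
    0 < 1 + radial c x ∧ 0 < 1 - radial c x := by
  have := abs_lt.1 (show |radial c x| < 1 / 2 from hx)
  constructor <;> linarith

theorem curvedData_H (κ c : ℝ) (y : Pt) : (curvedData κ c).H (y 0) (zeta y)
    = 12 * κ / c * (((1 - radial c y) * radial c y + 4
      + 4 * ((1 - radial c y) * Real.log (1 - radial c y))) / (1 + radial c y)) := by
  simp only [curvedData, normSq_zeta]; rfl

theorem curvedData_Q (κ c : ℝ) (y : Pt) :
    (curvedData κ c).Q c (y 0) (zeta y) = 1 - radial c y := by
  simp [WaveData.Q, curvedData, normSq_zeta, radial]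

theorem P_zeta (c : ℝ) (y : Pt) : WaveData.P c (zeta y) = 1 + radial c y := by
  simp [WaveData.P, normSq_zeta, radial]

theorem curvedData_isRegular (κ c : ℝ) :
    (curvedData κ c).IsRegular c (curvedDomain c) where
  isOpen := isOpen_lt (continuous_radial c).abs continuous_const
  P_ne x hx := by rw [P_zeta]; exact (curvedDomain_pos hx).1.ne'
  Q_ne x hx := by rw [curvedData_Q]; exact (curvedDomain_pos hx).2.ne'
  α_smooth := contDiffOn_const
  β_smooth := contDiffOn_const
  H_smooth := by
    simp only [curvedData_H]
    have hs : ContDiffOn ℝ ∞ (radial c) (curvedDomain c) := by unfold radial; fun_prop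
    have hq : ContDiffOn ℝ ∞ (fun y => 1 - radial c y) (curvedDomain c) := contDiffOn_const.sub hs
    have hl := hq.log fun x hx => (curvedDomain_pos hx).2.ne'
    exact contDiffOn_const.mul ((((hq.mul hs).add contDiffOn_const).add
      (contDiffOn_const.mul (hq.mul hl))).div (contDiffOn_const.add hs)
      fun x hx => (curvedDomain_pos hx).1.ne')
  F_smooth := contDiffOn_const
  G_smooth := contDiff_zeta.contDiffOn
  F_prim x _ := hasDerivAt_const _ _
  G_prim x _ := hasDerivAt_id _

/-- For a function of `s = (λ/6)|ζ|²`, (W) becomes `(s H')' + 2H/(1+s)² = (12κ/λ)(1+s)/(1-s)`, whose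
homogeneous version is solved by `(1-s)/(1+s)`. The function `H` of `curvedData` is a particular
solution regular at `s = 0`, and `|s| < 1/2` keeps `P`, `Q` and the logarithm regular for both signs
of `λ`. -/
theorem curvedData_wave {p : Params} (hl : p.lam ≠ 0) :
    WaveEquation p (curvedDomain p.lam) (curvedData p.κ p.lam) := by
  have R := curvedData_isRegular p.κ p.lam
  have q : ∀ y, HasPD (fun y => 1 - radial p.lam y) _ y := fun y =>
    (HasPD.const 1).sub (hasPD_radial p.lam y)
  have l : ∀ y ∈ curvedDomain p.lam, HasPD (fun y => Real.log (1 - radial p.lam y)) _ y :=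
    fun y hy => (q y).log (curvedDomain_pos hy).2.ne'
  have h : ∀ y ∈ curvedDomain p.lam,
      HasPD (fun y => (curvedData p.κ p.lam).H (y 0) (zeta y)) _ y := fun y hy =>
    ((((((q y).mul (hasPD_radial p.lam y)).add (HasPD.const 4)).add
      (((q y).mul (l y hy)).const_mul 4)).div ((HasPD.const 1).add (hasPD_radial p.lam y))
      (curvedDomain_pos hy).1.ne').const_mul (12 * p.κ / p.lam)).congr_fun
      (Filter.Eventually.of_forall fun y => curvedData_H p.κ p.lam y)
  intro x hx
  obtain ⟨h1, h2⟩ := curvedDomain_pos hx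
  have r := hasPD_radial p.lam x
  -- `K` is `dH/ds = -(12κ/λ)(s² + 6s + 7 + 8 ln(1-s))/(1+s)²`; multiplied by `∇s = (λ/3)(x², x³)`
  -- it gives the gradient of `H`.
  have K := (((r.sq.add (r.const_mul 6)).add ((HasPD.const 7).add ((l x hx).const_mul 8))).div
    ((HasPD.const 1).add r).sq (pow_ne_zero 2 h1.ne')).const_mul (-(12 * p.κ / p.lam))
  have e2 := K.mul ((HasPD.coord (x := x) 2).const_mul (p.lam / 3))
  have e3 := K.mul ((HasPD.coord (x := x) 3).const_mul (p.lam / 3))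
  rw [dz_dzbar_of_hasPD R.isOpen R.H_smooth (H2 := _) (H3 := _)
    (fun y hy => ⟨_, h y hy, ?_, ?_⟩) hx e2 e3, ← Complex.ofReal_add, Complex.ofReal_inj,
    curvedData_H, P_zeta, curvedData_Q]
  · have hr : p.lam * (x 2 * x 2 + x 3 * x 3) = 6 * radial p.lam x := by rw [radial]; ring
    simp only [Fin.isValue, if_true, Matrix.cons_val, curvedData, norm_zero,
      norm_one]
    generalize radial p.lam x = s at *
    generalize Real.log (1 - s) = L at *
    field_simp
    linear_combination (-(12 * p.κ) * (((2 * s + 6) * (1 - s) - 8) * (1 + s)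
      - 2 * (1 - s) * (s * (s + 6) + (7 + 8 * L)))) * hr
  · obtain ⟨h1, h2⟩ := curvedDomain_pos hy
    simp only [Fin.isValue, Matrix.cons_val]
    field_simp; ring
  · obtain ⟨h1, h2⟩ := curvedDomain_pos hy
    simp only [Fin.isValue, Matrix.cons_val]
    field_simp; ring

theorem curvedData_isNondegenerate {p : Params} (hl : p.lam ≠ 0) :
    IsNondegenerate p (curvedDomain p.lam) (curvedData p.κ p.lam) :=
  ⟨⟨0, by simp [curvedDomain, radial], one_ne_zero⟩, fun h => absurd h hl⟩

end MAG

end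

theorem theorem4 (p : MAG.Params) (hκ : p.κ ≠ 0) (hρ : p.ρ ≠ 0) (hk : p.k0 ≠ 0) :
    -- under the constraints, a configuration is a solution iff the wave equation holds
    (p.Constraints →
      ∀ (U : Set MAG.Pt) (D : MAG.WaveData) (Γ : MAG.Pt → MAG.Arr3),
        MAG.IsConfiguration p U D Γ →
        (MAG.IsSolution p U (D.fields p.lam Γ) ↔ MAG.WaveEquation p U D)) ∧
    -- the constraints are necessary for the wave equation to yield solutions
    ((∀ (U : Set MAG.Pt) (D : MAG.WaveData) (Γ : MAG.Pt → MAG.Arr3),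
        MAG.IsConfiguration p U D Γ → MAG.WaveEquation p U D →
        MAG.IsSolution p U (D.fields p.lam Γ)) →
      p.Constraints) ∧
    -- they are necessary already for a single configuration, if it is not degenerate
    (∀ (U : Set MAG.Pt) (D : MAG.WaveData) (Γ : MAG.Pt → MAG.Arr3),
        MAG.IsConfiguration p U D Γ → MAG.IsNondegenerate p U D → MAG.WaveEquation p U D →
        MAG.IsSolution p U (D.fields p.lam Γ) → p.Constraints) := by
  refine ⟨fun hp U D Γ hC => MAG.isSolution_iff_waveEquation hκ hρ hk hp hC, fun h => ?_,
    fun U D Γ hC hN hW hS => MAG.constraints_of_isSolution hκ hρ hk hC hN hW hS⟩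
  -- For `λ ≠ 0` the trace equation already yields `a₀ = 1`, so `f = 0` is allowed; for `λ = 0` the
  -- witness must have `|f|²` not proportional to `|g|²`.
  by_cases hl : p.lam = 0
  · refine MAG.constraints_of_forall hκ hρ hk ?_ (MAG.flatData_isNondegenerate p)
      (MAG.flatData_wave hl) h
    rw [hl]; exact MAG.flatData_isRegular p.κ
  · exact MAG.constraints_of_forall hκ hρ hk (MAG.curvedData_isRegular p.κ p.lam)
      (MAG.curvedData_isNondegenerate hl) (MAG.curvedData_wave hl) h
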